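/- Let $n\in\{2,3\}$ and $d\ge 3$. Let $\mathcal Q_n^d$ be the space of forms of degree $d$ in $z_1,\dots,z_n$ over $\mathbb C$. A discriminant $\Delta$ on $\mathcal Q_n^d$ is an irreducible polynomial in the coefficients of $f\in\mathcal Q_n^d$ whose zero set is the set of those $f$ whose first partial derivatives have a common zero in $\mathbb C^n\setminus\{0\}$; such a $\Delta$ is unique up to a nonzero constant factor. For $f$ with $\Delta(f)\ne0$ let $M_f=\mathbb C[z_1,\dots,z_n]/(\partial f/\partial z_1,\dots,\partial f/\partial z_n)$ be the Milnor algebra, let $H(f)=\det(\partial^2f/\partial z_i\partial z_j)$ be the Hessian, whose class spans the one-dimensional socle of $M_f$, and let $\omega$ be the linear functional on the socle with $\omega(H(f))=1$. For $i_1+\dots+i_n=n(d-2)$ let $\mu_{i_1,\dots,i_n}(f)\in\mathbb C$ be given by $z_1^{i_1}\cdots z_n^{i_n}=\mu_{i_1,\dots,i_n}(f)\,H(f)$ in $M_f$, and let the associated form of $f$ be $$\Phi(f)(z^*)=\omega\bigl((z_1^*z_1+\dots+z_n^*z_n)^{n(d-2)}\bigr)=\sum_{i_1+\dots+i_n=n(d-2)}\frac{(n(d-2))!}{i_1!\cdots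 i_n!}\,\mu_{i_1,\dots,i_n}(f)\,z_1^{*\,i_1}\cdots z_n^{*\,i_n},\qquad z^*\in\mathbb C^{n*}.$$ Then a discriminant exists, and for every discriminant $\Delta$ the following hold. (1) For each $(i_1,\dots,i_n)$ with $i_1+\dots+i_n=n(d-2)$ there is a smallest nonnegative integer $p_{i_1,\dots,i_n}$ such that $\Delta^{p_{i_1,\dots,i_n}}\mu_{i_1,\dots,i_n}$ extends to a polynomial function on $\mathcal Q_n^d$, and $$\max\{p_{i_1,\dots,i_n} : i_1+\dots+i_n=n(d-2)\}=1.$$ (2) $\Delta\Phi$ extends to a contravariant of forms in $\mathcal Q_n^d$ of weight $d(d-1)^{n-1}-2$, degree $n(d-1)^{n-1}-n$ and class $n(d-2)$. That is, there is a polynomial $\Lambda\in\mathbb C[\mathcal Q_n^d\times\mathbb C^{n*}]$, homogeneous of degree $n(d-1)^{n-1}-n$ in the coefficients of $f$ and homogeneous of degree $n(d-2)$ in $z^*$, such that $\Lambda(f,z^*)=\Delta(f)\,\Phi(f)(z^*)$ whenever $\Delta(f)\ne0$, and $$\Lambda(f,z^*)=(\det C)^{d(d-1)^{n-1}-2}\,\Lambda(C\cdot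 f,\,C\cdot z^*)$$ for all $f\in\mathcal Q_n^d$, $z^*\in\mathbb C^{n*}$ and $C\in\mathrm{GL}_n(\mathbb C)$, where $(C\cdot f)(z)=f(C^{-1}z)$ and $C\cdot z^*=(z_1^*,\dots,z_n^*)\,C^{-1}$. -/

import Mathlib

namespace AssocForm

open MvPolynomial

noncomputable section

/-- Exponent vectors of the monomials of degree `d` in `n` variables. They index the coefficients of
the forms of degree `d`, hence the coordinates on the vector space of these forms. -/
abbrev Exps (n d : ℕ) : Type := {m : Fin n →₀ ℕ // m.degree = d}

/-- The coordinates (that is, the coefficients) of a form `f` of degree `d` in `n` variables. -/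
def coords {n : ℕ} (d : ℕ) (f : MvPolynomial (Fin n) ℂ) : Exps n d → ℂ :=
  fun m => f.coeff m.1

/-- The value at the form `f` of a polynomial function `P` on the space of forms of degree `d`. -/
def evalForm {n d : ℕ} (P : MvPolynomial (Exps n d) ℂ) (f : MvPolynomial (Fin n) ℂ) : ℂ :=
  eval (coords d f) P

/-- The hypersurface `f = 0` has a singular point away from the origin, i.e. all first partial
derivatives of `f` have a common zero other than the origin. -/
def IsSingularForm {n : ℕ} (f : MvPolynomial (Fin n) ℂ) : Prop :=
  ∃ z : Fin n → ℂ, z ≠ 0 ∧ ∀ i, eval z (pderiv i f) = 0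

/-- `Δ` is a discriminant of forms of degree `d` in `n` variables: an irreducible polynomial in the
coefficients whose zero set is the set of the singular forms. By the Nullstellensatz this determines
`Δ` up to a nonzero constant factor. -/
def IsDiscriminant (n d : ℕ) (Δ : MvPolynomial (Exps n d) ℂ) : Prop :=
  Irreducible Δ ∧
    ∀ f : MvPolynomial (Fin n) ℂ, f.IsHomogeneous d → (evalForm Δ f = 0 ↔ IsSingularForm f)

/-- The Jacobian ideal `(∂f/∂z₁, …, ∂f/∂zₙ)`. -/
def jacobianIdeal {n : ℕ} (f : MvPolynomial (Fin n) ℂ) : Ideal (MvPolynomial (Fin n) ℂ) :=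
  Ideal.span (Set.range fun i => pderiv i f)

/-- The Milnor algebra `ℂ[z₁, …, zₙ] / (∂f/∂z₁, …, ∂f/∂zₙ)`. -/
abbrev MilnorAlgebra {n : ℕ} (f : MvPolynomial (Fin n) ℂ) : Type :=
  MvPolynomial (Fin n) ℂ ⧸ jacobianIdeal f

/-- The class of a polynomial in the Milnor algebra of `f`. -/
def toMilnor {n : ℕ} (f g : MvPolynomial (Fin n) ℂ) : MilnorAlgebra f :=
  Ideal.Quotient.mk (jacobianIdeal f) g

/-- The Hessian `H(f)`: the determinant of the matrix of second partial derivatives. -/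
def hessian {n : ℕ} (f : MvPolynomial (Fin n) ℂ) : MvPolynomial (Fin n) ℂ :=
  (Matrix.of fun i j => pderiv i (pderiv j f)).det

open Classical in
/-- The functional `ω` with `ω(H(f)) = 1` on the socle of the Milnor algebra of `f`: for
nondegenerate `f` the socle is the line spanned by the class of the Hessian, and `ω x` is the unique
`c` with `x = c • H(f)`. Elements that are not a multiple of the Hessian get the value `0`. -/
def omega {n : ℕ} (f : MvPolynomial (Fin n) ℂ) (x : MilnorAlgebra f) : ℂ :=
  if h : ∃ c : ℂ, x = c • toMilnor f (hessian f) then h.choose else 0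

/-- The coefficient `μ_i(f)`, given by `z₁^{i₁} ⋯ zₙ^{iₙ} = μ_i(f) H(f)` in the Milnor algebra
of `f`, where `i₁ + ⋯ + iₙ = n (d - 2)`. -/
def mu {n d : ℕ} (i : Exps n (n * (d - 2))) (f : MvPolynomial (Fin n) ℂ) : ℂ :=
  omega f (toMilnor f (monomial i.1 1))

/-- The value at `z*` of the associated form of `f`, a form of degree `d`:
`ω((z₁* z₁ + ⋯ + zₙ* zₙ) ^ (n (d - 2)))`. -/
def associatedForm {n : ℕ} (d : ℕ) (f : MvPolynomial (Fin n) ℂ) (w : Fin n → ℂ) : ℂ :=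
  omega f ((∑ j, w j • toMilnor f (X j)) ^ (n * (d - 2)))

/-- The product `Δ ^ q • u`, where `u` is a function on the set of the forms `f` of degree `d` with
`Δ(f) ≠ 0`, extends to a polynomial function on the space of all forms of degree `d`. -/
def ClearsDenominator {n d : ℕ} (Δ : MvPolynomial (Exps n d) ℂ)
    (u : MvPolynomial (Fin n) ℂ → ℂ) (q : ℕ) : Prop :=
  ∃ P : MvPolynomial (Exps n d) ℂ, ∀ f : MvPolynomial (Fin n) ℂ, f.IsHomogeneous d →
    evalForm Δ f ≠ 0 → evalForm P f = evalForm Δ f ^ q * u f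

/-- The action of `GLₙ` on forms, `(C · f)(z) = f(C⁻¹ z)`. -/
def actForm {n : ℕ} (C : GL (Fin n) ℂ) (f : MvPolynomial (Fin n) ℂ) : MvPolynomial (Fin n) ℂ :=
  bind₁ (fun i => ∑ j, MvPolynomial.C ((C⁻¹).val i j) * X j) f

/-- The action of `GLₙ` on the dual space, `C · z* = (z₁*, …, zₙ*) C⁻¹`. -/
def actDual {n : ℕ} (C : GL (Fin n) ℂ) (w : Fin n → ℂ) : Fin n → ℂ :=
  Matrix.vecMul w (C⁻¹).val

/-- The value at `(f, z*)` of a polynomial function on the product of the space of forms of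
degree `d` in `n` variables with the dual space of `ℂⁿ`. -/
def evalPair {n d : ℕ} (L : MvPolynomial (Exps n d ⊕ Fin n) ℂ)
    (f : MvPolynomial (Fin n) ℂ) (w : Fin n → ℂ) : ℂ :=
  eval (Sum.elim (coords d f) w) L

/-- `L` is a contravariant of weight `k` of forms of degree `d` in `n` variables:
`L(f, z*) = (det C) ^ k L(C · f, C · z*)` for all `f`, `z*` and `C`. -/
def IsContravariant {n d : ℕ} (L : MvPolynomial (Exps n d ⊕ Fin n) ℂ) (k : ℕ) : Prop :=
  ∀ (f : MvPolynomial (Fin n) ℂ), f.IsHomogeneous d → ∀ (w : Fin n → ℂ) (C : GL (Fin n) ℂ),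
    evalPair L f w = C.val.det ^ k * evalPair L (actForm C f) (actDual C w)

/-- `L` is homogeneous of degree `K` in the coefficients of the form. -/
def HasDegree {n d : ℕ} (L : MvPolynomial (Exps n d ⊕ Fin n) ℂ) (K : ℕ) : Prop :=
  IsWeightedHomogeneous (Sum.elim (fun _ => 1) (fun _ => 0) : Exps n d ⊕ Fin n → ℕ) L K

/-- `L` has class `D`, i.e. is homogeneous of degree `D` in the variables `z*`. -/
def HasClass {n d : ℕ} (L : MvPolynomial (Exps n d ⊕ Fin n) ℂ) (D : ℕ) : Prop :=
  IsWeightedHomogeneous (Sum.elim (fun _ => 0) (fun _ => 1) : Exps n d ⊕ Fin n → ℕ) L D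

end

end AssocForm

/-!
The proof writes the discriminant as one explicit square determinant, of which the `μ_i` times the
discriminant are minors up to a constant.

Let `Bez(x, y)` be the determinant of divided differences of the partial derivatives of `f`
(`bez`), a form of degree `n (d - 2)` in `x` and `y` together. The determinant of Sylvester type
`discDet` has its rows indexed by the monomials of degree `(n - 1) (d - 2)`. Its columns are the
products `z ^ α ∂f/∂zᵢ` of this degree, and the coefficients of `Bez(x, y)` at the monomials of
degree `d - 2` in `y`. This matrix is square for `n = 2` and `n = 3` (`card_sylvesterCols`).

* At a singular form the row of the monomials evaluated at a singular point is annihilated by the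
  matrix (`exists_vecMul_sylvester_eq_zero`), so the determinant vanishes.
* For a nonsingular form the Nullstellensatz gives `Xᵢ ^ k = ∑ⱼ bᵢⱼ ∂ⱼf`, and the coefficient of
  `(X₁ ⋯ Xₙ) ^ (k - 1)` in `g det(b)` defines a residue functional. The Bezoutian is its reproducing
  kernel modulo the Jacobian ideal (`exists_residue`); this rests on Wiebe's lemma that the
  determinant of a matrix expressing the powers `yᵢ ^ k` through the `yⱼ - xⱼ` is unique modulo these powers
  (`det_sub_det_mem_powIdeal`). Comparison with the Hessian shows that the residue is
  `(d - 1) ^ n ω` in degree `n (d - 2)` (`omega_toMilnor_eq`).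
* Hence a row vector annihilated by the first kind of columns is determined by its products with the
  second kind, with the values of the residue as coefficients (`eq_sum_residue_mul`). So the
  determinant does not vanish at nonsingular forms, and, applied to the rows of the adjugate matrix,
  the products `discDet • μ_i` are polynomials (`exists_evalForm_eq_discDet_mul_mu`).

Starting from a nonsingular form, a polynomial `Δ` that vanishes exactly at the singular forms is
constant along transvections and a monomial along diagonal matrices, so `Δ(f(A z)) = det(A) ^ E Δ(f)`
(`evalForm_subst_eq_det_pow_mul`), where `E = d (d - 1) ^ (n - 1)` by the degree of the determinant.
Any two singular forms lie on a rational curve of singular forms, so the singular locus is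
irreducible and the determinant is a power of a prime (`exists_prime_associated_pow`). Its order of
vanishing in `t` on `t x ^ d + y ^ d` and on `t x ^ d + x y ^ (d - 1)`, and on the analogous families
in three variables, is computed by diagonal substitutions. The two orders are coprime, so the exponent
is one and the determinant is a discriminant (`isDiscriminant_discDet`). Discriminants are unique up
to a constant by the Nullstellensatz.

Consequently one power of `Δ` clears every denominator, while a nonzero `μ_i` has negative degree
and is not itself a polynomial (`not_clearsDenominator_zero`). The Hessian of `f(A z)` is `det(A) ^ 2`
times the substituted Hessian, so the associated form has weight `-2` and `Δ Φ` has weight `E - 2`;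
scalar matrices then give its degree.
-/

namespace AssocForm

open MvPolynomial

noncomputable section

/-! ### Divided differences and the Bezoutian -/

section Bezoutian

variable {n : ℕ} {R : Type*} [CommRing R]

/-- The `j`-th telescoping divided difference of the monomial `z ^ α`: the quotient of
`x₁^α₁ ⋯ xⱼ^αⱼ yⱼ₊₁^αⱼ₊₁ ⋯ yₙ^αₙ - x₁^α₁ ⋯ yⱼ^αⱼ yⱼ₊₁^αⱼ₊₁ ⋯ yₙ^αₙ` by `xⱼ - yⱼ`. Polynomials in two
sets of variables are encoded as polynomials in `y` whose coefficients are polynomials in `x`, so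
that `xⱼ` is `C (X j)` and `yⱼ` is `X j`. -/
def divDiffMonomial (R : Type*) [CommRing R] (j : Fin n) (α : Fin n →₀ ℕ) :
    MvPolynomial (Fin n) (MvPolynomial (Fin n) R) :=
  (∏ l with l < j, C (X l) ^ α l) *
    (∑ p ∈ Finset.range (α j), C (X j) ^ p * X j ^ (α j - 1 - p)) * ∏ l with j < l, X l ^ α l

/-- The `j`-th divided difference, extended linearly from the monomials. -/
def divDiff (j : Fin n) :
    MvPolynomial (Fin n) R →ₗ[R] MvPolynomial (Fin n) (MvPolynomial (Fin n) R) :=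
  (basisMonomials (Fin n) R).constr R (divDiffMonomial R j)

theorem divDiff_monomial (j : Fin n) (α : Fin n →₀ ℕ) (c : R) :
    divDiff j (monomial α c) = C (C c) * divDiffMonomial R j α := by
  have h : monomial α c = c • basisMonomials (Fin n) R α := by
    simp [smul_monomial]
  rw [h, map_smul, divDiff, Module.Basis.constr_basis, ← algebraMap_eq, ← algebraMap_eq,
    Algebra.smul_def]
  rfl

theorem monomial_eq_C_mul_prod (α : Fin n →₀ ℕ) (c : R) :
    monomial α c = C c * ∏ i, X i ^ α i := by
  rw [monomial_eq, Finsupp.prod_fintype _ _ (by simp)]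

/-- The divided differences realise `f(x) - f(y)` as a combination of the `xⱼ - yⱼ`. -/
theorem sum_divDiff (f : MvPolynomial (Fin n) R) :
    ∑ j, divDiff j f * (C (X j) - X j) = C f - map C f := by
  induction f using MvPolynomial.induction_on' with
  | monomial α c =>
    have key := Finset.prod_add_ordered Finset.univ
      (fun i => (X i : MvPolynomial (Fin n) (MvPolynomial (Fin n) R)) ^ α i)
      (fun i => C (X i) ^ α i - X i ^ α i)
    simp only [add_sub_cancel] at key
    have h1 : C (monomial α c) - map C (monomial α c) =
        C (C c) * (∏ i, C (X i) ^ α i - ∏ i, X i ^ α i) := by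
      rw [map_monomial, monomial_eq_C_mul_prod, monomial_eq_C_mul_prod]
      simp [mul_sub]
    rw [h1, key, add_sub_cancel_left, Finset.mul_sum]
    refine Finset.sum_congr rfl fun j _ => ?_
    rw [divDiff_monomial, divDiffMonomial, ← geom_sum₂_mul]
    ring
  | add p q hp hq =>
    simp only [map_add, add_mul, Finset.sum_add_distrib, hp, hq]
    ring

theorem divDiff_map {R' : Type*} [CommRing R'] (φ : R →+* R') (j : Fin n)
    (f : MvPolynomial (Fin n) R) :
    divDiff j (map φ f) = map (map φ) (divDiff j f) := by
  induction f using MvPolynomial.induction_on' with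
  | monomial α c =>
    simp [map_monomial, divDiff_monomial, divDiffMonomial]
  | add p q hp hq => simp only [map_add, hp, hq]

/-- A polynomial in two sets of variables is homogeneous of degree `k` in all variables together. -/
def IsTotallyHomogeneous (P : MvPolynomial (Fin n) (MvPolynomial (Fin n) R)) (k : ℕ) : Prop :=
  ∀ β γ, coeff γ (coeff β P) ≠ 0 → γ.degree + β.degree = k

namespace IsTotallyHomogeneous

variable {P Q : MvPolynomial (Fin n) (MvPolynomial (Fin n) R)} {k l : ℕ}

theorem zero : IsTotallyHomogeneous (0 : MvPolynomial (Fin n) (MvPolynomial (Fin n) R)) k := by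
  intro β γ h
  simp at h

theorem add (hP : IsTotallyHomogeneous P k) (hQ : IsTotallyHomogeneous Q k) :
    IsTotallyHomogeneous (P + Q) k := by
  intro β γ h
  rw [coeff_add, coeff_add] at h
  by_cases h1 : coeff γ (coeff β P) = 0
  · rw [h1, zero_add] at h
    exact hQ β γ h
  · exact hP β γ h1

theorem sum {ι : Type*} (s : Finset ι)
    (F : ι → MvPolynomial (Fin n) (MvPolynomial (Fin n) R))
    (h : ∀ i ∈ s, IsTotallyHomogeneous (F i) k) : IsTotallyHomogeneous (∑ i ∈ s, F i) k := by
  classical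
  induction s using Finset.induction_on with
  | empty => simpa using zero
  | insert a s ha ih =>
    rw [Finset.sum_insert ha]
    exact (h a (by simp)).add (ih fun i hi => h i (by simp [hi]))

theorem mul (hP : IsTotallyHomogeneous P k) (hQ : IsTotallyHomogeneous Q l) :
    IsTotallyHomogeneous (P * Q) (k + l) := by
  classical
  intro β γ h
  rw [coeff_mul, coeff_sum] at h
  obtain ⟨⟨β₁, β₂⟩, hβ, h⟩ := Finset.exists_ne_zero_of_sum_ne_zero h
  rw [coeff_mul] at h
  obtain ⟨⟨γ₁, γ₂⟩, hγ, h⟩ := Finset.exists_ne_zero_of_sum_ne_zero h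
  rw [Finset.HasAntidiagonal.mem_antidiagonal] at hβ hγ
  have h1 := hP β₁ γ₁ (left_ne_zero_of_mul h)
  have h2 := hQ β₂ γ₂ (right_ne_zero_of_mul h)
  simp only at hβ hγ
  rw [← hβ, ← hγ, map_add, map_add]
  omega

theorem C_C (c : R) :
    IsTotallyHomogeneous (C (C c) : MvPolynomial (Fin n) (MvPolynomial (Fin n) R)) 0 := by
  classical
  intro β γ h
  rw [coeff_C] at h
  split_ifs at h with h1
  · rw [coeff_C] at h
    split_ifs at h with h2
    · simp [← h1, ← h2]
    · exact absurd rfl h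
  · simp at h

theorem X (j : Fin n) :
    IsTotallyHomogeneous
      (MvPolynomial.X j : MvPolynomial (Fin n) (MvPolynomial (Fin n) R)) 1 := by
  classical
  intro β γ h
  rw [coeff_X] at h
  split_ifs at h with h1
  · rw [coeff_one] at h
    split_ifs at h with h2
    · simp [← h1, ← h2]
    · exact absurd rfl h
  · simp at h

theorem C_X (j : Fin n) :
    IsTotallyHomogeneous
      (C (MvPolynomial.X j) : MvPolynomial (Fin n) (MvPolynomial (Fin n) R)) 1 := by
  classical
  intro β γ h
  rw [coeff_C] at h
  split_ifs at h with h1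
  · rw [coeff_X] at h
    split_ifs at h with h2
    · simp [← h1, ← h2]
    · exact absurd rfl h
  · simp at h

theorem pow (hP : IsTotallyHomogeneous P k) (r : ℕ) : IsTotallyHomogeneous (P ^ r) (r * k) := by
  induction r with
  | zero => simpa using C_C (n := n) (1 : R)
  | succ r ih =>
    rw [pow_succ, add_mul, one_mul]
    exact ih.mul hP

theorem prod {ι : Type*} (s : Finset ι)
    (F : ι → MvPolynomial (Fin n) (MvPolynomial (Fin n) R)) (e : ι → ℕ)
    (h : ∀ i ∈ s, IsTotallyHomogeneous (F i) (e i)) :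
    IsTotallyHomogeneous (∏ i ∈ s, F i) (∑ i ∈ s, e i) := by
  classical
  induction s using Finset.induction_on with
  | empty => simpa using C_C (n := n) (1 : R)
  | insert a s ha ih =>
    rw [Finset.prod_insert ha, Finset.sum_insert ha]
    exact (h a (by simp)).mul (ih fun i hi => h i (by simp [hi]))

theorem det {A : Matrix (Fin n) (Fin n) (MvPolynomial (Fin n) (MvPolynomial (Fin n) R))}
    (h : ∀ i j, IsTotallyHomogeneous (A i j) k) : IsTotallyHomogeneous A.det (n * k) := by
  rw [Matrix.det_apply']
  refine sum _ _ fun τ _ => ?_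
  have h1 := prod Finset.univ (fun i => A (τ i) i) (fun _ => k) fun i _ => h _ _
  have h2 := (C_C (n := n) ((Equiv.Perm.sign τ : ℤ) : R)).mul h1
  simpa using h2

theorem isHomogeneous_coeff (hP : IsTotallyHomogeneous P k) {β : Fin n →₀ ℕ} {e : ℕ}
    (h : e + β.degree = k) : (coeff β P).IsHomogeneous e := by
  intro γ hγ
  have := hP β γ hγ
  have e' : Finsupp.weight 1 γ = γ.degree := by
    rw [Finsupp.degree_eq_weight_one]
    rfl
  omega

end IsTotallyHomogeneous

theorem isTotallyHomogeneous_divDiffMonomial (j : Fin n) (α : Fin n →₀ ℕ) {k : ℕ}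
    (h : α.degree = k + 1) : IsTotallyHomogeneous (divDiffMonomial R j α) k := by
  rcases Nat.eq_zero_or_pos (α j) with h0 | h0
  · simpa [divDiffMonomial, h0] using IsTotallyHomogeneous.zero
  have hsum : ∑ l with l < j, α l + (α j + ∑ l with j < l, α l) = k + 1 := by
    rw [← h, Finsupp.degree_eq_sum, ← Finset.sum_filter_add_sum_filter_not Finset.univ (· < j),
      ← Finset.sum_filter_add_sum_filter_not (Finset.univ.filter fun x => ¬ x < j) (j < ·),
      Finset.filter_filter, Finset.filter_filter]
    have e1 : (Finset.univ.filter fun a => ¬ a < j ∧ j < a) = Finset.univ.filter (j < ·) := by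
      ext a; simp only [Finset.mem_filter, Finset.mem_univ, true_and]; omega
    have e2 : (Finset.univ.filter fun a => ¬ a < j ∧ ¬ j < a) = {j} := by
      ext a; simp only [Finset.mem_filter, Finset.mem_univ, true_and, Finset.mem_singleton]; omega
    rw [e1, e2, Finset.sum_singleton]
    omega
  have h1 := IsTotallyHomogeneous.prod (R := R) (Finset.univ.filter (· < j))
    (fun l => C (X l) ^ α l) α fun l _ => by simpa using (IsTotallyHomogeneous.C_X l).pow (α l)
  have h3 := IsTotallyHomogeneous.prod (R := R) (Finset.univ.filter (j < ·))
    (fun l => X l ^ α l) α fun l _ => by simpa using (IsTotallyHomogeneous.X l).pow (α l)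
  have h2 : IsTotallyHomogeneous (R := R)
      (∑ p ∈ Finset.range (α j), C (X j) ^ p * X j ^ (α j - 1 - p)) (α j - 1) := by
    refine IsTotallyHomogeneous.sum _ _ fun p hp => ?_
    have := ((IsTotallyHomogeneous.C_X (R := R) j).pow p).mul
      ((IsTotallyHomogeneous.X (R := R) j).pow (α j - 1 - p))
    have hp' := Finset.mem_range.1 hp
    have e : p * 1 + (α j - 1 - p) * 1 = α j - 1 := by omega
    rwa [e] at this
  have := (h1.mul h2).mul h3
  have e : ∑ l with l < j, α l + (α j - 1) + ∑ l with j < l, α l = k := by omega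
  rw [e] at this
  exact this

theorem isTotallyHomogeneous_divDiff (j : Fin n) {f : MvPolynomial (Fin n) R} {k : ℕ}
    (h : f.IsHomogeneous (k + 1)) : IsTotallyHomogeneous (divDiff j f) k := by
  rw [f.as_sum, map_sum]
  refine IsTotallyHomogeneous.sum _ _ fun α hα => ?_
  rw [divDiff_monomial]
  have h1 : α.degree = k + 1 := by
    rw [Finsupp.degree_eq_weight_one]
    exact h (mem_support_iff.1 hα)
  simpa using (IsTotallyHomogeneous.C_C (coeff α f)).mul
    (isTotallyHomogeneous_divDiffMonomial (R := R) j α h1)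

/-- The matrix of the divided differences of the first partial derivatives of `f`. -/
def bezMatrix (f : MvPolynomial (Fin n) R) :
    Matrix (Fin n) (Fin n) (MvPolynomial (Fin n) (MvPolynomial (Fin n) R)) :=
  Matrix.of fun i j => divDiff j (pderiv i f)

/-- The Bezoutian (or Morley form) of the first partial derivatives of `f`. -/
def bez (f : MvPolynomial (Fin n) R) : MvPolynomial (Fin n) (MvPolynomial (Fin n) R) :=
  (bezMatrix f).det

theorem bezMatrix_mulVec (f : MvPolynomial (Fin n) R) :
    (bezMatrix f).mulVec (fun j => C (X j) - X j) =
      fun i => C (pderiv i f) - map C (pderiv i f) := by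
  funext i
  rw [← sum_divDiff]
  rfl

theorem bezMatrix_map {R' : Type*} [CommRing R'] (φ : R →+* R') (f : MvPolynomial (Fin n) R) :
    bezMatrix (map φ f) = (map (map φ)).mapMatrix (bezMatrix f) := by
  ext i j : 2
  simp [bezMatrix, pderiv_map, divDiff_map]

theorem bez_map {R' : Type*} [CommRing R'] (φ : R →+* R') (f : MvPolynomial (Fin n) R) :
    bez (map φ f) = map (map φ) (bez f) := by
  rw [bez, bezMatrix_map, bez, RingHom.map_det]

theorem bez_smul (c : R) (f : MvPolynomial (Fin n) R) : bez (c • f) = c ^ n • bez f := by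
  have h : bezMatrix (c • f) = c • bezMatrix f := by
    ext i j : 2
    simp [bezMatrix]
  rw [bez, h, bez]
  have := Matrix.det_smul (bezMatrix f)
    (C (C c) : MvPolynomial (Fin n) (MvPolynomial (Fin n) R))
  have e : ∀ P : MvPolynomial (Fin n) (MvPolynomial (Fin n) R), ∀ b : R, b • P = C (C b) * P := by
    intro P b
    rw [Algebra.smul_def]
    rfl
  rw [e, map_pow, map_pow]
  rw [Fintype.card_fin] at this
  rw [← this]
  congr 1
  ext i j : 2
  simp [e]

theorem isTotallyHomogeneous_bez {f : MvPolynomial (Fin n) R} {k : ℕ}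
    (h : f.IsHomogeneous (k + 2)) : IsTotallyHomogeneous (bez f) (n * k) :=
  IsTotallyHomogeneous.det fun _ j => isTotallyHomogeneous_divDiff j (k := k) h.pderiv

theorem det_smul_eq_adjugate_mulVec {ι A : Type*} [Fintype ι] [DecidableEq ι] [CommRing A]
    {M : Matrix ι ι A} {u w : ι → A} (h : M.mulVec u = w) : M.det • u = M.adjugate.mulVec w := by
  rw [← h, Matrix.mulVec_mulVec, Matrix.adjugate_mul, Matrix.smul_mulVec, Matrix.one_mulVec]

end Bezoutian

/-! ### Matrices that express powers of the variables through `Xⱼ - xⱼ` -/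

section Wiebe

variable {n : ℕ} {B : Type*} [CommRing B]

/-- Membership in an ideal generated by powers of variables, read off the coefficients. -/
theorem mem_span_X_pow_iff {k : ℕ} {S : Set (Fin n)} {P : MvPolynomial (Fin n) B} :
    P ∈ Ideal.span ((fun l => (X l : MvPolynomial (Fin n) B) ^ k) '' S) ↔
      ∀ β : Fin n →₀ ℕ, (∀ l ∈ S, β l < k) → coeff β P = 0 := by
  have e : (fun l => (X l : MvPolynomial (Fin n) B) ^ k) '' S =
      (fun s => monomial s (1 : B)) '' ((fun l => Finsupp.single l k) '' S) := by
    rw [Set.image_image]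
    simp only [X_pow_eq_monomial]
  rw [e, mem_ideal_span_monomial_image]
  constructor
  · intro h β hβ
    by_contra hne
    obtain ⟨_, ⟨l, hl, rfl⟩, hle⟩ := h β (mem_support_iff.2 hne)
    have := hle l
    simp only [Finsupp.single_eq_same] at this
    exact absurd (hβ l hl) (by omega)
  · intro h β hβ
    by_contra! hcon
    refine mem_support_iff.1 hβ (h β fun l hl => ?_)
    by_contra! hlt
    refine hcon _ ⟨l, hl, rfl⟩ ?_
    rwa [Finsupp.single_le_iff]

/-- `Xᵢ - x` is a nonzerodivisor modulo powers of the other variables. -/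
theorem mem_span_X_pow_of_X_sub_C_mul_mem {k : ℕ} {S : Set (Fin n)} {i : Fin n} (hi : i ∉ S) (x : B)
    {P : MvPolynomial (Fin n) B}
    (h : (X i - C x) * P ∈ Ideal.span ((fun l => (X l : MvPolynomial (Fin n) B) ^ k) '' S)) :
    P ∈ Ideal.span ((fun l => (X l : MvPolynomial (Fin n) B) ^ k) '' S) := by
  rw [mem_span_X_pow_iff] at h ⊢
  have step : ∀ β : Fin n →₀ ℕ, (∀ l ∈ S, β l < k) →
      coeff β P = x * coeff (β + Finsupp.single i 1) P := by
    intro β hβ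
    have := h (Finsupp.single i 1 + β) fun l hl => by
      have hne : i ≠ l := fun hil => hi (hil ▸ hl)
      simpa [Finsupp.single_eq_of_ne hne.symm] using hβ l hl
    rw [sub_mul, coeff_sub, coeff_X_mul, coeff_C_mul, sub_eq_zero] at this
    rw [this, add_comm]
  have iter : ∀ (r : ℕ) (β : Fin n →₀ ℕ), (∀ l ∈ S, β l < k) →
      coeff β P = x ^ r * coeff (β + Finsupp.single i r) P := by
    intro r
    induction r with
    | zero => intro β _; simp
    | succ r ih =>
      intro β hβ
      rw [ih β hβ, step (β + Finsupp.single i r), pow_succ, mul_assoc, add_assoc,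
        ← Finsupp.single_add]
      intro l hl
      have hne : i ≠ l := fun hil => hi (hil ▸ hl)
      simpa [Finsupp.single_eq_of_ne hne.symm] using hβ l hl
  intro β hβ
  rw [iter (P.totalDegree + 1) β hβ]
  have : coeff (β + Finsupp.single i (P.totalDegree + 1)) P = 0 := by
    refine coeff_eq_zero_of_totalDegree_lt ?_
    change _ < Finsupp.degree _
    rw [map_add, Finsupp.degree_single]
    omega
  rw [this, mul_zero]

/-- If the row `i` of `E` annihilates the vector of the `Xⱼ - xⱼ` and each other row `l` sends it to
`Xₗ ^ k`, then `det E` lies in the ideal of these `k`-th powers. -/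
theorem det_mem_span_of_row_eq_zero {k : ℕ} (x : Fin n → B) (i : Fin n)
    {E : Matrix (Fin n) (Fin n) (MvPolynomial (Fin n) B)}
    (hi : E.mulVec (fun j => X j - C (x j)) i = 0)
    (hl : ∀ l, l ≠ i → E.mulVec (fun j => X j - C (x j)) l = X l ^ k) :
    E.det ∈ Ideal.span ((fun l => (X l : MvPolynomial (Fin n) B) ^ k) '' {l | l ≠ i}) := by
  refine mem_span_X_pow_of_X_sub_C_mul_mem (S := {l | l ≠ i}) (i := i) (by simp) (x i) ?_
  have := congrFun (det_smul_eq_adjugate_mulVec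
    (Eq.refl (E.mulVec (fun j => (X j - C (x j) : MvPolynomial (Fin n) B))))) i
  rw [Pi.smul_apply, smul_eq_mul, mul_comm] at this
  rw [this]
  change ∑ l, E.adjugate i l * E.mulVec (fun j => X j - C (x j)) l ∈ _
  refine Ideal.sum_mem _ fun l _ => ?_
  by_cases h : l = i
  · rw [h, hi, mul_zero]
    exact Ideal.zero_mem _
  · rw [hl l h]
    exact Ideal.mul_mem_left _ _ (Ideal.subset_span ⟨l, h, rfl⟩)

/-- The ideal generated by the `k`-th powers of the variables. -/
def powIdeal (n : ℕ) (B : Type*) [CommRing B] (k : ℕ) : Ideal (MvPolynomial (Fin n) B) :=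
  Ideal.span ((fun l => (X l : MvPolynomial (Fin n) B) ^ k) '' Set.univ)

/-- Wiebe's uniqueness: two matrices that both express the powers `Xᵢ ^ k` through the `Xⱼ - xⱼ`
have the same determinant modulo these powers. The rows are exchanged one at a time. -/
theorem det_sub_det_mem_powIdeal {k : ℕ} (x : Fin n → B)
    {E E' : Matrix (Fin n) (Fin n) (MvPolynomial (Fin n) B)}
    (hE : E.mulVec (fun j => X j - C (x j)) = fun l => X l ^ k)
    (hE' : E'.mulVec (fun j => X j - C (x j)) = fun l => X l ^ k) :
    E.det - E'.det ∈ powIdeal n B k := by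
  classical
  have key : ∀ s : Finset (Fin n),
      (Matrix.of fun l => if l ∈ s then E' l else E l).det - E.det ∈ powIdeal n B k := by
    intro s
    induction s using Finset.induction_on with
    | empty =>
      have : (Matrix.of fun l => if l ∈ (∅ : Finset (Fin n)) then E' l else E l) = E := by
        ext i j : 2; simp
      rw [this, sub_self]
      exact Ideal.zero_mem _
    | insert i s hi ih =>
      set M := (Matrix.of fun l => if l ∈ s then E' l else E l) with hM
      have h1 : (Matrix.of fun l => if l ∈ insert i s then E' l else E l) =
          M.updateRow i (E' i) := by
        ext l j : 2
        by_cases hl : l = i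
        · subst hl; simp
        · simp [hM, hl]
      have h2 : M = M.updateRow i (E i) := by
        have : M i = E i := by ext j; simp [hM, hi]
        rw [← this, Matrix.updateRow_eq_self]
      have h3 : M.det = (M.updateRow i (E i)).det := by rw [← h2]
      have h4 : (M.updateRow i (E' i)).det - M.det = (M.updateRow i (E' i - E i)).det := by
        have := Matrix.det_updateRow_add M i (E i) (E' i - E i)
        rw [add_sub_cancel] at this
        rw [this, ← h3, add_sub_cancel_left]
      have h5 : (M.updateRow i (E' i - E i)).det ∈ powIdeal n B k := by
        refine Ideal.span_mono (Set.image_mono (Set.subset_univ _))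
          (det_mem_span_of_row_eq_zero x i ?_ ?_)
        · have a1 := congrFun hE i
          have a2 := congrFun hE' i
          simp only [Matrix.mulVec, dotProduct] at a1 a2
          simp only [Matrix.mulVec, dotProduct, Matrix.updateRow_self, Pi.sub_apply]
          simp only [sub_mul (E' i _), Finset.sum_sub_distrib, a1, a2, sub_self]
        · intro l hl
          have a1 := congrFun hE l
          have a2 := congrFun hE' l
          simp only [Matrix.mulVec, dotProduct] at a1 a2
          simp only [Matrix.mulVec, dotProduct, Matrix.updateRow_ne hl]
          by_cases hs : l ∈ s
          · simp only [hM, Matrix.of_apply, if_pos hs]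
            exact a2
          · simp only [hM, Matrix.of_apply, if_neg hs]
            exact a1
      rw [h1, ← sub_add_sub_cancel _ M.det, h4]
      exact Ideal.add_mem _ h5 ih
  have h := key Finset.univ
  have e : (Matrix.of fun l => if l ∈ (Finset.univ : Finset (Fin n)) then E' l else E l) = E' := by
    ext i j : 2; simp
  rw [e] at h
  rw [← neg_sub]
  exact Ideal.neg_mem_iff _ |>.2 h

/-- The exponent vector `(e, …, e)`. -/
def constExp (n e : ℕ) : Fin n →₀ ℕ := Finsupp.equivFunOnFinite.symm fun _ => e

@[simp]
theorem constExp_apply (e : ℕ) (i : Fin n) : constExp n e i = e := rfl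

theorem coeff_constExp_of_mem_powIdeal {k : ℕ} (hk : 0 < k) {P : MvPolynomial (Fin n) B}
    (h : P ∈ powIdeal n B k) : coeff (constExp n (k - 1)) P = 0 :=
  mem_span_X_pow_iff.1 h _ fun l _ => by simp only [constExp_apply]; omega

theorem coeff_prod_geom_sum {k : ℕ} (hk : 0 < k) (x : Fin n → B) :
    coeff (constExp n (k - 1))
      (∏ i, ∑ p ∈ Finset.range k, (X i : MvPolynomial (Fin n) B) ^ p * C (x i) ^ (k - 1 - p)) =
        1 := by
  classical
  rw [Finset.prod_univ_sum, coeff_sum]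
  have e : ∀ q : Fin n → ℕ,
      ∏ i, ((X i : MvPolynomial (Fin n) B) ^ q i * C (x i) ^ (k - 1 - q i)) =
        monomial (Finsupp.equivFunOnFinite.symm q) (∏ i, x i ^ (k - 1 - q i)) := by
    intro q
    rw [monomial_eq_C_mul_prod, Finset.prod_mul_distrib, mul_comm]
    simp [map_prod]
  rw [Finset.sum_eq_single (fun _ => k - 1)]
  · rw [e, coeff_monomial]
    refine (if_pos rfl).trans ?_
    simp
  · intro q _ hq
    rw [e, coeff_monomial, if_neg]
    intro h
    exact hq (Finsupp.equivFunOnFinite.symm.injective h)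
  · intro h
    exact absurd (Fintype.mem_piFinset.2 fun _ => Finset.mem_range.2 (by omega)) h

/-- The residue modulo the `k`-th powers of `y`, applied to the Bezoutian of these powers, evaluates
polynomials at `x` when `xᵢ ^ k = 0`. -/
theorem coeff_mul_prod_geom_sum {A : Type*} [CommRing A] [Algebra A B] {k : ℕ} (hk : 0 < k)
    (x : Fin n → B) (hx : ∀ i, x i ^ k = 0) (g : MvPolynomial (Fin n) A) :
    coeff (constExp n (k - 1)) (map (algebraMap A B) g *
      ∏ i, ∑ p ∈ Finset.range k, (X i : MvPolynomial (Fin n) B) ^ p * C (x i) ^ (k - 1 - p)) =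
        aeval x g := by
  set c := fun i => ∑ p ∈ Finset.range k,
    (X i : MvPolynomial (Fin n) B) ^ p * C (x i) ^ (k - 1 - p) with hc
  have hX : ∀ i, (X i - C (x i)) * ∏ i, c i ∈ powIdeal n B k := by
    intro i
    rw [← Finset.mul_prod_erase _ _ (Finset.mem_univ i), ← mul_assoc]
    refine Ideal.mul_mem_right _ _ ?_
    have : (X i - C (x i)) * c i = X i ^ k := by
      rw [mul_comm, hc, geom_sum₂_mul, ← map_pow, hx, map_zero, sub_zero]
    rw [this]
    exact Ideal.subset_span ⟨i, trivial, rfl⟩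
  induction g using MvPolynomial.induction_on with
  | C a =>
    rw [map_C, coeff_C_mul, coeff_prod_geom_sum hk, mul_one, aeval_C]
  | add p q hp hq => rw [map_add, add_mul, coeff_add, hp, hq, map_add]
  | mul_X p i ih =>
    have h1 : map (algebraMap A B) (p * X i) * ∏ i, c i =
        map (algebraMap A B) p * ((X i - C (x i)) * ∏ i, c i) +
          C (x i) * (map (algebraMap A B) p * ∏ i, c i) := by
      rw [map_mul, map_X]
      ring
    rw [h1, coeff_add, coeff_constExp_of_mem_powIdeal hk (Ideal.mul_mem_left _ _ (hX i)), zero_add,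
      coeff_C_mul, ih, map_mul, aeval_X, mul_comm]

end Wiebe

/-! ### The residue functional of a nonsingular form -/

section Residue

variable {n : ℕ}

theorem pderiv_mem_jacobianIdeal (f : MvPolynomial (Fin n) ℂ) (i : Fin n) :
    pderiv i f ∈ jacobianIdeal f :=
  Ideal.subset_span ⟨i, rfl⟩

/-- By the Nullstellensatz, the Jacobian ideal of a nonsingular form contains powers of all
variables. -/
theorem exists_X_pow_mem_jacobianIdeal {f : MvPolynomial (Fin n) ℂ} (hf : ¬ IsSingularForm f) :
    ∃ k : ℕ, 0 < k ∧ ∀ i, X i ^ k ∈ jacobianIdeal f := by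
  have h : ∀ i, ∃ k : ℕ, X i ^ k ∈ jacobianIdeal f := by
    intro i
    have h1 : (X i : MvPolynomial (Fin n) ℂ) ∈
        vanishingIdeal ℂ (zeroLocus ℂ (jacobianIdeal f)) := by
      intro z hz
      have hz0 : z = 0 := by
        by_contra hne
        refine hf ⟨z, hne, fun j => ?_⟩
        have := hz _ (pderiv_mem_jacobianIdeal f j)
        rwa [aeval_eq_eval] at this
      simp [hz0]
    rw [vanishingIdeal_zeroLocus_eq_radical] at h1
    exact h1
  choose k hk using h
  refine ⟨∑ i, k i + 1, by omega, fun i => ?_⟩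
  have hle : k i ≤ ∑ i, k i + 1 :=
    (Finset.single_le_sum (fun _ _ => Nat.zero_le _) (Finset.mem_univ i)).trans (Nat.le_succ _)
  exact Ideal.pow_mem_of_pow_mem _ (hk i) hle

theorem pderiv_pderiv_comm (i j : Fin n) (f : MvPolynomial (Fin n) ℂ) :
    pderiv i (pderiv j f) = pderiv j (pderiv i f) := by
  by_cases hij : i = j
  · rw [hij]
  · ext γ
    rw [coeff_pderiv, coeff_pderiv, coeff_pderiv, coeff_pderiv, Finsupp.add_apply,
      Finsupp.add_apply, Finsupp.single_eq_of_ne hij, Finsupp.single_eq_of_ne (Ne.symm hij),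
      add_right_comm, add_zero, add_zero, mul_assoc, mul_assoc,
      mul_comm ((γ j : ℂ) + 1)]

/-- Euler's identity for the first partial derivatives, in matrix form. -/
theorem hessMatrix_mulVec {f : MvPolynomial (Fin n) ℂ} {m : ℕ} (hf : f.IsHomogeneous (m + 1)) :
    (Matrix.of fun i j => pderiv i (pderiv j f)).mulVec X = fun i => (m : ℂ) • pderiv i f := by
  funext i
  have h := (hf.pderiv (i := i)).sum_X_mul_pderiv
  rw [Nat.add_sub_cancel] at h
  rw [Nat.cast_smul_eq_nsmul, ← h, Matrix.mulVec, dotProduct]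
  refine Finset.sum_congr rfl fun j _ => ?_
  rw [mul_comm, Matrix.of_apply, pderiv_pderiv_comm]

/-- The Bezoutian is a reproducing kernel for the residue functional, in any algebra `B` in which
the partial derivatives vanish. Both `b * (Bezoutian matrix)` and the diagonal matrix of the
`∑ xᵢ ^ p yᵢ ^ (k - 1 - p)` express the `yᵢ ^ k` through the `yⱼ - xⱼ` in `B[y]`. -/
theorem reproducing {B : Type*} [CommRing B] [Algebra ℂ B] (π : MvPolynomial (Fin n) ℂ →ₐ[ℂ] B)
    (f : MvPolynomial (Fin n) ℂ) (hπ : ∀ i, π (pderiv i f) = 0) {k : ℕ} (hk : 0 < k)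
    (b : Fin n → Fin n → MvPolynomial (Fin n) ℂ) (hb : ∀ i, ∑ j, b i j * pderiv j f = X i ^ k)
    (g : MvPolynomial (Fin n) ℂ) :
    π g = ∑ β ∈ (bez f).support,
      π (C (coeff (constExp n (k - 1)) (g * monomial β 1 * (Matrix.of b).det)) *
        coeff β (bez f)) := by
  have hπC : ∀ c, π (C c) = algebraMap ℂ B c := π.commutes
  have halg : ∀ q : MvPolynomial (Fin n) ℂ,
      map (algebraMap ℂ B) q = map (π : MvPolynomial (Fin n) ℂ →+* B) (map C q) := by
    intro q
    rw [map_map]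
    congr 2
    ext c
    exact (hπC c).symm
  let x : Fin n → B := fun i => π (X i)
  have hx : ∀ i, x i ^ k = 0 := fun i => by
    simp only [x]
    rw [← map_pow, ← hb, map_sum]
    simp [hπ]
  let E := (map (algebraMap ℂ B)).mapMatrix (Matrix.of b) *
    (map (π : MvPolynomial (Fin n) ℂ →+* B)).mapMatrix (bezMatrix f)
  have hE : E.mulVec (fun j => X j - C (x j)) = fun l => X l ^ k := by
    have h1 : ((map (π : MvPolynomial (Fin n) ℂ →+* B)).mapMatrix (bezMatrix f)).mulVec
        (fun j => X j - C (x j)) = fun i => map (algebraMap ℂ B) (pderiv i f) := by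
      funext i
      have := congrArg (map (π : MvPolynomial (Fin n) ℂ →+* B))
        (congrFun (bezMatrix_mulVec f) i)
      rw [map_sub, map_C, ← halg, RingHom.coe_coe, hπ, map_zero, zero_sub,
        eq_comm, neg_eq_iff_eq_neg] at this
      rw [this]
      simp only [Matrix.mulVec, dotProduct, map_sum, map_mul, map_sub, map_C, map_X,
        RingHom.mapMatrix_apply, Matrix.map_apply, x, ← Finset.sum_neg_distrib, RingHom.coe_coe]
      refine Finset.sum_congr rfl fun j _ => ?_
      ring
    rw [← Matrix.mulVec_mulVec, h1]
    funext i
    have := congrArg (map (algebraMap ℂ B)) (hb i)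
    simpa [Matrix.mulVec, dotProduct] using this
  have hE' : (Matrix.diagonal fun i => ∑ p ∈ Finset.range k,
      (X i : MvPolynomial (Fin n) B) ^ p * C (x i) ^ (k - 1 - p)).mulVec
        (fun j => X j - C (x j)) = fun l => X l ^ k := by
    funext i
    rw [Matrix.mulVec_diagonal, geom_sum₂_mul, ← map_pow, hx, map_zero, sub_zero]
  have h2 := coeff_constExp_of_mem_powIdeal hk (Ideal.mul_mem_left _
    (map (algebraMap ℂ B) g) (det_sub_det_mem_powIdeal x hE hE'))
  rw [mul_sub, coeff_sub, Matrix.det_diagonal, coeff_mul_prod_geom_sum hk x hx, sub_eq_zero] at h2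
  have h3 : aeval x g = π g := by
    have : aeval x = π := by
      ext i; simp [x]
    rw [this]
  have h4 : E.det = map (algebraMap ℂ B) (Matrix.of b).det *
      map (π : MvPolynomial (Fin n) ℂ →+* B) (bez f) := by
    rw [Matrix.det_mul, ← RingHom.map_det, ← RingHom.map_det, bez]
  have h5 : map (π : MvPolynomial (Fin n) ℂ →+* B) (bez f) =
      ∑ β ∈ (bez f).support, monomial β (π (coeff β (bez f))) := by
    conv_lhs => rw [(bez f).as_sum, map_sum]
    simp only [map_monomial, RingHom.coe_coe]
  rw [h3, h4, h5, ← mul_assoc, ← map_mul, Finset.mul_sum, coeff_sum] at h2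
  rw [← h2]
  refine Finset.sum_congr rfl fun β _ => ?_
  have h6 : map (algebraMap ℂ B) (g * (Matrix.of b).det) *
      monomial β (π (coeff β (bez f))) = C (π (coeff β (bez f))) *
        map (algebraMap ℂ B) (g * monomial β 1 * (Matrix.of b).det) := by
    have : monomial β (π (coeff β (bez f))) =
        C (π (coeff β (bez f))) * map (algebraMap ℂ B) (monomial β 1) := by
      rw [map_monomial, map_one, C_mul_monomial, mul_one]
    rw [this, map_mul, map_mul, map_mul]
    ring
  rw [h6, coeff_C_mul, coeff_map, map_mul, mul_comm, hπC]

/-- The residue functional of a nonsingular form. It kills the Jacobian ideal, it is normalised on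
the Hessian, and the Bezoutian is its reproducing kernel. If `Xᵢ ^ k = ∑ⱼ bᵢⱼ ∂ⱼf`, then `ω(g)` is
the coefficient of `X₁ ^ (k - 1) ⋯ Xₙ ^ (k - 1)` in `g det(b)`. -/
theorem exists_residue {f : MvPolynomial (Fin n) ℂ} {m : ℕ} (hm : 0 < m)
    (hf : f.IsHomogeneous (m + 1)) (hns : ¬ IsSingularForm f) :
    ∃ ω : MvPolynomial (Fin n) ℂ →ₗ[ℂ] ℂ,
      (∀ g ∈ jacobianIdeal f, ω g = 0) ∧ ω (hessian f) = (m : ℂ) ^ n ∧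
        ∀ g, g - ∑ β ∈ (bez f).support, C (ω (g * monomial β 1)) * coeff β (bez f) ∈
          jacobianIdeal f := by
  classical
  obtain ⟨k, hk, hmem⟩ := exists_X_pow_mem_jacobianIdeal hns
  have hb : ∀ i, ∃ b : Fin n → MvPolynomial (Fin n) ℂ, ∑ j, b j * pderiv j f = X i ^ k := by
    intro i
    have := hmem i
    rw [jacobianIdeal, Ideal.mem_span_range_iff_exists_fun] at this
    exact this
  choose b hb using hb
  have hbf : (Matrix.of b).mulVec (fun j => pderiv j f) = fun i => X i ^ k := by
    funext i
    exact hb i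
  let ω : MvPolynomial (Fin n) ℂ →ₗ[ℂ] ℂ :=
    (lcoeff ℂ (constExp n (k - 1))).comp (LinearMap.mulRight ℂ (Matrix.of b).det)
  have hω : ∀ g, ω g = coeff (constExp n (k - 1)) (g * (Matrix.of b).det) := fun g => rfl
  refine ⟨ω, ?_, ?_, ?_⟩
  · intro g hg
    rw [hω]
    refine coeff_constExp_of_mem_powIdeal hk ?_
    rw [jacobianIdeal, Ideal.mem_span_range_iff_exists_fun] at hg
    obtain ⟨q, rfl⟩ := hg
    rw [Finset.sum_mul]
    refine Ideal.sum_mem _ fun j _ => ?_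
    rw [mul_assoc]
    refine Ideal.mul_mem_left _ _ ?_
    have := congrFun (det_smul_eq_adjugate_mulVec hbf) j
    rw [Pi.smul_apply, smul_eq_mul, mul_comm] at this
    rw [this]
    change ∑ l, (Matrix.of b).adjugate j l * X l ^ k ∈ _
    exact Ideal.sum_mem _ fun l _ => Ideal.mul_mem_left _ _ (Ideal.subset_span ⟨l, trivial, rfl⟩)
  · -- compare `b * (Hessian matrix) / m` with the diagonal matrix of the `Xᵢ ^ (k - 1)`
    have hm0 : (m : ℂ) ≠ 0 := Nat.cast_ne_zero.2 hm.ne'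
    have hX : (fun j => X j - C (0 : ℂ)) = (X : Fin n → MvPolynomial (Fin n) ℂ) := by
      funext j; simp
    have h1 : (Matrix.of b * ((m : ℂ)⁻¹ • Matrix.of fun i j => pderiv i (pderiv j f))).mulVec
        (fun j => X j - C (0 : ℂ)) = fun i => X i ^ k := by
      rw [hX, ← Matrix.mulVec_mulVec, Matrix.smul_mulVec, hessMatrix_mulVec hf, ← hbf]
      congr 1
      funext i
      simp [smul_smul, hm0]
    have h2 : (Matrix.diagonal fun i => (X i : MvPolynomial (Fin n) ℂ) ^ (k - 1)).mulVec
        (fun j => X j - C (0 : ℂ)) = fun i => X i ^ k := by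
      rw [hX]
      funext i
      rw [Matrix.mulVec_diagonal, ← pow_succ, Nat.sub_add_cancel hk]
    have h3 := coeff_constExp_of_mem_powIdeal hk (det_sub_det_mem_powIdeal (fun _ => 0) h1 h2)
    have h4 : ((m : ℂ)⁻¹ • Matrix.of fun i j => pderiv i (pderiv j f)).det =
        ((m : ℂ)⁻¹ ^ n) • hessian f := by
      have := Matrix.det_smul (Matrix.of fun i j => pderiv i (pderiv j f))
        (C (m : ℂ)⁻¹ : MvPolynomial (Fin n) ℂ)
      rw [Fintype.card_fin, ← map_pow, ← smul_eq_C_mul] at this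
      rw [hessian, ← this]
      congr 1
      ext i j : 2
      simp [smul_eq_C_mul]
    have h5 : coeff (constExp n (k - 1))
        (Matrix.diagonal fun i => (X i : MvPolynomial (Fin n) ℂ) ^ (k - 1)).det = 1 := by
      rw [Matrix.det_diagonal]
      have : ∏ i, (X i : MvPolynomial (Fin n) ℂ) ^ (k - 1) =
          monomial (constExp n (k - 1)) 1 := by
        rw [monomial_eq_C_mul_prod]
        simp
      rw [this, coeff_monomial, if_pos rfl]
    rw [coeff_sub, h5, sub_eq_zero, Matrix.det_mul, h4, mul_smul_comm, coeff_smul, smul_eq_mul,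
      inv_pow, inv_mul_eq_one₀ (pow_ne_zero _ hm0)] at h3
    rw [hω, h3, mul_comm]
  · intro g
    have h := reproducing (Ideal.Quotient.mkₐ ℂ (jacobianIdeal f)) f
      (fun i => Ideal.Quotient.eq_zero_iff_mem.2 (pderiv_mem_jacobianIdeal f i)) hk b hb g
    rw [← map_sum] at h
    exact Ideal.Quotient.eq.1 h

end Residue

/-! ### The determinant of Sylvester type -/

instance instFintypeExps (n d : ℕ) : Fintype (Exps n d) :=
  Fintype.ofEquiv {m // m ∈ (Finset.univ : Finset (Fin n)).finsuppAntidiag d}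
    (Equiv.subtypeEquivRight fun m => by
      simp [Finset.mem_finsuppAntidiag, Finsupp.degree_eq_sum])

theorem card_exps (n d : ℕ) : Fintype.card (Exps n d) = (n + d - 1).choose d := by
  have h := Finset.card_finsuppAntidiag_nat_eq_choose (s := (Finset.univ : Finset (Fin n))) d
  rw [Finset.card_univ, Fintype.card_fin] at h
  rw [← h, ← Fintype.card_coe]
  exact Fintype.card_congr (Equiv.subtypeEquivRight fun m => by
      simp [Finset.mem_finsuppAntidiag, Finsupp.degree_eq_sum])

/-- The exponent vectors `α` with `|α| + m = t`; there are none if `t < m`. -/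
abbrev ShiftExps (n m t : ℕ) : Type := {α : Fin n →₀ ℕ // α.degree + m = t}

/-- If `m ≤ t`, the shifted exponent vectors are those of degree `t - m`. -/
def shiftExpsEquiv (n : ℕ) {m t : ℕ} (h : m ≤ t) : ShiftExps n m t ≃ Exps n (t - m) :=
  Equiv.subtypeEquivRight fun α => by omega

instance instFintypeShiftExps (n m t : ℕ) : Fintype (ShiftExps n m t) :=
  if h : m ≤ t then Fintype.ofEquiv _ (shiftExpsEquiv n h).symm
  else
    haveI : IsEmpty (ShiftExps n m t) := ⟨fun α => h (by have := α.2; omega)⟩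
    Fintype.ofIsEmpty

theorem card_shiftExps (n : ℕ) {m t : ℕ} (h : m ≤ t) :
    Fintype.card (ShiftExps n m t) = (n + (t - m) - 1).choose (t - m) := by
  rw [← card_exps]
  exact Fintype.card_congr (shiftExpsEquiv n h)

theorem card_shiftExps_of_lt (n : ℕ) {m t : ℕ} (h : t < m) :
    Fintype.card (ShiftExps n m t) = 0 := by
  rw [Fintype.card_eq_zero_iff]
  exact ⟨fun α => by have := α.2; omega⟩

section Sylvester

variable {n : ℕ}

/-- The matrix of Sylvester type of a form `f` whose partial derivatives have degree `m`. Its rows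
are indexed by the monomials of degree `t`. Its columns are the products `z ^ α ∂f/∂zᵢ` of degree
`t`, and the coefficients of the Bezoutian at `y ^ β` with `|β| = s`. -/
def sylvester {R : Type*} [CommRing R] (m s t : ℕ) (f : MvPolynomial (Fin n) R) :
    Matrix (Exps n t) ((Fin n × ShiftExps n m t) ⊕ Exps n s) R :=
  Matrix.of fun γ => Sum.elim (fun p => coeff γ.1 (monomial p.2.1 1 * pderiv p.1 f))
    fun β => coeff γ.1 (coeff β.1 (bez f))

theorem sylvester_map {R R' : Type*} [CommRing R] [CommRing R'] (φ : R →+* R') (m s t : ℕ)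
    (f : MvPolynomial (Fin n) R) :
    sylvester m s t (map φ f) = (sylvester m s t f).map φ := by
  ext γ (p | β)
  · have : (monomial p.2.1 (1 : R')) = map φ (monomial p.2.1 1) := by simp
    simp only [sylvester, Matrix.of_apply, Matrix.map_apply, Sum.elim_inl, pderiv_map]
    rw [this, ← map_mul, coeff_map]
  · simp only [sylvester, Matrix.of_apply, Matrix.map_apply, Sum.elim_inr, bez_map, coeff_map]

theorem sylvester_smul {R : Type*} [CommRing R] (c : R) (m s t : ℕ)
    (f : MvPolynomial (Fin n) R) :
    sylvester m s t (c • f) = Matrix.of fun γ p =>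
      Sum.elim (fun _ => c) (fun _ => c ^ n) p * sylvester m s t f γ p := by
  ext γ (p | β)
  · simp [sylvester]
  · simp [sylvester, bez_smul]

variable {f : MvPolynomial (Fin n) ℂ} {m s t : ℕ}

theorem sum_exps_eq_sum_support {g : MvPolynomial (Fin n) ℂ} {t : ℕ} (hg : g.IsHomogeneous t)
    (F : (Fin n →₀ ℕ) → ℂ) :
    ∑ γ : Exps n t, F γ.1 * coeff γ.1 g = ∑ γ ∈ g.support, F γ * coeff γ g := by
  classical
  symm
  refine Finset.sum_bij_ne_zero (fun γ hγ _ => ⟨γ, ?_⟩) ?_ ?_ ?_ ?_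
  · rw [Finsupp.degree_eq_weight_one]
    exact hg (mem_support_iff.1 hγ)
  · intro γ hγ _
    exact Finset.mem_univ _
  · intro γ _ _ γ' _ _ h
    exact congrArg Subtype.val h
  · intro γ _ hγ
    exact ⟨γ.1, mem_support_iff.2 (right_ne_zero_of_mul hγ), hγ, rfl⟩
  · intros
    rfl

theorem sum_exps_eq_eval {g : MvPolynomial (Fin n) ℂ} {t : ℕ} (hg : g.IsHomogeneous t)
    (z : Fin n → ℂ) : ∑ γ : Exps n t, (∏ i, z i ^ γ.1 i) * coeff γ.1 g = eval z g := by
  rw [sum_exps_eq_sum_support hg fun γ => ∏ i, z i ^ γ i, eval_eq']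
  exact Finset.sum_congr rfl fun _ _ => mul_comm _ _

/-- At a common zero `z ≠ 0` of the partial derivatives, the part of the Bezoutian `Bez(z, y)` of
degree less than `m` in `y` vanishes: multiplied by a nonzero `zⱼ - yⱼ` it lies in the ideal of the
forms `∂f/∂yᵢ` of degree `m`. -/
theorem eval_coeff_bez_eq_zero (hf : f.IsHomogeneous (m + 1)) {z : Fin n → ℂ} (hz : z ≠ 0)
    (h0 : ∀ i, eval z (pderiv i f) = 0) (β : Fin n →₀ ℕ) (hβ : β.degree < m) :
    eval z (coeff β (bez f)) = 0 := by
  obtain ⟨j, hj⟩ := Function.ne_iff.1 hz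
  have h1 := congrFun (det_smul_eq_adjugate_mulVec (bezMatrix_mulVec f)) j
  have h2 : map (eval z) (bez f) * (C (z j) - X j) =
      ∑ i, map (eval z) ((bezMatrix f).adjugate j i) * (-pderiv i f) := by
    have h3 := congrArg (map (eval z)) h1
    simp only [Pi.smul_apply, smul_eq_mul, Matrix.mulVec, dotProduct, map_mul, map_sub, map_sum,
      map_C, map_X, eval_X] at h3
    rw [bez, h3]
    refine Finset.sum_congr rfl fun i _ => ?_
    rw [h0, map_map]
    have : (eval z).comp C = RingHom.id ℂ := by ext c; simp
    rw [this, map_id, map_zero, zero_sub]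
  have h4 : ∀ δ : Fin n →₀ ℕ, δ.degree < m →
      coeff δ (map (eval z) (bez f) * (C (z j) - X j)) = 0 := by
    intro δ hδ
    rw [h2, coeff_sum]
    refine Finset.sum_eq_zero fun i _ => ?_
    rw [coeff_mul]
    refine Finset.sum_eq_zero fun p hp => ?_
    rw [Finset.HasAntidiagonal.mem_antidiagonal] at hp
    have : coeff p.2 (pderiv i f) = 0 := by
      refine (hf.pderiv (i := i)).coeff_eq_zero ?_
      have := congrArg Finsupp.degree hp
      rw [map_add] at this
      omega
    rw [coeff_neg, this, neg_zero, mul_zero]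
  have h5 : ∀ (e : ℕ) (δ : Fin n →₀ ℕ), δ.degree = e → e < m →
      coeff δ (map (eval z) (bez f)) = 0 := by
    classical
    intro e
    induction e with
    | zero =>
      intro δ hδ he
      have h6 := h4 δ (by omega)
      rw [mul_sub, coeff_sub, mul_comm _ (C _), coeff_C_mul, coeff_mul_X', if_neg] at h6
      · rw [sub_zero] at h6
        exact (mul_eq_zero.1 h6).resolve_left hj
      · rw [Finsupp.degree_eq_zero_iff] at hδ
        simp [hδ]
    | succ e ih =>
      intro δ hδ he
      have h6 := h4 δ (by omega)
      rw [mul_sub, coeff_sub, mul_comm _ (C _), coeff_C_mul, coeff_mul_X'] at h6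
      split_ifs at h6 with h7
      · rw [ih (δ - Finsupp.single j 1) _ (by omega), sub_zero] at h6
        · exact (mul_eq_zero.1 h6).resolve_left hj
        · have h8 : δ - Finsupp.single j 1 + Finsupp.single j 1 = δ := by
            refine tsub_add_cancel_of_le ?_
            rw [Finsupp.single_le_iff]
            exact Nat.one_le_iff_ne_zero.2 (Finsupp.mem_support_iff.1 h7)
          have := congrArg Finsupp.degree h8
          rw [map_add, Finsupp.degree_single] at this
          omega
      · rw [sub_zero] at h6
        exact (mul_eq_zero.1 h6).resolve_left hj
  have := h5 _ β rfl hβ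
  rwa [coeff_map] at this

/-- The monomials at a singular point form a nonzero row vector annihilated by the matrix. -/
theorem exists_vecMul_sylvester_eq_zero (hf : f.IsHomogeneous (m + 1)) (hs : s < m)
    (hst : t + s = n * (m - 1)) (h : IsSingularForm f) :
    ∃ v ≠ 0, Matrix.vecMul v (sylvester m s t f) = 0 := by
  obtain ⟨z, hz, h0⟩ := h
  obtain ⟨m, rfl⟩ : ∃ k, m = k + 1 := ⟨m - 1, by omega⟩
  rw [Nat.add_sub_cancel] at hst
  refine ⟨fun γ => ∏ i, z i ^ γ.1 i, ?_, ?_⟩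
  · obtain ⟨j, hj⟩ := Function.ne_iff.1 hz
    intro hv
    have := congrFun hv ⟨Finsupp.single j t, by simp⟩
    simp only [Pi.zero_apply, Finset.prod_eq_zero_iff, Finset.mem_univ, true_and] at this
    obtain ⟨i, hi⟩ := this
    by_cases hij : i = j
    · subst hij
      rw [Finsupp.single_eq_same] at hi
      exact hj (eq_zero_of_pow_eq_zero hi)
    · simp [Finsupp.single_eq_of_ne hij] at hi
  · funext p
    rcases p with ⟨i, α⟩ | β
    · have hg : (monomial α.1 (1 : ℂ) * pderiv i f).IsHomogeneous t := by
        have := (isHomogeneous_monomial (1 : ℂ) (rfl : α.1.degree = _)).mul (hf.pderiv (i := i))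
        rwa [Nat.add_sub_cancel, α.2] at this
      have := sum_exps_eq_eval hg z
      rw [map_mul, h0, mul_zero] at this
      exact this
    · have hg : (coeff β.1 (bez f)).IsHomogeneous t := by
        refine (isTotallyHomogeneous_bez hf).isHomogeneous_coeff ?_
        rw [β.2, hst]
      have := sum_exps_eq_eval hg z
      rw [eval_coeff_bez_eq_zero hf hz h0 _ (by rw [β.2]; exact hs)] at this
      exact this

/-- A row vector annihilated by the columns `z ^ α ∂f/∂zᵢ` is determined by its products with the
remaining columns, through the values of the residue functional. -/
theorem eq_sum_residue_mul (hf : f.IsHomogeneous (m + 1)) (hm : 0 < m)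
    (hst : t + s = n * (m - 1)) {ω : MvPolynomial (Fin n) ℂ →ₗ[ℂ] ℂ}
    (hω : ∀ g, g - ∑ β ∈ (bez f).support, C (ω (g * monomial β 1)) * coeff β (bez f) ∈
          jacobianIdeal f) (v : Exps n t → ℂ)
    (hv : ∀ p, Matrix.vecMul v (sylvester m s t f) (Sum.inl p) = 0) (γ : Exps n t) :
    v γ = ∑ β : Exps n s, ω (monomial (γ.1 + β.1) 1) *
      Matrix.vecMul v (sylvester m s t f) (Sum.inr β) := by
  classical
  obtain ⟨m, rfl⟩ : ∃ k, m = k + 1 := ⟨m - 1, by omega⟩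
  rw [Nat.add_sub_cancel] at hst
  let V : MvPolynomial (Fin n) ℂ →ₗ[ℂ] ℂ := ∑ γ : Exps n t, v γ • lcoeff ℂ γ.1
  have hV : ∀ g, V g = ∑ γ : Exps n t, v γ * coeff γ.1 g := by
    intro g
    simp [V, lcoeff]
  have hVI : ∀ g ∈ jacobianIdeal f, V g = 0 := by
    intro g hg
    rw [jacobianIdeal, Ideal.mem_span_range_iff_exists_fun] at hg
    obtain ⟨q, rfl⟩ := hg
    rw [map_sum]
    refine Finset.sum_eq_zero fun i _ => ?_
    generalize q i = q
    induction q using MvPolynomial.induction_on' with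
    | monomial α c =>
      have e : monomial α c * pderiv i f = c • (monomial α 1 * pderiv i f) := by
        rw [← smul_mul_assoc, smul_monomial, smul_eq_mul, mul_one]
      rw [e, map_smul, hV]
      by_cases hα : α.degree + (m + 1) = t
      · have := hv (i, ⟨α, hα⟩)
        have h2 : ∑ γ : Exps n t, v γ * coeff γ.1 (monomial α 1 * pderiv i f) = 0 := this
        rw [h2, smul_zero]
      · have h2 : (monomial α (1 : ℂ) * pderiv i f).IsHomogeneous (α.degree + (m + 1)) :=
          (isHomogeneous_monomial _ rfl).mul hf.pderiv
        rw [Finset.sum_eq_zero, smul_zero]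
        intro γ _
        rw [h2.coeff_eq_zero, mul_zero]
        rw [γ.2]
        exact fun h => hα h.symm
    | add p q hp hq => rw [add_mul, map_add, hp, hq, add_zero]
  have h1 := hVI _ (hω (monomial γ.1 1))
  rw [map_sub, sub_eq_zero, map_sum] at h1
  have h2 : V (monomial γ.1 1) = v γ := by
    rw [hV, Finset.sum_eq_single γ]
    · simp
    · intro γ' _ hne
      rw [coeff_monomial, if_neg, mul_zero]
      exact fun h => hne (Subtype.ext h.symm)
    · simp
  have h3 : ∀ β : Fin n →₀ ℕ, β.degree ≠ s → V (coeff β (bez f)) = 0 := by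
    intro β hβ
    rw [hV]
    refine Finset.sum_eq_zero fun δ _ => ?_
    have : coeff δ.1 (coeff β (bez f)) = 0 := by
      by_contra hne
      have := isTotallyHomogeneous_bez hf _ _ hne
      rw [δ.2] at this
      omega
    rw [this, mul_zero]
  rw [← h2, h1]
  symm
  refine Finset.sum_bij_ne_zero (fun β _ _ => β.1) ?_ ?_ ?_ ?_
  · intro β _ hne
    rw [mem_support_iff]
    intro h0
    refine right_ne_zero_of_mul hne ?_
    change ∑ δ : Exps n t, v δ * coeff δ.1 (coeff β.1 (bez f)) = 0
    simp [h0]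
  · intro β _ _ β' _ _ h
    exact Subtype.ext h
  · intro β hβ hne
    rw [← smul_eq_C_mul, map_smul, smul_eq_mul] at hne
    have hdeg : β.degree = s := by
      by_contra h
      exact right_ne_zero_of_mul hne (h3 β h)
    refine ⟨⟨β, hdeg⟩, Finset.mem_univ _, ?_, rfl⟩
    rw [monomial_mul, one_mul, hV] at hne
    exact hne
  · intro β _ _
    rw [← smul_eq_C_mul, map_smul, smul_eq_mul, monomial_mul, one_mul, hV]
    rfl

end Sylvester

/-! ### The socle of the Milnor algebra -/

section Socle

variable {n : ℕ}

theorem homogeneousComponent_mem_jacobianIdeal {f : MvPolynomial (Fin n) ℂ} {d : ℕ}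
    (hf : f.IsHomogeneous d) (k : ℕ) {g : MvPolynomial (Fin n) ℂ} (hg : g ∈ jacobianIdeal f) :
    homogeneousComponent k g ∈ jacobianIdeal f := by
  let _ : GradedAlgebra (homogeneousSubmodule (Fin n) ℂ) := gradedAlgebra
  have h : (jacobianIdeal f).IsHomogeneous (homogeneousSubmodule (Fin n) ℂ) := by
    refine Ideal.homogeneous_span _ _ ?_
    rintro _ ⟨i, rfl⟩
    exact ⟨d - 1, hf.pderiv⟩
  rw [← decomposition.decompose'_apply]
  exact h k hg

theorem isHomogeneous_hessian {f : MvPolynomial (Fin n) ℂ} {d : ℕ} (hf : f.IsHomogeneous d) :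
    (hessian f).IsHomogeneous (n * (d - 2)) := by
  rw [hessian, Matrix.det_apply']
  refine IsHomogeneous.sum _ _ _ fun τ _ => ?_
  have h1 : (∏ i, (Matrix.of fun i j => pderiv i (pderiv j f)) (τ i) i).IsHomogeneous
      (∑ _i : Fin n, (d - 2)) :=
    IsHomogeneous.prod _ _ _ fun i _ => hf.pderiv.pderiv
  have h2 := (isHomogeneous_C (Fin n) ((Equiv.Perm.sign τ : ℤ) : ℂ)).mul h1
  simpa using h2

/-- In degree `n (d - 2)` the Milnor algebra of a nonsingular form is spanned by the Hessian, and
the residue functional computes the coefficient. -/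
theorem sub_smul_hessian_mem_jacobianIdeal {f : MvPolynomial (Fin n) ℂ} {m : ℕ} (hm : 0 < m)
    (hf : f.IsHomogeneous (m + 1)) {ω : MvPolynomial (Fin n) ℂ →ₗ[ℂ] ℂ}
    (hH : ω (hessian f) = (m : ℂ) ^ n)
    (hω : ∀ g, g - ∑ β ∈ (bez f).support, C (ω (g * monomial β 1)) * coeff β (bez f) ∈
          jacobianIdeal f) {g : MvPolynomial (Fin n) ℂ} (hg : g.IsHomogeneous (n * (m - 1))) :
    g - C (ω g / (m : ℂ) ^ n) * hessian f ∈ jacobianIdeal f := by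
  classical
  have hm0 : (m : ℂ) ^ n ≠ 0 := pow_ne_zero _ (Nat.cast_ne_zero.2 hm.ne')
  obtain ⟨m, rfl⟩ : ∃ k, m = k + 1 := ⟨m - 1, by omega⟩
  rw [Nat.add_sub_cancel] at hg
  have key : ∀ g : MvPolynomial (Fin n) ℂ, g.IsHomogeneous (n * m) →
      g - C (ω g) * coeff 0 (bez f) ∈ jacobianIdeal f := by
    intro g hg
    have h1 := homogeneousComponent_mem_jacobianIdeal hf (n * m) (hω g)
    rw [map_sub, map_sum, homogeneousComponent_of_mem hg, if_pos rfl] at h1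
    have h2 : ∑ β ∈ (bez f).support,
        homogeneousComponent (n * m) (C (ω (g * monomial β 1)) * coeff β (bez f)) =
          C (ω g) * coeff 0 (bez f) := by
      rw [Finset.sum_eq_single 0]
      · have h0 : (C (ω (g * monomial 0 1)) * coeff 0 (bez f)).IsHomogeneous (n * m) := by
          have := (isHomogeneous_C (Fin n) (ω (g * monomial 0 1))).mul
            ((isTotallyHomogeneous_bez hf).isHomogeneous_coeff (β := 0) (e := n * m) (by simp))
          rwa [zero_add] at this
        rw [homogeneousComponent_of_mem h0, if_pos rfl, monomial_zero', map_one, mul_one]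
      · intro β hβ hne
        have hpos : β.degree ≠ 0 := fun h => hne ((Finsupp.degree_eq_zero_iff β).1 h)
        obtain ⟨γ, hγ⟩ : ∃ γ, coeff γ (coeff β (bez f)) ≠ 0 := by
          by_contra! hall
          exact mem_support_iff.1 hβ (by ext γ; simpa using hall γ)
        have hdeg := isTotallyHomogeneous_bez hf _ _ hγ
        have h0 := (isHomogeneous_C (Fin n) (ω (g * monomial β 1))).mul
            ((isTotallyHomogeneous_bez hf).isHomogeneous_coeff hdeg)
        rw [homogeneousComponent_of_mem h0, if_neg]
        omega
      · intro h
        rw [notMem_support_iff.1 h]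
        simp
    rwa [h2] at h1
  have k1 := key g hg
  have k2 := key (hessian f) (isHomogeneous_hessian hf)
  rw [hH] at k2
  have := Ideal.sub_mem _ k1
    (Ideal.mul_mem_left _ (C (ω g / ((m + 1 : ℕ) : ℂ) ^ n)) k2)
  have e : C (ω g / ((m + 1 : ℕ) : ℂ) ^ n) * C (((m + 1 : ℕ) : ℂ) ^ n) =
      (C (ω g) : MvPolynomial (Fin n) ℂ) := by
    rw [← C_mul, div_mul_cancel₀ _ hm0]
  rw [mul_sub, ← mul_assoc, e] at this
  convert this using 1
  ring

theorem omega_eq_of_eq_smul {f : MvPolynomial (Fin n) ℂ} (hH : hessian f ∉ jacobianIdeal f)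
    {x : MilnorAlgebra f} {c : ℂ} (h : x = c • toMilnor f (hessian f)) : omega f x = c := by
  have hex : ∃ c : ℂ, x = c • toMilnor f (hessian f) := ⟨c, h⟩
  rw [omega, dif_pos hex]
  have h1 := h.symm.trans hex.choose_spec
  have h2 : (c - hex.choose) • toMilnor f (hessian f) = 0 := by
    rw [sub_smul, ← h1, sub_self]
  have h3 : toMilnor f (hessian f) ≠ 0 := fun h0 => hH (Ideal.Quotient.eq_zero_iff_mem.1 h0)
  exact (sub_eq_zero.1 ((smul_eq_zero.1 h2).resolve_right h3)).symm

theorem toMilnor_eq_smul_iff {f g h : MvPolynomial (Fin n) ℂ} {c : ℂ} :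
    toMilnor f g = c • toMilnor f h ↔ g - C c * h ∈ jacobianIdeal f := by
  have : c • toMilnor f h = toMilnor f (C c * h) := by
    rw [← smul_eq_C_mul]
    rfl
  rw [this]
  exact Ideal.Quotient.eq

/-- For a nonsingular form the functional `omega` is, up to the factor `m ^ n`, the residue
functional in degree `n (d - 2)`. -/
theorem omega_toMilnor_eq {f : MvPolynomial (Fin n) ℂ} {m : ℕ} (hm : 0 < m)
    (hf : f.IsHomogeneous (m + 1)) {ω : MvPolynomial (Fin n) ℂ →ₗ[ℂ] ℂ}
    (hI : ∀ g ∈ jacobianIdeal f, ω g = 0) (hH : ω (hessian f) = (m : ℂ) ^ n)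
    (hω : ∀ g, g - ∑ β ∈ (bez f).support, C (ω (g * monomial β 1)) * coeff β (bez f) ∈
          jacobianIdeal f) {g : MvPolynomial (Fin n) ℂ} (hg : g.IsHomogeneous (n * (m - 1))) :
    omega f (toMilnor f g) = ω g / (m : ℂ) ^ n := by
  refine omega_eq_of_eq_smul (fun h => ?_)
    (toMilnor_eq_smul_iff.2 (sub_smul_hessian_mem_jacobianIdeal hm hf hH hω hg))
  have hm0 : (m : ℂ) ^ n ≠ 0 := pow_ne_zero _ (Nat.cast_ne_zero.2 hm.ne')
  exact hm0 (hH ▸ hI _ h)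

end Socle

/-! ### The generic form and the determinant as a polynomial in the coefficients -/

section Generic

variable {n d : ℕ}

/-- The form with given coefficients. -/
def form {R : Type*} [CommRing R] (c : Exps n d → R) : MvPolynomial (Fin n) R :=
  ∑ m, monomial m.1 (c m)

theorem map_form {R R' : Type*} [CommRing R] [CommRing R'] (φ : R →+* R') (c : Exps n d → R) :
    map φ (form c) = form fun m => φ (c m) := by
  simp [form]

theorem coeff_form {R : Type*} [CommRing R] (c : Exps n d → R) (m : Exps n d) :
    coeff m.1 (form c) = c m := by
  classical
  rw [form, coeff_sum, Finset.sum_eq_single m]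
  · simp
  · intro m' _ hne
    rw [coeff_monomial, if_neg fun h => hne (Subtype.ext h)]
  · simp

theorem isHomogeneous_form {R : Type*} [CommRing R] (c : Exps n d → R) :
    (form c).IsHomogeneous d :=
  IsHomogeneous.sum _ _ _ fun m _ => isHomogeneous_monomial _ m.2

theorem coords_form (c : Exps n d → ℂ) : coords d (form c) = c :=
  funext fun m => coeff_form c m

theorem form_coords {f : MvPolynomial (Fin n) ℂ} (hf : f.IsHomogeneous d) :
    form (coords d f) = f := by
  ext γ
  by_cases h : γ.degree = d
  · exact coeff_form (coords d f) ⟨γ, h⟩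
  · rw [hf.coeff_eq_zero h, (isHomogeneous_form _).coeff_eq_zero h]

/-- The columns of the matrix of Sylvester type used for forms of degree `d`. -/
abbrev SylvesterCols (n d : ℕ) : Type :=
  (Fin n × ShiftExps n (d - 1) ((n - 1) * (d - 2))) ⊕ Exps n (d - 2)

/-- The square matrix obtained by identifying rows and columns. -/
def sylvesterSquare {R : Type*} [CommRing R] (e : Exps n ((n - 1) * (d - 2)) ≃ SylvesterCols n d)
    (f : MvPolynomial (Fin n) R) :
    Matrix (Exps n ((n - 1) * (d - 2))) (Exps n ((n - 1) * (d - 2))) R :=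
  (sylvester (d - 1) (d - 2) ((n - 1) * (d - 2)) f).submatrix id e

open Classical in
/-- The determinant of Sylvester type as a polynomial in the coefficients of the form. It depends on
the identification `e` of rows and columns by a sign only. -/
def discDet (e : Exps n ((n - 1) * (d - 2)) ≃ SylvesterCols n d) : MvPolynomial (Exps n d) ℂ :=
  (sylvesterSquare e (form X)).det

variable (e : Exps n ((n - 1) * (d - 2)) ≃ SylvesterCols n d)

theorem map_sylvesterSquare_form_X {f : MvPolynomial (Fin n) ℂ} (hf : f.IsHomogeneous d) :
    (sylvesterSquare e (form X)).map (eval (coords d f)) = sylvesterSquare e f := by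
  have : f = map (eval (coords d f)) (form X) := by
    rw [map_form]
    simp only [eval_X]
    exact (form_coords hf).symm
  conv_rhs => rw [this, sylvesterSquare, sylvester_map]
  rfl

open Classical in
theorem evalForm_discDet {f : MvPolynomial (Fin n) ℂ} (hf : f.IsHomogeneous d) :
    evalForm (discDet e) f = (sylvesterSquare e f).det := by
  rw [evalForm, discDet, RingHom.map_det, RingHom.mapMatrix_apply, map_sylvesterSquare_form_X e hf]

theorem vecMul_sylvesterSquare (f : MvPolynomial (Fin n) ℂ)
    (v : Exps n ((n - 1) * (d - 2)) → ℂ) (γ : Exps n ((n - 1) * (d - 2))) :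
    Matrix.vecMul v (sylvesterSquare e f) γ =
      Matrix.vecMul v (sylvester (d - 1) (d - 2) ((n - 1) * (d - 2)) f) (e γ) :=
  rfl

theorem pred_mul_add_self (hn : 0 < n) (k : ℕ) : (n - 1) * k + k = n * k := by
  obtain ⟨n, rfl⟩ : ∃ k, n = k + 1 := ⟨n - 1, by omega⟩
  rw [Nat.add_sub_cancel, add_mul, one_mul]

/-- The determinant of Sylvester type vanishes exactly at the singular forms. -/
theorem evalForm_discDet_eq_zero_iff (hn : 0 < n) (hd : 2 ≤ d) {f : MvPolynomial (Fin n) ℂ}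
    (hf : f.IsHomogeneous d) : evalForm (discDet e) f = 0 ↔ IsSingularForm f := by
  classical
  have hst : (n - 1) * (d - 2) + (d - 2) = n * (d - 1 - 1) := by
    rw [pred_mul_add_self hn, Nat.sub_sub]
  have hf' : f.IsHomogeneous (d - 1 + 1) := by
    rwa [Nat.sub_add_cancel (by omega)]
  rw [evalForm_discDet e hf, ← Matrix.exists_vecMul_eq_zero_iff]
  constructor
  · rintro ⟨v, hv0, hv⟩
    by_contra hns
    obtain ⟨ω, -, -, hω⟩ := exists_residue (by omega) hf' hns
    have hv' : ∀ p, Matrix.vecMul v (sylvester (d - 1) (d - 2) ((n - 1) * (d - 2)) f) p = 0 := by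
      intro p
      have := congrFun hv (e.symm p)
      rwa [vecMul_sylvesterSquare, e.apply_symm_apply] at this
    refine hv0 (funext fun γ => ?_)
    rw [eq_sum_residue_mul hf' (by omega) hst hω v (fun p => hv' _) γ]
    simp [hv']
  · intro h
    obtain ⟨v, hv0, hv⟩ := exists_vecMul_sylvester_eq_zero (s := d - 2) hf' (by omega) hst h
    refine ⟨v, hv0, funext fun γ => ?_⟩
    rw [vecMul_sylvesterSquare, hv]
    rfl

theorem exists_le_degree_eq {σ : Type*} (i : σ →₀ ℕ) {k : ℕ} (hk : k ≤ i.degree) :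
    ∃ α ≤ i, α.degree = k := by
  classical
  induction k with
  | zero => exact ⟨0, fun _ => Nat.zero_le _, by simp⟩
  | succ k ih =>
    obtain ⟨α, hα, hdeg⟩ := ih (by omega)
    have hne : α ≠ i := by
      rintro rfl
      omega
    obtain ⟨j, hj⟩ : ∃ j, α j < i j := by
      by_contra! hcon
      exact hne (le_antisymm hα hcon)
    refine ⟨α + Finsupp.single j 1, fun l => ?_, by simp [hdeg]⟩
    by_cases hl : l = j
    · subst hl
      simpa using hj
    · simpa [Finsupp.single_eq_of_ne hl] using hα l

/-- The coefficients `μ_i`, multiplied by the determinant of Sylvester type, are polynomial: by the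
reproducing property they are entries of its adjugate matrix. -/
theorem exists_evalForm_eq_discDet_mul_mu (hn : 0 < n) (hd : 2 ≤ d) (i : Exps n (n * (d - 2))) :
    ∃ P : MvPolynomial (Exps n d) ℂ, ∀ f : MvPolynomial (Fin n) ℂ, f.IsHomogeneous d →
      ¬ IsSingularForm f → evalForm P f = evalForm (discDet e) f * mu i f := by
  classical
  have hst : (n - 1) * (d - 2) + (d - 2) = n * (d - 1 - 1) := by
    rw [pred_mul_add_self hn, Nat.sub_sub]
  obtain ⟨γ, hγi, hγ⟩ := exists_le_degree_eq i.1 (k := (n - 1) * (d - 2)) (by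
    rw [i.2, ← pred_mul_add_self hn]
    omega)
  have hadd : γ + (i.1 - γ) = i.1 := add_tsub_cancel_of_le hγi
  have hβ : (i.1 - γ).degree = d - 2 := by
    have := congrArg Finsupp.degree hadd
    rw [map_add, hγ] at this
    have h1 := i.2
    have h2 := pred_mul_add_self hn (d - 2)
    omega
  let γ' : Exps n ((n - 1) * (d - 2)) := ⟨γ, hγ⟩
  let β' : Exps n (d - 2) := ⟨i.1 - γ, hβ⟩
  refine ⟨C (((d - 1 : ℕ) : ℂ) ^ n)⁻¹ *
    (sylvesterSquare e (form X)).adjugate (e.symm (Sum.inr β')) γ', fun f hf hns => ?_⟩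
  have hf' : f.IsHomogeneous (d - 1 + 1) := by
    rwa [Nat.sub_add_cancel (by omega)]
  obtain ⟨ω, hI, hH, hω⟩ := exists_residue (by omega) hf' hns
  have hadj : eval (coords d f) ((sylvesterSquare e (form X)).adjugate
      (e.symm (Sum.inr β')) γ') = (sylvesterSquare e f).adjugate (e.symm (Sum.inr β')) γ' := by
    rw [← map_sylvesterSquare_form_X e hf, ← RingHom.mapMatrix_apply, ← RingHom.map_adjugate]
    rfl
  set v : Exps n ((n - 1) * (d - 2)) → ℂ :=
    (sylvesterSquare e f).adjugate (e.symm (Sum.inr β')) with hv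
  have hvM : ∀ p, Matrix.vecMul v (sylvester (d - 1) (d - 2) ((n - 1) * (d - 2)) f) p =
      if Sum.inr β' = p then (sylvesterSquare e f).det else 0 := by
    intro p
    have h1 := congrFun (congrFun (Matrix.adjugate_mul (sylvesterSquare e f))
      (e.symm (Sum.inr β'))) (e.symm p)
    have h2 : ((sylvesterSquare e f).adjugate * sylvesterSquare e f) (e.symm (Sum.inr β'))
        (e.symm p) = Matrix.vecMul v (sylvesterSquare e f) (e.symm p) := rfl
    rw [h2, vecMul_sylvesterSquare, e.apply_symm_apply] at h1
    rw [h1, Matrix.smul_apply, Matrix.one_apply]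
    simp
  have h3 := eq_sum_residue_mul hf' (by omega) hst hω v (fun p => by rw [hvM]; simp) γ'
  simp only [hvM] at h3
  rw [Finset.sum_eq_single β'] at h3
  · rw [if_pos rfl] at h3
    have hN : (monomial i.1 (1 : ℂ)).IsHomogeneous (n * (d - 1 - 1)) :=
      isHomogeneous_monomial _ (by rw [i.2, Nat.sub_sub])
    rw [mu, omega_toMilnor_eq (by omega) hf' hI hH hω hN, evalForm_discDet e hf, evalForm, map_mul,
      eval_C, hadj]
    change _ * v γ' = _
    rw [h3]
    simp only [γ', β', hadd]
    ring
  · intro β _ hne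
    rw [if_neg, mul_zero]
    intro h
    exact hne (Sum.inr_injective h).symm
  · simp

/-- The degree of the determinant of Sylvester type, computed by scaling the columns. -/
theorem evalForm_discDet_smul {f : MvPolynomial (Fin n) ℂ} (hf : f.IsHomogeneous d) (c : ℂ) :
    evalForm (discDet e) (c • f) =
      c ^ (n * Fintype.card (ShiftExps n (d - 1) ((n - 1) * (d - 2))) +
        n * Fintype.card (Exps n (d - 2))) * evalForm (discDet e) f := by
  classical
  have hcf : (c • f).IsHomogeneous d := by
    rw [smul_eq_C_mul]
    simpa using (isHomogeneous_C (Fin n) c).mul hf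
  rw [evalForm_discDet e hcf, evalForm_discDet e hf]
  have h1 : sylvesterSquare e (c • f) = Matrix.of fun γ δ =>
      (Sum.elim (fun _ => c) (fun _ => c ^ n) (e δ) : ℂ) * sylvesterSquare e f γ δ := by
    rw [sylvesterSquare, sylvester_smul]
    rfl
  have h2 : ∏ δ, (Sum.elim (fun _ => c) (fun _ => c ^ n) (e δ) : ℂ) =
      c ^ (n * Fintype.card (ShiftExps n (d - 1) ((n - 1) * (d - 2))) +
        n * Fintype.card (Exps n (d - 2))) := by
    rw [Equiv.prod_comp e (Sum.elim (fun _ => c) fun _ => c ^ n), Fintype.prod_sum_type]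
    simp [Finset.prod_const, Finset.card_univ, ← pow_mul, pow_add]
  rw [h1, Matrix.det_mul_row, h2]

end Generic

/-! ### The number of rows, the number of columns and the degree -/

section Count

variable {d : ℕ}

/-- For two or three variables the matrix is square. -/
theorem card_sylvesterCols {n : ℕ} (hn : n = 2 ∨ n = 3) (hd : 3 ≤ d) :
    Fintype.card (SylvesterCols n d) = Fintype.card (Exps n ((n - 1) * (d - 2))) := by
  obtain ⟨k, rfl⟩ : ∃ k, d = k + 3 := ⟨d - 3, by omega⟩
  rcases hn with rfl | rfl
  · rw [Fintype.card_sum, Fintype.card_prod, card_shiftExps_of_lt _ (by omega)]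
    simp
  · rw [Fintype.card_sum, Fintype.card_prod, card_shiftExps _ (by omega), card_exps, card_exps,
      Fintype.card_fin]
    have e1 : (3 - 1) * (k + 3 - 2) - (k + 3 - 1) = k := by omega
    have e2 : (3 - 1) * (k + 3 - 2) = 2 * k + 2 := by omega
    have e3 : k + 3 - 2 = k + 1 := by omega
    rw [e1, e2, e3]
    have c1 : (3 + k - 1).choose k = (k + 2).choose 2 := by
      rw [← Nat.choose_symm_of_eq_add (show k + 2 = k + 2 from rfl)]; congr 1; omega
    have c2 : (3 + (k + 1) - 1).choose (k + 1) = (k + 3).choose 2 := by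
      rw [← Nat.choose_symm_of_eq_add (show k + 3 = (k + 1) + 2 by omega)]; congr 1; omega
    have c3 : (3 + (2 * k + 2) - 1).choose (2 * k + 2) = (2 * k + 4).choose 2 := by
      rw [← Nat.choose_symm_of_eq_add (show 2 * k + 4 = (2 * k + 2) + 2 by omega)]
      congr 1; omega
    rw [c1, c2, c3]
    qify
    rw [Nat.cast_choose_two, Nat.cast_choose_two, Nat.cast_choose_two]
    push_cast
    ring

/-- The degree of the determinant of Sylvester type, as counted in `evalForm_discDet_smul`. For
`n = 2` there are no columns `z ^ α ∂f/∂zᵢ`, since `d - 2 < d - 1`. -/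
theorem degree_discDet {n : ℕ} (hn : n = 2 ∨ n = 3) (hd : 3 ≤ d) :
    n * Fintype.card (ShiftExps n (d - 1) ((n - 1) * (d - 2))) +
        n * Fintype.card (Exps n (d - 2)) = n * (d - 1) ^ (n - 1) := by
  obtain ⟨k, rfl⟩ : ∃ k, d = k + 3 := ⟨d - 3, by omega⟩
  rcases hn with rfl | rfl
  · rw [card_shiftExps_of_lt _ (by omega), card_exps]
    have e1 : 2 + (k + 3 - 2) - 1 = (k + 3 - 2) + 1 := by omega
    rw [e1, Nat.choose_succ_self_right]
    simp
  · rw [card_shiftExps _ (by omega), card_exps]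
    have e1 : (3 - 1) * (k + 3 - 2) - (k + 3 - 1) = k := by omega
    have e3 : k + 3 - 2 = k + 1 := by omega
    rw [e1, e3]
    have c1 : (3 + k - 1).choose k = (k + 2).choose 2 := by
      rw [← Nat.choose_symm_of_eq_add (show k + 2 = k + 2 from rfl)]; congr 1; omega
    have c2 : (3 + (k + 1) - 1).choose (k + 1) = (k + 3).choose 2 := by
      rw [← Nat.choose_symm_of_eq_add (show k + 3 = (k + 1) + 2 by omega)]; congr 1; omega
    rw [c1, c2, show k + 3 - 1 = k + 2 by omega, show 3 - 1 = 2 by rfl]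
    qify
    rw [Nat.cast_choose_two, Nat.cast_choose_two]
    push_cast
    ring

end Count

/-! ### Linear substitutions -/

section Subst

variable {n : ℕ} {R : Type*} [CommRing R]

/-- The linear substitution `f(z) ↦ f(A z)`. -/
def subst (A : Matrix (Fin n) (Fin n) R) :
    MvPolynomial (Fin n) R →ₐ[R] MvPolynomial (Fin n) R :=
  bind₁ fun i => ∑ j, C (A i j) * X j

theorem subst_X (A : Matrix (Fin n) (Fin n) R) (i : Fin n) :
    subst A (X i) = ∑ j, C (A i j) * X j :=
  bind₁_X_right _ _

theorem subst_C (A : Matrix (Fin n) (Fin n) R) (c : R) : subst A (C c) = C c :=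
  bind₁_C_right _ _

theorem subst_subst (A B : Matrix (Fin n) (Fin n) R) (f : MvPolynomial (Fin n) R) :
    subst A (subst B f) = subst (B * A) f := by
  have : (subst A).comp (subst B) = subst (B * A) := by
    ext1 i
    rw [AlgHom.comp_apply, subst_X, subst_X, map_sum]
    simp only [map_mul, subst_C, subst_X, Matrix.mul_apply, map_sum, Finset.mul_sum,
      Finset.sum_mul]
    rw [Finset.sum_comm]
    simp only [mul_assoc]
  rw [← this]
  rfl

theorem subst_one (f : MvPolynomial (Fin n) R) : subst 1 f = f := by
  have : subst (1 : Matrix (Fin n) (Fin n) R) = AlgHom.id R _ := by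
    ext1 i
    rw [subst_X, Finset.sum_eq_single i]
    · simp
    · intro j _ h
      rw [Matrix.one_apply_ne h.symm, map_zero, zero_mul]
    · simp
  rw [this]
  rfl

theorem map_subst {R' : Type*} [CommRing R'] (φ : R →+* R') (A : Matrix (Fin n) (Fin n) R)
    (f : MvPolynomial (Fin n) R) : map φ (subst A f) = subst (A.map φ) (map φ f) := by
  rw [subst, map_bind₁, subst]
  simp

theorem isHomogeneous_subst (A : Matrix (Fin n) (Fin n) R) {f : MvPolynomial (Fin n) R} {d : ℕ}
    (hf : f.IsHomogeneous d) : (subst A f).IsHomogeneous d := by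
  have h := hf.aeval (g := fun i => ∑ j, C (A i j) * X j) (n := 1) fun i =>
    IsHomogeneous.sum _ _ _ fun j _ => by
      simpa using (isHomogeneous_C (Fin n) (A i j)).mul (isHomogeneous_X R j)
  rwa [one_mul] at h

theorem eval_subst (A : Matrix (Fin n) (Fin n) R) (z : Fin n → R) (f : MvPolynomial (Fin n) R) :
    eval z (subst A f) = eval (A.mulVec z) f := by
  rw [← coe_aeval_eq_eval, ← coe_aeval_eq_eval]
  have : (aeval z).comp (subst A) = aeval (A.mulVec z) := by
    ext1 i
    rw [AlgHom.comp_apply, subst_X]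
    simp [Matrix.mulVec, dotProduct]
  change ((aeval z).comp (subst A)) f = _
  rw [this]
  rfl

theorem pderiv_subst (A : Matrix (Fin n) (Fin n) R) (j : Fin n) (f : MvPolynomial (Fin n) R) :
    pderiv j (subst A f) = ∑ i, C (A i j) * subst A (pderiv i f) := by
  classical
  induction f using MvPolynomial.induction_on with
  | C a => simp
  | add p q hp hq => simp only [map_add, hp, hq, mul_add, Finset.sum_add_distrib]
  | mul_X p l ih =>
    have h1 : pderiv j (subst A (X l)) = C (A l j) := by
      rw [subst_X, map_sum, Finset.sum_eq_single j]
      · simp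
      · intro i _ h
        rw [pderiv_C_mul, pderiv_X_of_ne h, mul_zero]
      · simp
    rw [map_mul, pderiv_mul, ih, h1, Finset.sum_mul]
    have h2 : ∀ i, C (A i j) * subst A (pderiv i (p * X l)) =
        C (A i j) * subst A (pderiv i p) * subst A (X l) +
          (if i = l then subst A p * C (A l j) else 0) := by
      intro i
      rw [pderiv_mul, map_add, map_mul, map_mul]
      by_cases h : i = l
      · subst h
        rw [if_pos rfl, pderiv_X_self, map_one]
        ring
      · rw [if_neg h, pderiv_X_of_ne (Ne.symm h), map_zero]
        ring
    simp only [h2, Finset.sum_add_distrib, Finset.sum_ite_eq', Finset.mem_univ, if_true]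

theorem subst_diagonal_X {R : Type*} [CommRing R] (u : Fin n → R) (i : Fin n) :
    subst (Matrix.diagonal u) (X i) = C (u i) * X i := by
  rw [subst_X, Finset.sum_eq_single i]
  · simp
  · intro j _ h
    rw [Matrix.diagonal_apply_ne _ h.symm, map_zero, zero_mul]
  · simp

theorem coeff_subst_diagonal (u : Fin n → R) (f : MvPolynomial (Fin n) R) (m : Fin n →₀ ℕ) :
    coeff m (subst (Matrix.diagonal u) f) = (∏ i, u i ^ m i) * coeff m f := by
  classical
  induction f using MvPolynomial.induction_on' with
  | monomial α c =>
    have h : subst (Matrix.diagonal u) (monomial α c) = monomial α ((∏ i, u i ^ α i) * c) := by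
      rw [monomial_eq_C_mul_prod, monomial_eq_C_mul_prod, map_mul, subst_C, map_prod]
      simp only [map_pow, subst_diagonal_X, mul_pow, Finset.prod_mul_distrib, map_mul, map_prod]
      ring
    rw [h, coeff_monomial, coeff_monomial]
    split_ifs with hα
    · rw [hα]
    · rw [mul_zero]
  | add p q hp hq => rw [map_add, coeff_add, hp, hq, coeff_add, mul_add]

theorem actForm_eq_subst (g : GL (Fin n) ℂ) (f : MvPolynomial (Fin n) ℂ) :
    actForm g f = subst (g⁻¹).val f :=
  rfl

/-- Singularity is preserved by every linear substitution, invertible or not: a vector in the kernel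
of the substitution is a singular point. -/
theorem IsSingularForm.subst {f : MvPolynomial (Fin n) ℂ} {d : ℕ} (hd : 2 ≤ d)
    (hf : f.IsHomogeneous d) (h : IsSingularForm f) (A : Matrix (Fin n) (Fin n) ℂ) :
    IsSingularForm (subst A f) := by
  obtain ⟨z, hz, h0⟩ := h
  by_cases hA : A.det = 0
  · obtain ⟨v, hv, hAv⟩ := Matrix.exists_mulVec_eq_zero_iff.2 hA
    refine ⟨v, hv, fun j => ?_⟩
    rw [pderiv_subst, map_sum]
    refine Finset.sum_eq_zero fun i _ => ?_
    have : eval (0 : Fin n → ℂ) (pderiv i f) = 0 := by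
      have h2 : coeff 0 (pderiv i f) = 0 := (hf.pderiv (i := i)).coeff_eq_zero (by
        rw [map_zero]
        omega)
      rw [← constantCoeff_eq] at h2
      rw [eval_zero]
      exact h2
    rw [map_mul, eval_subst, hAv, this, mul_zero]
  · have hu : IsUnit A.det := isUnit_iff_ne_zero.2 hA
    have hinv : A.mulVec (A⁻¹.mulVec z) = z := by
      rw [Matrix.mulVec_mulVec, Matrix.mul_nonsing_inv _ hu, Matrix.one_mulVec]
    refine ⟨A⁻¹.mulVec z, fun h => hz ?_, fun j => ?_⟩
    · rw [← hinv, h, Matrix.mulVec_zero]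
    · rw [pderiv_subst, map_sum]
      refine Finset.sum_eq_zero fun i _ => ?_
      rw [map_mul, eval_subst, hinv, h0, mul_zero]

theorem isSingularForm_subst_iff {f : MvPolynomial (Fin n) ℂ} {d : ℕ} (hd : 2 ≤ d)
    (hf : f.IsHomogeneous d) {A : Matrix (Fin n) (Fin n) ℂ} (hA : A.det ≠ 0) :
    IsSingularForm (subst A f) ↔ IsSingularForm f := by
  refine ⟨fun h => ?_, fun h => h.subst hd hf A⟩
  have := h.subst hd (isHomogeneous_subst A hf) A⁻¹
  rwa [subst_subst, Matrix.mul_nonsing_inv _ (isUnit_iff_ne_zero.2 hA), subst_one] at this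

end Subst

/-! ### One-parameter families -/

section Family

variable {n d : ℕ}

/-- The value of a polynomial function on a family of forms that depends polynomially on a
parameter, as a polynomial in the parameter. -/
def evalFamily (P : MvPolynomial (Exps n d) ℂ) (G : MvPolynomial (Fin n) (Polynomial ℂ)) :
    Polynomial ℂ :=
  aeval (fun m : Exps n d => coeff m.1 G) P

theorem eval_evalFamily (P : MvPolynomial (Exps n d) ℂ) (G : MvPolynomial (Fin n) (Polynomial ℂ))
    (t : ℂ) : (evalFamily P G).eval t = evalForm P (map (Polynomial.evalRingHom t) G) := by
  induction P using MvPolynomial.induction_on with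
  | C a => simp [evalFamily, evalForm]
  | add p q hp hq =>
    simp only [evalFamily, evalForm, map_add, Polynomial.eval_add] at *
    rw [hp, hq]
  | mul_X p m ih =>
    simp only [evalFamily, evalForm, map_mul, Polynomial.eval_mul, aeval_X, eval_X] at *
    rw [ih, coords, coeff_map]
    rfl

theorem polynomial_eq_C_of_forall_eval_ne_zero {p : Polynomial ℂ} (h : ∀ t, p.eval t ≠ 0) :
    p = Polynomial.C (p.eval 0) := by
  have hdeg : p.degree ≤ 0 := by
    by_contra hlt
    obtain ⟨t, ht⟩ := IsAlgClosed.exists_root p fun h0 => hlt h0.le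
    exact h t ht
  rw [Polynomial.eq_C_of_degree_le_zero hdeg]
  simp

theorem polynomial_eq_C_mul_X_pow {p : Polynomial ℂ} (h : ∀ t, t ≠ 0 → p.eval t ≠ 0) :
    ∃ e : ℕ, p = Polynomial.C (p.eval 1) * Polynomial.X ^ e := by
  have hp : p ≠ 0 := by
    rintro rfl
    exact h 1 one_ne_zero (by simp)
  obtain ⟨q, hq, hdvd⟩ := Polynomial.exists_eq_pow_rootMultiplicity_mul_and_not_dvd p hp 0
  rw [map_zero, sub_zero] at hq hdvd
  have hq' : ∀ t, q.eval t ≠ 0 := by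
    intro t ht
    by_cases h0 : t = 0
    · exact hdvd (Polynomial.X_dvd_iff.2 (by
        rw [Polynomial.coeff_zero_eq_eval_zero]
        rwa [h0] at ht))
    · refine h t h0 ?_
      rw [hq, Polynomial.eval_mul, ht, mul_zero]
  have hqc := polynomial_eq_C_of_forall_eval_ne_zero hq'
  refine ⟨p.rootMultiplicity 0, ?_⟩
  have h1 : p.eval 1 = q.eval 0 := by
    rw [hq, hqc]
    simp
  rw [h1, ← hqc, mul_comm]
  exact hq

theorem map_evalRingHom_comp_C (t : ℂ) (f : MvPolynomial (Fin n) ℂ) :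
    map (Polynomial.evalRingHom t) (map Polynomial.C f) = f := by
  rw [map_map]
  have : (Polynomial.evalRingHom t).comp Polynomial.C = RingHom.id ℂ := by ext c; simp
  rw [this, map_id]

end Family

/-! ### Semi-invariance under linear substitutions -/

section Weights

/-- A polynomial that is multiplied by some power of `s`, depending on the point a priori, when the
coordinates `xᵢ` are scaled by `s ^ wᵢ`, is multiplied by the same power at all points: its weighted
homogeneous components cannot be nonzero at a common point. -/
theorem exists_weight {τ : Type*} (w : τ → ℕ) {P : MvPolynomial τ ℂ}
    (h : ∀ x, eval x P ≠ 0 → ∃ e : ℕ, ∀ s : ℂ,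
      eval (fun i => s ^ w i * x i) P = s ^ e * eval x P) :
    ∃ E : ℕ, ∀ x s, eval (fun i => s ^ w i * x i) P = s ^ E * eval x P := by
  classical
  let Θ : (τ → ℂ) → Polynomial ℂ := fun x =>
    ∑ m ∈ P.support, Polynomial.C (coeff m P * m.prod fun i k => x i ^ k) *
      Polynomial.X ^ (Finsupp.weight w m)
  have hΘ : ∀ x s, (Θ x).eval s = eval (fun i => s ^ w i * x i) P := by
    intro x s
    rw [eval_eq, Polynomial.eval_finsetSum]
    refine Finset.sum_congr rfl fun m _ => ?_
    simp only [Polynomial.eval_mul, Polynomial.eval_C, Polynomial.eval_pow, Polynomial.eval_X,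
      Finsupp.weight_apply, Finsupp.prod, mul_pow, Finset.prod_mul_distrib, Finsupp.sum,
      smul_eq_mul, ← pow_mul, Finset.prod_pow_eq_pow_sum]
    rw [mul_assoc, mul_comm (∏ i ∈ m.support, x i ^ m i)]
    congr 3
    exact Finset.sum_congr rfl fun _ _ => mul_comm _ _
  have hcoeff : ∀ x e, (Θ x).coeff e = eval x (weightedHomogeneousComponent w e P) := by
    intro x e
    rw [weightedHomogeneousComponent_apply, map_sum, Polynomial.finsetSum_coeff, Finset.sum_filter]
    refine Finset.sum_congr rfl fun m _ => ?_
    rw [Polynomial.coeff_C_mul, Polynomial.coeff_X_pow, eval_monomial]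
    by_cases he : Finsupp.weight w m = e
    · rw [if_pos he.symm, if_pos he, mul_one]
    · rw [if_neg (Ne.symm he), if_neg he, mul_zero]
  by_cases hP : P = 0
  · exact ⟨0, by simp [hP]⟩
  have hmono : ∀ x, eval x P ≠ 0 → ∃ e : ℕ, Θ x = Polynomial.C (eval x P) * Polynomial.X ^ e := by
    intro x hx
    obtain ⟨e, he⟩ := h x hx
    refine ⟨e, Polynomial.funext fun s => ?_⟩
    rw [hΘ, he, Polynomial.eval_mul, Polynomial.eval_C, Polynomial.eval_pow, Polynomial.eval_X,
      mul_comm]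
  have huniq : ∀ e e', weightedHomogeneousComponent w e P ≠ 0 →
      weightedHomogeneousComponent w e' P ≠ 0 → e = e' := by
    intro e e' h1 h2
    have h3 : P * weightedHomogeneousComponent w e P * weightedHomogeneousComponent w e' P ≠ 0 :=
      mul_ne_zero (mul_ne_zero hP h1) h2
    obtain ⟨x, hx⟩ : ∃ x, eval x (P * weightedHomogeneousComponent w e P *
        weightedHomogeneousComponent w e' P) ≠ 0 := by
      by_contra! hall
      exact h3 (MvPolynomial.funext fun x => by rw [hall, map_zero])
    rw [map_mul, map_mul] at hx
    have hx1 := left_ne_zero_of_mul (left_ne_zero_of_mul hx)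
    have hx2 := right_ne_zero_of_mul (left_ne_zero_of_mul hx)
    have hx3 := right_ne_zero_of_mul hx
    obtain ⟨a, ha⟩ := hmono x hx1
    rw [← hcoeff, ha, Polynomial.coeff_C_mul, Polynomial.coeff_X_pow] at hx2 hx3
    have e1 : e = a := by
      by_contra hne
      rw [if_neg hne, mul_zero] at hx2
      exact hx2 rfl
    have e2 : e' = a := by
      by_contra hne
      rw [if_neg hne, mul_zero] at hx3
      exact hx3 rfl
    rw [e1, e2]
  obtain ⟨x₀, hx₀⟩ : ∃ x, eval x P ≠ 0 := by
    by_contra! hall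
    exact hP (MvPolynomial.funext fun x => by rw [hall, map_zero])
  obtain ⟨E, hE⟩ := hmono x₀ hx₀
  have hE0 : weightedHomogeneousComponent w E P ≠ 0 := by
    intro h0
    have := hcoeff x₀ E
    rw [h0, map_zero, hE, Polynomial.coeff_C_mul, Polynomial.coeff_X_pow, if_pos rfl,
      mul_one] at this
    exact hx₀ this
  refine ⟨E, fun x s => ?_⟩
  have hΘx : Θ x = Polynomial.C ((Θ x).coeff E) * Polynomial.X ^ E := by
    ext e
    rw [Polynomial.coeff_C_mul, Polynomial.coeff_X_pow]
    by_cases he : e = E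
    · rw [if_pos he, mul_one, he]
    · rw [if_neg he, mul_zero, hcoeff]
      by_contra hne
      refine he (huniq e E (fun h0 => hne ?_) hE0)
      rw [h0, map_zero]
  have h1 := hΘ x 1
  rw [hΘx] at h1
  simp only [Polynomial.eval_mul, Polynomial.eval_C, Polynomial.eval_pow, Polynomial.eval_X,
    one_pow, mul_one, one_mul] at h1
  rw [← hΘ, hΘx, h1, Polynomial.eval_mul, Polynomial.eval_C, Polynomial.eval_pow,
    Polynomial.eval_X, mul_comm]

end Weights

section SemiInvariance

variable {n d : ℕ} {D : MvPolynomial (Exps n d) ℂ}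

theorem det_transvection_eq_one {i j : Fin n} (hij : i ≠ j) (t : ℂ) :
    (Matrix.transvection i j t).det = 1 :=
  Matrix.det_transvection_of_ne i j hij t

/-- For nonsingular `f` the values at `f(T z)` for the transvections `T` of parameter `t` are
polynomial in `t` without zeros, hence constant. -/
theorem evalForm_subst_transvection (hd : 2 ≤ d)
    (h0 : ∀ f : MvPolynomial (Fin n) ℂ, f.IsHomogeneous d →
      (evalForm D f = 0 ↔ IsSingularForm f))
    {f : MvPolynomial (Fin n) ℂ} (hf : f.IsHomogeneous d) {i j : Fin n} (hij : i ≠ j) (t : ℂ) :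
    evalForm D (subst (Matrix.transvection i j t) f) = evalForm D f := by
  by_cases hs : IsSingularForm f
  · rw [(h0 f hf).2 hs, (h0 _ (isHomogeneous_subst _ hf)).2 (hs.subst hd hf _)]
  · let G : MvPolynomial (Fin n) (Polynomial ℂ) :=
      subst (Matrix.transvection i j Polynomial.X) (map Polynomial.C f)
    have hG : ∀ t, (evalFamily D G).eval t =
        evalForm D (subst (Matrix.transvection i j t) f) := by
      intro t
      rw [eval_evalFamily, map_subst, map_evalRingHom_comp_C]
      congr 3
      ext a b
      simp only [Matrix.transvection, Matrix.map_apply, Matrix.add_apply, map_add,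
        Matrix.one_apply, Matrix.single_apply]
      split_ifs <;> simp
    have hne : ∀ t, (evalFamily D G).eval t ≠ 0 := by
      intro t ht
      rw [hG, h0 _ (isHomogeneous_subst _ hf), isSingularForm_subst_iff hd hf] at ht
      · exact hs ht
      · rw [det_transvection_eq_one hij]
        exact one_ne_zero
    have hc := polynomial_eq_C_of_forall_eval_ne_zero hne
    have h1 := hG t
    rw [hc, Polynomial.eval_C, hG, Matrix.transvection_zero, subst_one] at h1
    exact h1.symm

/-- Scaling one variable by `s` multiplies the value at a nonsingular form by a power of `s`, as it
is a polynomial in `s` without nonzero zeros; by `exists_weight` the exponent is the same for all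
forms. -/
theorem exists_weight_subst_diagonal (hd : 2 ≤ d)
    (h0 : ∀ f : MvPolynomial (Fin n) ℂ, f.IsHomogeneous d →
      (evalForm D f = 0 ↔ IsSingularForm f)) (i : Fin n) :
    ∃ E : ℕ, ∀ f : MvPolynomial (Fin n) ℂ, f.IsHomogeneous d → ∀ s : ℂ,
      evalForm D (subst (Matrix.diagonal (Function.update 1 i s)) f) = s ^ E * evalForm D f := by
  have hcoeff : ∀ {R : Type} [CommRing R] (s : R) (f : MvPolynomial (Fin n) R) (m : Fin n →₀ ℕ),
      coeff m (subst (Matrix.diagonal (Function.update 1 i s)) f) = s ^ m i * coeff m f := by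
    intro R _ s f m
    rw [coeff_subst_diagonal, Finset.prod_eq_single i]
    · simp
    · intro j _ hj
      simp [hj]
    · simp
  have hsub : ∀ (f : MvPolynomial (Fin n) ℂ) (s : ℂ),
      evalForm D (subst (Matrix.diagonal (Function.update 1 i s)) f) =
        eval (fun m : Exps n d => s ^ m.1 i * coords d f m) D := by
    intro f s
    rw [evalForm]
    congr 2
    funext m
    exact hcoeff s f m.1
  obtain ⟨E, hE⟩ := exists_weight (fun m : Exps n d => m.1 i) (P := D) (by
    intro x hx
    have hform : evalForm D (form x) = eval x D := by rw [evalForm, coords_form]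
    rw [← hform] at hx
    have hns : ¬ IsSingularForm (form x) := fun h => hx ((h0 _ (isHomogeneous_form x)).2 h)
    let G : MvPolynomial (Fin n) (Polynomial ℂ) :=
      subst (Matrix.diagonal (Function.update 1 i Polynomial.X)) (map Polynomial.C (form x))
    have hG : ∀ s, (evalFamily D G).eval s =
        evalForm D (subst (Matrix.diagonal (Function.update 1 i s)) (form x)) := by
      intro s
      rw [eval_evalFamily, map_subst, map_evalRingHom_comp_C]
      congr 3
      ext a b
      by_cases hab : a = b
      · subst hab
        by_cases ha : a = i
        · subst ha; simp
        · simp [ha]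
      · simp [hab]
    obtain ⟨e, he⟩ := polynomial_eq_C_mul_X_pow (p := evalFamily D G) (by
      intro s hs h
      rw [hG, h0 _ (isHomogeneous_subst _ (isHomogeneous_form x)),
        isSingularForm_subst_iff hd (isHomogeneous_form x)] at h
      · exact hns h
      · rw [Matrix.det_diagonal, Finset.prod_eq_single i]
        · simpa using hs
        · intro j _ hj
          simp [hj]
        · simp)
    refine ⟨e, fun s => ?_⟩
    have h1 := hG s
    have h2 := hG 1
    have h3 : Function.update (1 : Fin n → ℂ) i 1 = fun _ => 1 := by
      funext j
      by_cases hj : j = i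
      · subst hj; simp
      · simp [hj]
    rw [h3, Matrix.diagonal_one, subst_one, hform] at h2
    rw [he, h2, hsub, coords_form] at h1
    rw [← h1, Polynomial.eval_mul, Polynomial.eval_C, Polynomial.eval_pow, Polynomial.eval_X,
      mul_comm])
  refine ⟨E, fun f hf s => ?_⟩
  rw [hsub, hE, evalForm]

theorem diagonal_update_eq (i : Fin n) (s : ℂ) :
    Matrix.diagonal (Function.update 1 i s) = 1 + (s - 1) • Matrix.single i i (1 : ℂ) := by
  ext a b
  by_cases hab : a = b
  · subst hab
    by_cases ha : a = i
    · subst ha; simp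
    · simp [ha, Ne.symm ha]
  · have : ¬ (i = a ∧ i = b) := fun h => hab (h.1.symm.trans h.2)
    simp [hab, this]

/-- The product `(1 + Eᵢⱼ)(1 - Eⱼᵢ)(1 + Eᵢⱼ)` of transvections exchanges the diagonal positions `i`
and `j`. -/
theorem transvections_mul_diagonal {i j : Fin n} (hij : i ≠ j) (s : ℂ) :
    Matrix.transvection i j 1 * Matrix.transvection j i (-1) * Matrix.transvection i j 1 *
        Matrix.diagonal (Function.update 1 i s) =
      Matrix.diagonal (Function.update 1 j s) * (Matrix.transvection i j 1 *
        Matrix.transvection j i (-1) * Matrix.transvection i j (1 : ℂ)) := by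
  rw [diagonal_update_eq, diagonal_update_eq]
  have hneg : Matrix.single j i (-1 : ℂ) = -Matrix.single j i 1 := by
    ext a b
    simp only [Matrix.single_apply, Matrix.neg_apply]
    split_ifs <;> simp
  simp only [Matrix.transvection, hneg]
  have h1 : Matrix.single i j (1 : ℂ) * Matrix.single j i 1 = Matrix.single i i 1 := by simp
  have h2 : Matrix.single j i (1 : ℂ) * Matrix.single i j 1 = Matrix.single j j 1 := by simp
  have h3 : Matrix.single i j (1 : ℂ) * Matrix.single i i 1 = 0 :=
    Matrix.single_mul_single_of_ne _ _ _ _ hij.symm _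
  have h4 : Matrix.single j i (1 : ℂ) * Matrix.single i i 1 = Matrix.single j i 1 := by simp
  have h5 : Matrix.single j j (1 : ℂ) * Matrix.single i j 1 = 0 :=
    Matrix.single_mul_single_of_ne _ _ _ _ hij.symm _
  have h6 : Matrix.single j j (1 : ℂ) * Matrix.single j i 1 = Matrix.single j i 1 := by simp
  have h7 : Matrix.single i i (1 : ℂ) * Matrix.single i i 1 = Matrix.single i i 1 := by simp
  have h8 : Matrix.single j j (1 : ℂ) * Matrix.single j j 1 = Matrix.single j j 1 := by simp
  have h9 : Matrix.single i i (1 : ℂ) * Matrix.single i j 1 = Matrix.single i j 1 := by simp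
  have h10 : Matrix.single j j (1 : ℂ) * Matrix.single i i 1 = 0 :=
    Matrix.single_mul_single_of_ne _ _ _ _ hij.symm _
  generalize Matrix.single i j (1 : ℂ) = a at *
  generalize Matrix.single j i (1 : ℂ) = b at *
  generalize Matrix.single i i (1 : ℂ) = p at *
  generalize Matrix.single j j (1 : ℂ) = q at *
  have hW : (1 + a) * (1 + -b) * (1 + a) = 1 + (a + a - p * a) - b - p - q + a * a := by
    rw [← h1, ← h2]
    noncomm_ring
  have haa : a * a = 0 := by
    rw [← h9, mul_assoc, ← mul_assoc a p a, h3, zero_mul, mul_zero]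
  rw [hW, haa, h9]
  have e1 : (1 + (a + a - a) - b - p - q + 0) * p = -b := by
    simp only [add_sub_cancel_right, add_zero, add_mul, sub_mul, one_mul, h3, h4, h7, h10]
    abel
  have e2 : q * (1 + (a + a - a) - b - p - q + 0) = -b := by
    simp only [add_sub_cancel_right, add_zero, mul_add, mul_sub, mul_one, h5, h6, h8, h10]
    abel
  rw [mul_add, mul_one, mul_smul_comm, e1, add_mul, one_mul, smul_mul_assoc, e2]

/-- A polynomial in the coefficients that vanishes exactly at the singular forms and is homogeneous
of degree `K` is multiplied by `det(A) ^ E` with `n E = d K` under `f(z) ↦ f(A z)`. -/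
theorem evalForm_subst_eq_det_pow_mul (hd : 2 ≤ d) {K E : ℕ} (hKE : n * E = d * K)
    (h0 : ∀ f : MvPolynomial (Fin n) ℂ, f.IsHomogeneous d →
      (evalForm D f = 0 ↔ IsSingularForm f))
    (hK : ∀ f : MvPolynomial (Fin n) ℂ, f.IsHomogeneous d → ∀ c : ℂ,
      evalForm D (c • f) = c ^ K * evalForm D f)
    (hne : ∃ f : MvPolynomial (Fin n) ℂ, f.IsHomogeneous d ∧ ¬ IsSingularForm f)
    {f : MvPolynomial (Fin n) ℂ} (hf : f.IsHomogeneous d) {A : Matrix (Fin n) (Fin n) ℂ}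
    (hA : A.det ≠ 0) : evalForm D (subst A f) = A.det ^ E * evalForm D f := by
  classical
  obtain ⟨f₀, hf₀, hs₀⟩ := hne
  have hf₀' : evalForm D f₀ ≠ 0 := fun h => hs₀ ((h0 f₀ hf₀).1 h)
  choose e he using exists_weight_subst_diagonal hd h0
  have htr : ∀ {f : MvPolynomial (Fin n) ℂ}, f.IsHomogeneous d → ∀ {i j : Fin n}, i ≠ j →
      ∀ t : ℂ, evalForm D (subst (Matrix.transvection i j t) f) = evalForm D f :=
    fun hf _ _ hij t => evalForm_subst_transvection hd h0 hf hij t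
  have hinj : ∀ a b : ℕ, (2 : ℂ) ^ a = 2 ^ b → a = b := by
    intro a b h
    exact Nat.pow_right_injective le_rfl (by exact_mod_cast h)
  -- all diagonal positions carry the same exponent
  have heq : ∀ i j, e i = e j := by
    intro i j
    by_cases hij : i = j
    · rw [hij]
    have h1 := congrArg (fun M => evalForm D (subst M f₀)) (transvections_mul_diagonal hij 2)
    simp only [← subst_subst] at h1
    rw [he i _ (isHomogeneous_subst _ (isHomogeneous_subst _ (isHomogeneous_subst _ hf₀))),
      htr (isHomogeneous_subst _ (isHomogeneous_subst _ hf₀)) hij,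
      htr (isHomogeneous_subst _ hf₀) (Ne.symm hij), htr hf₀ hij,
      htr (isHomogeneous_subst _ (isHomogeneous_subst _ (isHomogeneous_subst _ hf₀))) hij,
      htr (isHomogeneous_subst _ (isHomogeneous_subst _ hf₀)) (Ne.symm hij),
      htr (isHomogeneous_subst _ hf₀) hij, he j _ hf₀] at h1
    exact hinj _ _ (mul_right_cancel₀ hf₀' h1)
  have hdiag : ∀ (u : Fin n → ℂ) (S : Finset (Fin n)) (f : MvPolynomial (Fin n) ℂ),
      f.IsHomogeneous d → evalForm D (subst (Matrix.diagonal fun i => if i ∈ S then u i else 1) f) =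
        (∏ i ∈ S, u i ^ e i) * evalForm D f := by
    intro u S
    induction S using Finset.induction_on with
    | empty =>
      intro f _
      have : (fun i => if i ∈ (∅ : Finset (Fin n)) then u i else 1) = fun _ => (1 : ℂ) := by
        funext i; simp
      rw [this, Matrix.diagonal_one, subst_one]
      simp
    | insert a S ha ih =>
      intro f hf
      have : (Matrix.diagonal fun i => if i ∈ insert a S then u i else 1) =
          Matrix.diagonal (Function.update 1 a (u a)) *
            Matrix.diagonal fun i => if i ∈ S then u i else 1 := by
        rw [Matrix.diagonal_mul_diagonal]
        congr 1
        funext i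
        by_cases hi : i = a
        · subst hi; simp [ha]
        · simp [hi]
      rw [this, ← subst_subst, ih _ (isHomogeneous_subst _ hf), he _ _ hf, Finset.prod_insert ha]
      ring
  have hdiag' : ∀ (u : Fin n → ℂ) (f : MvPolynomial (Fin n) ℂ), f.IsHomogeneous d →
      evalForm D (subst (Matrix.diagonal u) f) = (∏ i, u i ^ e i) * evalForm D f := by
    intro u f hf
    simpa using hdiag u Finset.univ f hf
  -- the scalar matrix `2` determines the exponent
  have hsum : ∑ i, e i = d * K := by
    have h1 := hdiag' (fun _ => 2) f₀ hf₀
    have h2 : subst (Matrix.diagonal fun _ => (2 : ℂ)) f₀ = (2 : ℂ) ^ d • f₀ := by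
      ext m
      rw [coeff_subst_diagonal, coeff_smul, smul_eq_mul, Finset.prod_pow_eq_pow_sum]
      by_cases hm : m.degree = d
      · rw [← Finsupp.degree_eq_sum, hm]
      · rw [hf₀.coeff_eq_zero hm, mul_zero, mul_zero]
    rw [h2, hK f₀ hf₀, ← pow_mul, Finset.prod_pow_eq_pow_sum] at h1
    exact (hinj _ _ (mul_right_cancel₀ hf₀' h1)).symm
  have heE : ∀ i, e i = E := by
    intro i
    have h1 : ∑ j, e j = n * e i := by
      rw [Finset.sum_congr rfl fun j _ => heq j i]
      simp
    rw [h1, ← hKE] at hsum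
    exact Nat.eq_of_mul_eq_mul_left i.pos hsum
  have main : ∀ f : MvPolynomial (Fin n) ℂ, f.IsHomogeneous d →
      evalForm D (subst A f) = A.det ^ E * evalForm D f := by
    refine Matrix.diagonal_transvection_induction_of_det_ne_zero
      (fun A => ∀ f : MvPolynomial (Fin n) ℂ, f.IsHomogeneous d →
        evalForm D (subst A f) = A.det ^ E * evalForm D f) A hA ?_ ?_ ?_
    · intro u _ f hf
      rw [hdiag' u f hf, Matrix.det_diagonal, ← Finset.prod_pow]
      simp only [heE]
    · intro t f hf
      rw [Matrix.TransvectionStruct.toMatrix, htr hf t.hij, det_transvection_eq_one t.hij, one_pow,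
        one_mul]
    · intro A B _ _ ihA ihB f hf
      rw [← subst_subst, ihB _ (isHomogeneous_subst _ hf), ihA _ hf, Matrix.det_mul, mul_pow]
      ring
  exact main f hf

end SemiInvariance

/-! ### Irreducibility of the discriminant hypersurface -/

section Irreducible

variable {n d : ℕ}

/-- Any two nonzero vectors are exchanged by an invertible matrix. -/
theorem exists_matrix_mulVec_eq {z w : Fin n → ℂ} (hz : z ≠ 0) (hw : w ≠ 0) :
    ∃ A : Matrix (Fin n) (Fin n) ℂ, A.det ≠ 0 ∧ A.mulVec z = w := by
  obtain ⟨L, hL⟩ := SeparatingDual.exists_continuousLinearEquiv_apply_eq (R := ℂ) hz hw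
  refine ⟨LinearMap.toMatrix' (L.toLinearEquiv : (Fin n → ℂ) →ₗ[ℂ] (Fin n → ℂ)), ?_, ?_⟩
  · rw [LinearMap.det_toMatrix']
    exact (LinearEquiv.isUnit_det' L.toLinearEquiv).ne_zero
  · rw [← Matrix.toLin'_apply, Matrix.toLin'_toMatrix']
    exact hL

/-- The coefficient vectors of the singular forms. -/
def singularLocus (n d : ℕ) : Set (Exps n d → ℂ) := {c | IsSingularForm (form c)}

theorem mem_vanishingIdeal_singularLocus {P : MvPolynomial (Exps n d) ℂ} :
    P ∈ vanishingIdeal ℂ (singularLocus n d) ↔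
      ∀ f : MvPolynomial (Fin n) ℂ, f.IsHomogeneous d → IsSingularForm f → evalForm P f = 0 := by
  rw [mem_vanishingIdeal_iff]
  constructor
  · intro h f hf hs
    have := h (coords d f) (by
      change IsSingularForm (form (coords d f))
      rwa [form_coords hf])
    rwa [aeval_eq_eval] at this
  · intro h c hc
    have := h (form c) (isHomogeneous_form c) hc
    rwa [evalForm, coords_form] at this

theorem subst_smul_one {R : Type*} [CommRing R] (c : R) {f : MvPolynomial (Fin n) R}
    (hf : f.IsHomogeneous d) : subst (c • (1 : Matrix (Fin n) (Fin n) R)) f = c ^ d • f := by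
  ext m
  rw [← Matrix.diagonal_one, ← Matrix.diagonal_smul, coeff_subst_diagonal, coeff_smul,
    smul_eq_mul]
  by_cases hm : m.degree = d
  · rw [← hm, Finsupp.degree_eq_sum, ← Finset.prod_pow_eq_pow_sum]
    simp
  · rw [hf.coeff_eq_zero hm, mul_zero, mul_zero]

/-- Two singular forms `f₀` and `f₁` lie on a rational curve of singular forms. If `f₀` is singular
at `z₀` and `f₁` at `A z₀`, then `(1 - t) f₀ + t det(A)⁻ᵈ f₁(A z)` is singular at `z₀`; the
substitution of the adjugate of `1 + t (A - 1)` deforms it so that `f₁` is reached at `t = 1`. -/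
theorem exists_family_of_isSingularForm (hd : 2 ≤ d) {f₀ f₁ : MvPolynomial (Fin n) ℂ}
    (hf₀ : f₀.IsHomogeneous d) (hf₁ : f₁.IsHomogeneous d) (hs₀ : IsSingularForm f₀)
    (hs₁ : IsSingularForm f₁) :
    ∃ G : MvPolynomial (Fin n) (Polynomial ℂ),
      map (Polynomial.evalRingHom 0) G = f₀ ∧ map (Polynomial.evalRingHom 1) G = f₁ ∧
        ∀ t, (map (Polynomial.evalRingHom t) G).IsHomogeneous d ∧
          IsSingularForm (map (Polynomial.evalRingHom t) G) := by
  obtain ⟨z₀, hz₀, h₀⟩ := hs₀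
  obtain ⟨z₁, hz₁, h₁⟩ := hs₁
  obtain ⟨A, hA, hAz⟩ := exists_matrix_mulVec_eq hz₀ hz₁
  let g : MvPolynomial (Fin n) ℂ := C ((A.det ^ d)⁻¹) * subst A f₁
  let M : Matrix (Fin n) (Fin n) (Polynomial ℂ) :=
    1 + (Polynomial.X : Polynomial ℂ) • (A - 1).map Polynomial.C
  let G : MvPolynomial (Fin n) (Polynomial ℂ) := subst M.adjugate
    (C (1 - Polynomial.X) * map Polynomial.C f₀ + C Polynomial.X * map Polynomial.C g)
  have hM : ∀ t : ℂ, M.map (Polynomial.evalRingHom t) = 1 + t • (A - 1) := by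
    intro t
    ext i j
    by_cases hij : i = j
    · subst hij
      simp [M]
    · simpa [M, hij] using mul_comm (A i j) t
  have hG : ∀ t, map (Polynomial.evalRingHom t) G =
      subst (1 + t • (A - 1)).adjugate (C (1 - t) * f₀ + C t * g) := by
    intro t
    have hadj : M.adjugate.map (Polynomial.evalRingHom t) = (1 + t • (A - 1)).adjugate := by
      rw [← hM, ← RingHom.mapMatrix_apply, ← RingHom.mapMatrix_apply, RingHom.map_adjugate]
    rw [map_subst, hadj]
    simp only [map_add, map_mul, map_C, map_evalRingHom_comp_C]
    simp
  have hg : g.IsHomogeneous d := by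
    simpa using (isHomogeneous_C (Fin n) ((A.det ^ d)⁻¹)).mul (isHomogeneous_subst A hf₁)
  have hsum : ∀ t : ℂ, (C (1 - t) * f₀ + C t * g).IsHomogeneous d := by
    intro t
    refine IsHomogeneous.add ?_ ?_
    · simpa using (isHomogeneous_C (Fin n) (1 - t)).mul hf₀
    · simpa using (isHomogeneous_C (Fin n) t).mul hg
  refine ⟨G, ?_, ?_, fun t => ⟨?_, ?_⟩⟩
  · rw [hG]
    simp [subst_one]
  · rw [hG]
    simp only [sub_self, map_zero, zero_mul, zero_add, map_one, one_mul, one_smul,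
      add_sub_cancel, g, map_mul, subst_C]
    rw [subst_subst, Matrix.mul_adjugate, subst_smul_one _ hf₁, smul_eq_C_mul, ← mul_assoc, ← C_mul,
      inv_mul_cancel₀ (pow_ne_zero _ hA), map_one, one_mul]
  · rw [hG]
    exact isHomogeneous_subst _ (hsum t)
  · rw [hG]
    refine IsSingularForm.subst hd (hsum t) ⟨z₀, hz₀, fun i => ?_⟩ _
    simp only [map_add, pderiv_C_mul, map_mul, eval_C, h₀, mul_zero, zero_add, g, pderiv_subst,
      map_sum, eval_subst, hAz, h₁, Finset.sum_const_zero]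

theorem evalFamily_mul (P Q : MvPolynomial (Exps n d) ℂ)
    (G : MvPolynomial (Fin n) (Polynomial ℂ)) :
    evalFamily (P * Q) G = evalFamily P G * evalFamily Q G :=
  map_mul _ _ _

/-- The set of the singular forms is irreducible, because any two of its points lie on a rational
curve contained in it. -/
theorem isPrime_vanishingIdeal_singularLocus (hn : 0 < n) (hd : 2 ≤ d) :
    (vanishingIdeal ℂ (singularLocus n d)).IsPrime := by
  refine ⟨?_, ?_⟩
  · rw [Ne, Ideal.eq_top_iff_one, mem_vanishingIdeal_singularLocus]
    intro h
    have := h 0 (isHomogeneous_zero _ _ _) ⟨fun _ => 1, ?_, fun i => by simp⟩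
    · simp [evalForm] at this
    · intro h1
      have := congrFun h1 ⟨0, hn⟩
      simp at this
  · intro P Q hPQ
    by_contra! hcon
    obtain ⟨hP, hQ⟩ := hcon
    rw [mem_vanishingIdeal_singularLocus] at hP hQ hPQ
    push Not at hP hQ
    obtain ⟨f₀, hf₀, hs₀, hP⟩ := hP
    obtain ⟨f₁, hf₁, hs₁, hQ⟩ := hQ
    obtain ⟨G, hG₀, hG₁, hG⟩ := exists_family_of_isSingularForm hd hf₀ hf₁ hs₀ hs₁
    have h0 : evalFamily (P * Q) G = 0 := by
      refine Polynomial.funext fun t => ?_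
      rw [eval_evalFamily, hPQ _ (hG t).1 (hG t).2, Polynomial.eval_zero]
    rw [evalFamily_mul, mul_eq_zero] at h0
    rcases h0 with h0 | h0
    · refine hP ?_
      rw [← hG₀, ← eval_evalFamily, h0, Polynomial.eval_zero]
    · refine hQ ?_
      rw [← hG₁, ← eval_evalFamily, h0, Polynomial.eval_zero]

/-- By the Nullstellensatz, if the zeros of `D` are the singular forms, then `D` divides a power of
each polynomial that vanishes at the singular forms. -/
theorem exists_dvd_pow_of_mem_vanishingIdeal {D P : MvPolynomial (Exps n d) ℂ}
    (h0 : ∀ f : MvPolynomial (Fin n) ℂ, f.IsHomogeneous d → (evalForm D f = 0 ↔ IsSingularForm f))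
    (hP : P ∈ vanishingIdeal ℂ (singularLocus n d)) : ∃ N, D ∣ P ^ N := by
  have h1 : zeroLocus ℂ (Ideal.span {D}) = singularLocus n d := by
    rw [zeroLocus_span]
    ext c
    simp only [Set.mem_singleton_iff, forall_eq, Set.mem_ofPred_eq, singularLocus]
    rw [← h0 _ (isHomogeneous_form c), evalForm, coords_form, aeval_eq_eval]
  rw [← h1, vanishingIdeal_zeroLocus_eq_radical] at hP
  obtain ⟨N, hN⟩ := hP
  exact ⟨N, Ideal.mem_span_singleton.1 hN⟩

/-- A polynomial whose zeros are the singular forms is a power of an irreducible polynomial, up to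
a constant: the prime ideal of the singular locus contains a prime element `P`, and `D` divides a
power of `P`. -/
theorem exists_prime_associated_pow (hn : 0 < n) (hd : 2 ≤ d) {D : MvPolynomial (Exps n d) ℂ}
    (h0 : ∀ f : MvPolynomial (Fin n) ℂ, f.IsHomogeneous d → (evalForm D f = 0 ↔ IsSingularForm f))
    (hD : D ≠ 0) : ∃ (P : MvPolynomial (Exps n d) ℂ) (k : ℕ), Prime P ∧ Associated D (P ^ k) := by
  have hDJ : D ∈ vanishingIdeal ℂ (singularLocus n d) :=
    mem_vanishingIdeal_singularLocus.2 fun f hf hs => (h0 f hf).2 hs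
  obtain ⟨P, hPJ, hP⟩ := (isPrime_vanishingIdeal_singularLocus hn hd).exists_mem_prime_of_ne_bot
    (fun h => hD (by rwa [h, Ideal.mem_bot] at hDJ))
  obtain ⟨N, hN⟩ := exists_dvd_pow_of_mem_vanishingIdeal h0 hPJ
  obtain ⟨k, -, hk⟩ := (dvd_prime_pow hP N).1 hN
  exact ⟨P, k, hP, hk⟩

/-- Discriminants are unique up to a constant factor. -/
theorem IsDiscriminant.exists_eq_C_mul {D D' : MvPolynomial (Exps n d) ℂ}
    (h : IsDiscriminant n d D) (h' : IsDiscriminant n d D') : ∃ c : ℂ, c ≠ 0 ∧ D' = C c * D := by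
  obtain ⟨N, hN⟩ := exists_dvd_pow_of_mem_vanishingIdeal h.2
    (mem_vanishingIdeal_singularLocus.2 fun f hf hs => (h'.2 f hf).2 hs)
  have hdvd : D ∣ D' := h.1.prime.dvd_of_dvd_pow hN
  obtain ⟨u, hu⟩ := h.1.associated_of_dvd h'.1 hdvd
  obtain ⟨c, hc, hcu⟩ := isUnit_iff_eq_C_of_isReduced.1 u.isUnit
  refine ⟨c, hc.ne_zero, ?_⟩
  rw [← hu, hcu, mul_comm]

/-- On a one-parameter family obtained from a nonsingular form by diagonal substitutions, `D` is a
power of the parameter, whose exponent is divisible by the multiplicity `k`. -/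
theorem multiplicity_mul_eq {D P : MvPolynomial (Exps n d) ℂ} {k E a b : ℕ}
    (hDP : Associated D (P ^ k))
    (hE : ∀ f : MvPolynomial (Fin n) ℂ, f.IsHomogeneous d → ∀ A : Matrix (Fin n) (Fin n) ℂ,
      A.det ≠ 0 → evalForm D (subst A f) = A.det ^ E * evalForm D f)
    {f : MvPolynomial (Fin n) ℂ} (hf : f.IsHomogeneous d) (hDf : evalForm D f ≠ 0)
    (G : MvPolynomial (Fin n) (Polynomial ℂ)) (u : ℂ → Fin n → ℂ)
    (hu : ∀ s, s ≠ 0 → ∏ i, u s i = s ^ b)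
    (hG : ∀ s, s ≠ 0 → map (Polynomial.evalRingHom (s ^ a)) G =
      subst (Matrix.diagonal (u s)) f) :
    ∃ x, k * x * a = b * E := by
  obtain ⟨v, hv⟩ := hDP.symm
  obtain ⟨c, hc, hcv⟩ := isUnit_iff_eq_C_of_isReduced.1 v.isUnit
  have h1 : (evalFamily D G).comp (Polynomial.X ^ a) =
      Polynomial.C (evalForm D f) * Polynomial.X ^ (b * E) := by
    refine Polynomial.eq_of_infinite_eval_eq _ _
      (Set.Infinite.mono ?_ (Set.finite_singleton (0 : ℂ)).infinite_compl)
    intro s hs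
    have hs : s ≠ 0 := hs
    simp only [Set.mem_ofPred_eq, Polynomial.eval_comp, Polynomial.eval_pow, Polynomial.eval_X,
      Polynomial.eval_mul, Polynomial.eval_C]
    have hdet : (Matrix.diagonal (u s)).det = s ^ b := by rw [Matrix.det_diagonal, hu s hs]
    rw [eval_evalFamily, hG s hs, hE f hf, hdet, ← pow_mul, mul_comm]
    rw [hdet]
    exact pow_ne_zero _ hs
  have h2 : evalFamily D G = Polynomial.C c * evalFamily P G ^ k := by
    rw [← hv, hcv, evalFamily_mul, mul_comm]
    congr 1
    · exact aeval_C _ _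
    · exact map_pow _ _ _
  refine ⟨(evalFamily P G).natDegree, ?_⟩
  have h3 := congrArg Polynomial.natDegree h1
  rwa [Polynomial.natDegree_comp, Polynomial.natDegree_X_pow, h2,
    Polynomial.natDegree_C_mul hc.ne_zero, Polynomial.natDegree_pow,
    Polynomial.natDegree_C_mul hDf, Polynomial.natDegree_X_pow] at h3

end Irreducible

/-! ### Nonsingular forms -/

section Examples

variable {m : ℕ}

theorem isHomogeneous_X_mul_X_pow {n : ℕ} (i j : Fin n) (m : ℕ) :
    (X i * X j ^ m : MvPolynomial (Fin n) ℂ).IsHomogeneous (m + 1) := by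
  have := (isHomogeneous_X ℂ i).mul ((isHomogeneous_X ℂ j).pow m)
  rwa [one_mul, add_comm] at this

theorem not_isSingularForm_fermat_two :
    ¬ IsSingularForm (X 0 ^ (m + 1) + X 1 ^ (m + 1) : MvPolynomial (Fin 2) ℂ) := by
  rintro ⟨z, hz, h⟩
  have hm1 : ((m : ℂ) + 1) ≠ 0 := by exact_mod_cast Nat.succ_ne_zero m
  have h0 := h 0
  have h1 := h 1
  simp [pderiv_X, hm1] at h0 h1
  refine hz (funext fun i => ?_)
  fin_cases i
  · exact h0.1
  · exact h1.1

theorem not_isSingularForm_fermat_three :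
    ¬ IsSingularForm
      (X 0 ^ (m + 1) + X 1 ^ (m + 1) + X 2 ^ (m + 1) : MvPolynomial (Fin 3) ℂ) := by
  rintro ⟨z, hz, h⟩
  have hm1 : ((m : ℂ) + 1) ≠ 0 := by exact_mod_cast Nat.succ_ne_zero m
  have h0 := h 0
  have h1 := h 1
  have h2 := h 2
  simp [pderiv_X, hm1] at h0 h1 h2
  refine hz (funext fun i => ?_)
  fin_cases i
  · exact h0.1
  · exact h1.1
  · exact h2.1

theorem not_isSingularForm_chain_two (hm : 2 ≤ m) :
    ¬ IsSingularForm (X 0 ^ (m + 1) + X 0 * X 1 ^ m : MvPolynomial (Fin 2) ℂ) := by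
  rintro ⟨z, hz, h⟩
  have hm1 : ((m : ℂ) + 1) ≠ 0 := by exact_mod_cast Nat.succ_ne_zero m
  have hm0 : m ≠ 0 := by omega
  have h0 : ((m : ℂ) + 1) * z 0 ^ m + z 1 ^ m = 0 := by
    simpa [pderiv_X] using h 0
  have h1 : z 0 = 0 ∨ z 1 = 0 := by
    have := h 1
    simp only [map_add, pderiv_mul, pderiv_pow, pderiv_X_self,
      pderiv_X_of_ne (show (0 : Fin 2) ≠ 1 by decide), map_mul, map_pow, map_natCast, eval_X,
      mul_zero, zero_mul, zero_add, mul_one, mul_eq_zero, Nat.cast_eq_zero] at this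
    rcases this with h | h | h
    · exact Or.inl h
    · exact absurd h hm0
    · exact Or.inr (eq_zero_of_pow_eq_zero h)
  have h2 : z 0 = 0 ∧ z 1 = 0 := by
    rcases h1 with h1 | h1
    · rw [h1, zero_pow hm0, mul_zero, zero_add] at h0
      exact ⟨h1, eq_zero_of_pow_eq_zero h0⟩
    · rw [h1, zero_pow hm0, add_zero] at h0
      exact ⟨eq_zero_of_pow_eq_zero ((mul_eq_zero.1 h0).resolve_left hm1), h1⟩
  refine hz (funext fun i => ?_)
  fin_cases i
  · exact h2.1
  · exact h2.2

theorem not_isSingularForm_chain_three (hm : 2 ≤ m) :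
    ¬ IsSingularForm
      (X 0 ^ (m + 1) + X 0 * X 1 ^ m + X 1 * X 2 ^ m : MvPolynomial (Fin 3) ℂ) := by
  rintro ⟨z, hz, h⟩
  have hm1 : ((m : ℂ) + 1) ≠ 0 := by exact_mod_cast Nat.succ_ne_zero m
  have hm0 : m ≠ 0 := by omega
  have hm2 : m - 1 ≠ 0 := by omega
  have h0 : ((m : ℂ) + 1) * z 0 ^ m + z 1 ^ m = 0 := by
    simpa [pderiv_X] using h 0
  have h1 : z 0 * (m * z 1 ^ (m - 1)) + z 2 ^ m = 0 := by
    have := h 1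
    simpa only [map_add, pderiv_mul, pderiv_pow, pderiv_X_self,
      pderiv_X_of_ne (show (0 : Fin 3) ≠ 1 by decide),
      pderiv_X_of_ne (show (2 : Fin 3) ≠ 1 by decide), map_mul, map_pow, map_natCast, eval_X,
      mul_zero, zero_mul, zero_add, mul_one, one_mul, add_zero] using this
  have h2 : z 1 = 0 ∨ z 2 = 0 := by
    have := h 2
    simp only [map_add, pderiv_mul, pderiv_pow, pderiv_X_self,
      pderiv_X_of_ne (show (0 : Fin 3) ≠ 2 by decide),
      pderiv_X_of_ne (show (1 : Fin 3) ≠ 2 by decide), map_mul, map_pow, map_natCast, eval_X,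
      mul_zero, zero_mul, zero_add, add_zero, mul_one, mul_eq_zero,
      Nat.cast_eq_zero] at this
    rcases this with h | h | h
    · exact Or.inl h
    · exact absurd h hm0
    · exact Or.inr (eq_zero_of_pow_eq_zero h)
  have h3 : z 0 = 0 ∧ z 1 = 0 ∧ z 2 = 0 := by
    have h4 : z 1 = 0 → z 0 = 0 := by
      intro h1
      rw [h1, zero_pow hm0, add_zero] at h0
      exact eq_zero_of_pow_eq_zero ((mul_eq_zero.1 h0).resolve_left hm1)
    rcases h2 with h2 | h2
    · rw [h2, zero_pow hm2, mul_zero, mul_zero, zero_add] at h1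
      exact ⟨h4 h2, h2, eq_zero_of_pow_eq_zero h1⟩
    · rw [h2, zero_pow hm0, add_zero, mul_eq_zero, mul_eq_zero, Nat.cast_eq_zero] at h1
      rcases h1 with h1 | h1 | h1
      · rw [h1, zero_pow hm0, mul_zero, zero_add] at h0
        exact ⟨h1, eq_zero_of_pow_eq_zero h0, h2⟩
      · exact absurd h1 hm0
      · have h5 := eq_zero_of_pow_eq_zero h1
        exact ⟨h4 h5, h5, h2⟩
  refine hz (funext fun i => ?_)
  fin_cases i
  · exact h3.1
  · exact h3.2.1
  · exact h3.2.2

end Examples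

/-! ### The determinant of Sylvester type is a discriminant -/

section Discriminant

variable {n d : ℕ}

theorem exists_not_isSingularForm (hn : n = 2 ∨ n = 3) (hd : 3 ≤ d) :
    ∃ f : MvPolynomial (Fin n) ℂ, f.IsHomogeneous d ∧ ¬ IsSingularForm f := by
  obtain ⟨m, rfl⟩ : ∃ m, d = m + 1 := ⟨d - 1, by omega⟩
  rcases hn with rfl | rfl
  · exact ⟨_, (isHomogeneous_X_pow 0 _).add (isHomogeneous_X_pow 1 _),
      not_isSingularForm_fermat_two⟩
  · exact ⟨_, ((isHomogeneous_X_pow 0 _).add (isHomogeneous_X_pow 1 _)).add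
      (isHomogeneous_X_pow 2 _), not_isSingularForm_fermat_three⟩

/-- In two variables the multiplicity divides the coprime exponents `m` and `m - 1` obtained from
`t x ^ (m + 1) + y ^ (m + 1)` and `t x ^ (m + 1) + x y ^ m`. -/
theorem multiplicity_eq_one_two {m k : ℕ} (hm : 2 ≤ m)
    {D P : MvPolynomial (Exps 2 (m + 1)) ℂ} (hDP : Associated D (P ^ k))
    (h0 : ∀ f : MvPolynomial (Fin 2) ℂ, f.IsHomogeneous (m + 1) →
      (evalForm D f = 0 ↔ IsSingularForm f))
    (hE : ∀ f : MvPolynomial (Fin 2) ℂ, f.IsHomogeneous (m + 1) →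
      ∀ A : Matrix (Fin 2) (Fin 2) ℂ, A.det ≠ 0 →
        evalForm D (subst A f) = A.det ^ ((m + 1) * m) * evalForm D f) :
    k = 1 := by
  have hf₁ : (X 0 ^ (m + 1) + X 1 ^ (m + 1) : MvPolynomial (Fin 2) ℂ).IsHomogeneous (m + 1) :=
    (isHomogeneous_X_pow 0 _).add (isHomogeneous_X_pow 1 _)
  have hf₂ : (X 0 ^ (m + 1) + X 0 * X 1 ^ m : MvPolynomial (Fin 2) ℂ).IsHomogeneous (m + 1) :=
    (isHomogeneous_X_pow 0 _).add (isHomogeneous_X_mul_X_pow 0 1 m)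
  obtain ⟨x, hx⟩ := multiplicity_mul_eq (a := m + 1) (b := 1) hDP hE hf₁
    (fun h => not_isSingularForm_fermat_two ((h0 _ hf₁).1 h))
    (C Polynomial.X * X 0 ^ (m + 1) + X 1 ^ (m + 1)) (fun s => ![s, 1])
    (by intro s _; simp)
    (by
      intro s _
      simp [subst_diagonal_X, mul_pow])
  obtain ⟨y, hy⟩ := multiplicity_mul_eq (a := m * (m + 1)) (b := m - 1) hDP hE hf₂
    (fun h => not_isSingularForm_chain_two hm ((h0 _ hf₂).1 h))
    (C Polynomial.X * X 0 ^ (m + 1) + X 0 * X 1 ^ m) (fun s => ![s ^ m, s⁻¹])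
    (by
      intro s hs
      obtain ⟨j, rfl⟩ : ∃ j, m = j + 1 := ⟨m - 1, by omega⟩
      simp only [Fin.prod_univ_two, Matrix.cons_val_zero, Matrix.cons_val_one,
        Nat.add_sub_cancel, pow_succ]
      rw [mul_assoc, mul_inv_cancel₀ hs, mul_one])
    (by
      intro s hs
      have h1 : (C (s ^ m) * C s⁻¹ ^ m : MvPolynomial (Fin 2) ℂ) = 1 := by
        rw [← C_pow, ← C_mul, ← mul_pow, mul_inv_cancel₀ hs, one_pow, C_1]
      simp only [map_add, map_mul, map_pow, map_C, map_X, subst_diagonal_X,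
        Matrix.cons_val_zero, Matrix.cons_val_one, mul_pow, Polynomial.coe_evalRingHom,
        Polynomial.eval_X] at h1 ⊢
      rw [show C s ^ m * X 0 * (C s⁻¹ ^ m * X 1 ^ m) =
        C s ^ m * C s⁻¹ ^ m * (X 0 * X 1 ^ m : MvPolynomial (Fin 2) ℂ) by ring, h1]
      ring)
  have hm1 : 0 < m + 1 := by omega
  have h1 : k ∣ m := by
    refine ⟨x, Nat.eq_of_mul_eq_mul_right hm1 ?_⟩
    rw [hx]
    ring
  have h2 : k ∣ m - 1 := by
    refine ⟨y, Nat.eq_of_mul_eq_mul_right (Nat.mul_pos (by omega : 0 < m) hm1) ?_⟩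
    rw [hy]
    ring
  have h3 : k ∣ m - (m - 1) := Nat.dvd_sub h1 h2
  rw [show m - (m - 1) = 1 by omega] at h3
  exact Nat.dvd_one.1 h3

/-- In three variables the multiplicity divides the coprime exponents `m ^ 2` and `m ^ 2 - m + 1`
obtained from `t x ^ (m + 1) + y ^ (m + 1) + z ^ (m + 1)` and
`t x ^ (m + 1) + x y ^ m + y z ^ m`. -/
theorem multiplicity_eq_one_three {m k : ℕ} (hm : 2 ≤ m)
    {D P : MvPolynomial (Exps 3 (m + 1)) ℂ} (hDP : Associated D (P ^ k))
    (h0 : ∀ f : MvPolynomial (Fin 3) ℂ, f.IsHomogeneous (m + 1) →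
      (evalForm D f = 0 ↔ IsSingularForm f))
    (hE : ∀ f : MvPolynomial (Fin 3) ℂ, f.IsHomogeneous (m + 1) →
      ∀ A : Matrix (Fin 3) (Fin 3) ℂ, A.det ≠ 0 →
        evalForm D (subst A f) = A.det ^ ((m + 1) * m ^ 2) * evalForm D f) :
    k = 1 := by
  have hf₁ : (X 0 ^ (m + 1) + X 1 ^ (m + 1) + X 2 ^ (m + 1) :
      MvPolynomial (Fin 3) ℂ).IsHomogeneous (m + 1) :=
    ((isHomogeneous_X_pow 0 _).add (isHomogeneous_X_pow 1 _)).add (isHomogeneous_X_pow 2 _)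
  have hf₂ : (X 0 ^ (m + 1) + X 0 * X 1 ^ m + X 1 * X 2 ^ m :
      MvPolynomial (Fin 3) ℂ).IsHomogeneous (m + 1) :=
    ((isHomogeneous_X_pow 0 _).add (isHomogeneous_X_mul_X_pow 0 1 m)).add
      (isHomogeneous_X_mul_X_pow 1 2 m)
  obtain ⟨x, hx⟩ := multiplicity_mul_eq (a := m + 1) (b := 1) hDP hE hf₁
    (fun h => not_isSingularForm_fermat_three ((h0 _ hf₁).1 h))
    (C Polynomial.X * X 0 ^ (m + 1) + X 1 ^ (m + 1) + X 2 ^ (m + 1)) (fun s => ![s, 1, 1])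
    (by intro s _; simp [Fin.prod_univ_three])
    (by
      intro s _
      simp [subst_diagonal_X, mul_pow])
  obtain ⟨y, hy⟩ := multiplicity_mul_eq (a := m ^ 2 * (m + 1)) (b := m * (m - 1) + 1) hDP hE hf₂
    (fun h => not_isSingularForm_chain_three hm ((h0 _ hf₂).1 h))
    (C Polynomial.X * X 0 ^ (m + 1) + X 0 * X 1 ^ m + X 1 * X 2 ^ m)
    (fun s => ![s ^ m ^ 2, s⁻¹ ^ m, s])
    (by
      intro s hs
      obtain ⟨j, rfl⟩ : ∃ j, m = j + 1 := ⟨m - 1, by omega⟩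
      simp only [Fin.prod_univ_three, Matrix.cons_val_zero, Matrix.cons_val_one,
        Matrix.cons_val_two, Matrix.tail_cons, Matrix.head_cons, Nat.add_sub_cancel]
      rw [show (j + 1) ^ 2 = (j + 1) * j + (j + 1) by ring, pow_add, mul_assoc (s ^ _),
        ← mul_pow, mul_inv_cancel₀ hs, one_pow, mul_one, pow_succ])
    (by
      intro s hs
      have h1 : (C s * C s⁻¹ : MvPolynomial (Fin 3) ℂ) = 1 := by
        rw [← C_mul, mul_inv_cancel₀ hs, C_1]
      have h2 : (C s ^ m ^ 2 * (C s⁻¹ ^ m) ^ m : MvPolynomial (Fin 3) ℂ) = 1 := by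
        rw [← pow_mul, ← sq, ← mul_pow, h1, one_pow]
      have h3 : (C s⁻¹ ^ m * C s ^ m : MvPolynomial (Fin 3) ℂ) = 1 := by
        rw [← mul_pow, mul_comm, h1, one_pow]
      simp only [map_add, map_mul, map_pow, map_C, map_X, subst_diagonal_X,
        Matrix.cons_val_zero, Matrix.cons_val_one, Matrix.cons_val_two, Matrix.tail_cons,
        Matrix.head_cons, mul_pow, Polynomial.coe_evalRingHom, Polynomial.eval_X]
      rw [show C s ^ m ^ 2 * X 0 * ((C s⁻¹ ^ m) ^ m * X 1 ^ m) =
        C s ^ m ^ 2 * (C s⁻¹ ^ m) ^ m * (X 0 * X 1 ^ m : MvPolynomial (Fin 3) ℂ) by ring, h2,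
        show C s⁻¹ ^ m * X 1 * (C s ^ m * X 2 ^ m) =
        C s⁻¹ ^ m * C s ^ m * (X 1 * X 2 ^ m : MvPolynomial (Fin 3) ℂ) by ring, h3]
      ring)
  have hm1 : 0 < m + 1 := by omega
  have h1 : k ∣ m ^ 2 := by
    refine ⟨x, Nat.eq_of_mul_eq_mul_right hm1 ?_⟩
    rw [hx]
    ring
  have h2 : k ∣ m * (m - 1) + 1 := by
    refine ⟨y, Nat.eq_of_mul_eq_mul_right (Nat.mul_pos (by positivity : 0 < m ^ 2) hm1) ?_⟩
    rw [hy]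
    ring
  have hcop : Nat.Coprime (m ^ 2) (m * (m - 1) + 1) := by
    refine Nat.Coprime.pow_left 2 ?_
    rw [Nat.coprime_mul_left_add_right]
    exact Nat.coprime_one_right m
  exact Nat.eq_one_of_dvd_coprimes hcop h1 h2

theorem evalForm_discDet_subst (hn : n = 2 ∨ n = 3) (hd : 3 ≤ d)
    (e : Exps n ((n - 1) * (d - 2)) ≃ SylvesterCols n d) {f : MvPolynomial (Fin n) ℂ}
    (hf : f.IsHomogeneous d) {A : Matrix (Fin n) (Fin n) ℂ} (hA : A.det ≠ 0) :
    evalForm (discDet e) (subst A f) =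
      A.det ^ (d * (d - 1) ^ (n - 1)) * evalForm (discDet e) f := by
  refine evalForm_subst_eq_det_pow_mul (by omega) (K := n * (d - 1) ^ (n - 1)) (by ring)
    (fun f hf => evalForm_discDet_eq_zero_iff e (by omega) (by omega) hf) (fun f hf c => ?_)
    (exists_not_isSingularForm hn hd) hf hA
  rw [evalForm_discDet_smul e hf, degree_discDet hn hd]

/-- The determinant of Sylvester type is a discriminant. -/
theorem isDiscriminant_discDet (hn : n = 2 ∨ n = 3) (hd : 3 ≤ d)
    (e : Exps n ((n - 1) * (d - 2)) ≃ SylvesterCols n d) : IsDiscriminant n d (discDet e) := by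
  have hn0 : 0 < n := by omega
  have h0 : ∀ f : MvPolynomial (Fin n) ℂ, f.IsHomogeneous d →
      (evalForm (discDet e) f = 0 ↔ IsSingularForm f) := fun f hf =>
    evalForm_discDet_eq_zero_iff e hn0 (by omega) hf
  obtain ⟨f₀, hf₀, hs₀⟩ := exists_not_isSingularForm hn hd
  have hD : discDet e ≠ 0 := by
    intro h
    refine hs₀ ((h0 f₀ hf₀).1 ?_)
    rw [h, evalForm, map_zero]
  have hE : ∀ f : MvPolynomial (Fin n) ℂ, f.IsHomogeneous d → ∀ A : Matrix (Fin n) (Fin n) ℂ,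
      A.det ≠ 0 → evalForm (discDet e) (subst A f) =
        A.det ^ (d * (d - 1) ^ (n - 1)) * evalForm (discDet e) f :=
    fun f hf A hA => evalForm_discDet_subst hn hd e hf hA
  obtain ⟨P, k, hP, hDP⟩ := exists_prime_associated_pow hn0 (by omega) h0 hD
  have hk : k = 1 := by
    obtain ⟨m, rfl⟩ : ∃ m, d = m + 1 := ⟨d - 1, by omega⟩
    rcases hn with rfl | rfl
    · refine multiplicity_eq_one_two (by omega) hDP h0 fun f hf A hA => ?_
      simpa using hE f hf A hA
    · exact multiplicity_eq_one_three (by omega) hDP h0 fun f hf A hA => hE f hf A hA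
  rw [hk, pow_one] at hDP
  exact ⟨hDP.symm.irreducible hP.irreducible, h0⟩

end Discriminant

/-! ### Equivariance of the associated form -/

section Equivariance

variable {n d : ℕ} {f : MvPolynomial (Fin n) ℂ}

theorem hessian_notMem_jacobianIdeal (hd : 2 ≤ d) (hf : f.IsHomogeneous d)
    (hs : ¬ IsSingularForm f) : hessian f ∉ jacobianIdeal f := by
  obtain ⟨m, rfl⟩ : ∃ m, d = m + 1 := ⟨d - 1, by omega⟩
  obtain ⟨ω, hI, hH, -⟩ := exists_residue (by omega) hf hs
  intro h
  have hm0 : (m : ℂ) ^ n ≠ 0 := pow_ne_zero _ (Nat.cast_ne_zero.2 (by omega))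
  exact hm0 (hH ▸ hI _ h)

theorem sub_omega_mul_hessian_mem (hd : 2 ≤ d) (hf : f.IsHomogeneous d)
    (hs : ¬ IsSingularForm f) {g : MvPolynomial (Fin n) ℂ} (hg : g.IsHomogeneous (n * (d - 2))) :
    g - C (omega f (toMilnor f g)) * hessian f ∈ jacobianIdeal f := by
  obtain ⟨m, rfl⟩ : ∃ m, d = m + 1 := ⟨d - 1, by omega⟩
  obtain ⟨ω, hI, hH, hω⟩ := exists_residue (by omega) hf hs
  have hg' : g.IsHomogeneous (n * (m - 1)) := hg
  rw [omega_toMilnor_eq (by omega) hf hI hH hω hg']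
  exact sub_smul_hessian_mem_jacobianIdeal (by omega) hf hH hω hg'

theorem omega_eq_of_sub_mem (hd : 2 ≤ d) (hf : f.IsHomogeneous d) (hs : ¬ IsSingularForm f)
    {g : MvPolynomial (Fin n) ℂ} {c : ℂ} (h : g - C c * hessian f ∈ jacobianIdeal f) :
    omega f (toMilnor f g) = c :=
  omega_eq_of_eq_smul (hessian_notMem_jacobianIdeal hd hf hs) (toMilnor_eq_smul_iff.2 h)

theorem omega_toMilnor_eq_sum (hd : 2 ≤ d) (hf : f.IsHomogeneous d) (hs : ¬ IsSingularForm f)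
    {g : MvPolynomial (Fin n) ℂ} (hg : g.IsHomogeneous (n * (d - 2))) :
    omega f (toMilnor f g) = ∑ i : Exps n (n * (d - 2)), coeff i.1 g * mu i f := by
  refine omega_eq_of_sub_mem hd hf hs ?_
  have h1 : g = ∑ i : Exps n (n * (d - 2)), C (coeff i.1 g) * monomial i.1 1 := by
    conv_lhs => rw [← form_coords hg]
    refine Finset.sum_congr rfl fun i _ => ?_
    rw [C_mul_monomial, mul_one, coords]
  have h2 : g - C (∑ i : Exps n (n * (d - 2)), coeff i.1 g * mu i f) * hessian f =
      ∑ i : Exps n (n * (d - 2)),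
        C (coeff i.1 g) * (monomial i.1 1 - C (mu i f) * hessian f) := by
    refine (congrArg (fun q => q - C (∑ i : Exps n (n * (d - 2)), coeff i.1 g * mu i f) *
      hessian f) h1).trans ?_
    simp only [map_sum, map_mul, Finset.sum_mul, ← Finset.sum_sub_distrib]
    refine Finset.sum_congr rfl fun i _ => ?_
    ring
  rw [h2]
  exact Ideal.sum_mem _ fun i _ => Ideal.mul_mem_left _ _
    (sub_omega_mul_hessian_mem hd hf hs (isHomogeneous_monomial _ i.2))

theorem subst_mem_jacobianIdeal {A : Matrix (Fin n) (Fin n) ℂ} (hA : A.det ≠ 0)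
    {g : MvPolynomial (Fin n) ℂ} (hg : g ∈ jacobianIdeal f) :
    subst A g ∈ jacobianIdeal (subst A f) := by
  have h1 : ∀ l, subst A (pderiv l f) ∈ jacobianIdeal (subst A f) := by
    intro l
    have h2 : subst A (pderiv l f) = ∑ j, C (A⁻¹ j l) * pderiv j (subst A f) := by
      simp only [pderiv_subst, Finset.mul_sum, ← mul_assoc, ← C_mul]
      rw [Finset.sum_comm]
      have h3 : ∀ i, ∑ j, A⁻¹ j l * A i j = if i = l then 1 else 0 := by
        intro i
        have := congrFun (congrFun (Matrix.mul_nonsing_inv A (isUnit_iff_ne_zero.2 hA)) i) l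
        rw [Matrix.mul_apply, Matrix.one_apply] at this
        rw [← this]
        exact Finset.sum_congr rfl fun j _ => mul_comm _ _
      simp only [← Finset.sum_mul, ← map_sum, h3]
      rw [Finset.sum_eq_single l]
      · simp
      · intro i _ hi
        simp [hi]
      · simp
    rw [h2]
    exact Ideal.sum_mem _ fun j _ => Ideal.mul_mem_left _ _ (pderiv_mem_jacobianIdeal _ j)
  rw [jacobianIdeal, Ideal.mem_span_range_iff_exists_fun] at hg
  obtain ⟨q, rfl⟩ := hg
  rw [map_sum]
  refine Ideal.sum_mem _ fun l _ => ?_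
  rw [map_mul]
  exact Ideal.mul_mem_left _ _ (h1 l)

theorem hessian_subst (A : Matrix (Fin n) (Fin n) ℂ) (f : MvPolynomial (Fin n) ℂ) :
    hessian (subst A f) = C (A.det ^ 2) * subst A (hessian f) := by
  have h : (Matrix.of fun i j => pderiv i (pderiv j (subst A f))) =
      (A.map C).transpose * ((subst A).mapMatrix (Matrix.of fun i j => pderiv i (pderiv j f))) *
        A.map C := by
    refine Matrix.ext fun i j => ?_
    simp only [Matrix.of_apply, Matrix.mul_apply, Matrix.transpose_apply, Matrix.map_apply,
      AlgHom.mapMatrix_apply, pderiv_subst, map_sum, pderiv_C_mul]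
    simp only [Finset.mul_sum, Finset.sum_mul]
    refine Finset.sum_congr rfl fun a _ => Finset.sum_congr rfl fun b _ => ?_
    ring
  have hC : (A.map C).det = (C A.det : MvPolynomial (Fin n) ℂ) := by
    rw [RingHom.map_det]
    rfl
  rw [hessian, h, Matrix.det_mul, Matrix.det_mul, Matrix.det_transpose, hC, ← AlgHom.map_det,
    hessian, C_pow]
  ring

/-- Under a linear substitution `A` the functional `omega` is multiplied by `det(A) ^ (-2)`, because
the Hessian is multiplied by `det(A) ^ 2`. -/
theorem omega_subst (hd : 2 ≤ d) (hf : f.IsHomogeneous d) (hs : ¬ IsSingularForm f)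
    {A : Matrix (Fin n) (Fin n) ℂ} (hA : A.det ≠ 0) {g : MvPolynomial (Fin n) ℂ}
    (hg : g.IsHomogeneous (n * (d - 2))) :
    omega f (toMilnor f g) =
      A.det ^ 2 * omega (subst A f) (toMilnor (subst A f) (subst A g)) := by
  have h1 := subst_mem_jacobianIdeal hA (sub_omega_mul_hessian_mem hd hf hs hg)
  have hA2 : A.det ^ 2 ≠ 0 := pow_ne_zero _ hA
  have h2 : omega (subst A f) (toMilnor (subst A f) (subst A g)) =
      omega f (toMilnor f g) * (A.det ^ 2)⁻¹ := by
    refine omega_eq_of_sub_mem hd (isHomogeneous_subst A hf)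
      (fun h => hs ((isSingularForm_subst_iff hd hf hA).1 h)) ?_
    rw [hessian_subst, ← mul_assoc, ← C_mul, mul_assoc, inv_mul_cancel₀ hA2, mul_one]
    rwa [map_sub, map_mul, subst_C] at h1
  rw [h2]
  field_simp

/-- The power `(w₁ z₁ + ⋯ + wₙ zₙ) ^ N` of a linear form. -/
def linearPow {R : Type*} [CommRing R] (N : ℕ) (w : Fin n → R) : MvPolynomial (Fin n) R :=
  (∑ j, C (w j) * X j) ^ N

theorem isHomogeneous_linearPow {R : Type*} [CommRing R] (N : ℕ) (w : Fin n → R) :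
    (linearPow N w).IsHomogeneous N := by
  have h : (∑ j, C (w j) * X j : MvPolynomial (Fin n) R).IsHomogeneous 1 :=
    IsHomogeneous.sum _ _ _ fun j _ => by
      simpa using (isHomogeneous_C (Fin n) (w j)).mul (isHomogeneous_X R j)
  have := h.pow N
  rwa [one_mul] at this

theorem map_linearPow {R R' : Type*} [CommRing R] [CommRing R'] (φ : R →+* R') (N : ℕ)
    (w : Fin n → R) : map φ (linearPow N w) = linearPow N fun j => φ (w j) := by
  simp [linearPow]

theorem subst_linearPow (A : Matrix (Fin n) (Fin n) ℂ) (N : ℕ) (w : Fin n → ℂ) :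
    subst A (linearPow N w) = linearPow N (Matrix.vecMul w A) := by
  rw [linearPow, linearPow, map_pow, map_sum]
  congr 1
  simp only [map_mul, subst_C, subst_X, Matrix.vecMul, dotProduct, map_sum, Finset.mul_sum,
    Finset.sum_mul]
  rw [Finset.sum_comm]
  simp only [mul_assoc]

theorem linearPow_smul (N : ℕ) (c : ℂ) (w : Fin n → ℂ) :
    linearPow N (c • w) = C (c ^ N) * linearPow N w := by
  rw [linearPow, linearPow, C_pow, ← mul_pow, Finset.mul_sum]
  simp [mul_assoc]

theorem associatedForm_eq_omega (w : Fin n → ℂ) :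
    associatedForm d f w = omega f (toMilnor f (linearPow (n * (d - 2)) w)) := by
  rw [associatedForm]
  congr 1
  rw [linearPow]
  change _ = Ideal.Quotient.mk _ _
  rw [map_pow, map_sum]
  congr 2
  funext j
  rw [← smul_eq_C_mul]
  rfl

theorem associatedForm_subst (hd : 2 ≤ d) (hf : f.IsHomogeneous d) (hs : ¬ IsSingularForm f)
    {A : Matrix (Fin n) (Fin n) ℂ} (hA : A.det ≠ 0) (w : Fin n → ℂ) :
    associatedForm d f w =
      A.det ^ 2 * associatedForm d (subst A f) (Matrix.vecMul w A) := by
  rw [associatedForm_eq_omega, associatedForm_eq_omega, ← subst_linearPow,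
    omega_subst hd hf hs hA (isHomogeneous_linearPow _ _)]

end Equivariance

/-! ### Polynomial identities and denominators -/

section Density

variable {n d : ℕ}

/-- A polynomial identity that holds at the forms with `Δ ≠ 0` holds everywhere. -/
theorem evalForm_eq_of_forall_ne_zero {Δ P Q : MvPolynomial (Exps n d) ℂ}
    {A : Matrix (Fin n) (Fin n) ℂ} {c : ℂ}
    (hΔ : ∃ f : MvPolynomial (Fin n) ℂ, f.IsHomogeneous d ∧ evalForm Δ f ≠ 0)
    (h : ∀ f : MvPolynomial (Fin n) ℂ, f.IsHomogeneous d → evalForm Δ f ≠ 0 →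
      evalForm P f = c * evalForm Q (subst A f))
    {f : MvPolynomial (Fin n) ℂ} (hf : f.IsHomogeneous d) :
    evalForm P f = c * evalForm Q (subst A f) := by
  obtain ⟨f₀, hf₀, hΔ₀⟩ := hΔ
  -- the segment from `f` to a form with `Δ ≠ 0`
  let G : MvPolynomial (Fin n) (Polynomial ℂ) :=
    C (1 - Polynomial.X) * map Polynomial.C f + C Polynomial.X * map Polynomial.C f₀
  have hG : ∀ t, map (Polynomial.evalRingHom t) G = C (1 - t) * f + C t * f₀ := by
    intro t
    simp only [G, map_add, map_mul, map_C, map_evalRingHom_comp_C]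
    simp
  have hhom : ∀ t : ℂ, (C (1 - t) * f + C t * f₀).IsHomogeneous d := by
    intro t
    refine IsHomogeneous.add ?_ ?_
    · simpa using (isHomogeneous_C (Fin n) (1 - t)).mul hf
    · simpa using (isHomogeneous_C (Fin n) t).mul hf₀
  have hq : ∀ t, (evalFamily Q (subst (A.map Polynomial.C) G)).eval t =
      evalForm Q (subst A (C (1 - t) * f + C t * f₀)) := by
    intro t
    rw [eval_evalFamily, map_subst, hG]
    congr 3
    ext i j
    simp
  have hmul : evalFamily Δ G * (evalFamily P G -
      Polynomial.C c * evalFamily Q (subst (A.map Polynomial.C) G)) = 0 := by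
    refine Polynomial.funext fun t => ?_
    rw [Polynomial.eval_mul, Polynomial.eval_sub, Polynomial.eval_mul, Polynomial.eval_C,
      eval_evalFamily, eval_evalFamily, hq, hG, Polynomial.eval_zero, mul_eq_zero, sub_eq_zero]
    by_cases h0 : evalForm Δ (C (1 - t) * f + C t * f₀) = 0
    · exact Or.inl h0
    · exact Or.inr (h _ (hhom t) h0)
  have hne : evalFamily Δ G ≠ 0 := by
    intro h0
    have := eval_evalFamily Δ G 1
    rw [h0, hG] at this
    simp only [sub_self, map_zero, zero_mul, zero_add, map_one, one_mul,
      Polynomial.eval_zero] at this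
    exact hΔ₀ this.symm
  have h1 := congrArg (Polynomial.eval 0) ((mul_eq_zero.1 hmul).resolve_left hne)
  rw [Polynomial.eval_sub, Polynomial.eval_mul, Polynomial.eval_C, eval_evalFamily, hq, hG,
    Polynomial.eval_zero, sub_eq_zero] at h1
  simpa using h1

/-- Weighted homogeneity can be tested by scaling with the factor `2`. -/
theorem isWeightedHomogeneous_of_eval_two {τ : Type*} (w : τ → ℕ) {P : MvPolynomial τ ℂ} {k : ℕ}
    (h : ∀ x, eval (fun i => 2 ^ w i * x i) P = 2 ^ k * eval x P) :
    IsWeightedHomogeneous w P k := by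
  classical
  let S : MvPolynomial τ ℂ →ₐ[ℂ] MvPolynomial τ ℂ := aeval fun i => C (2 ^ w i) * X i
  have hS : ∀ (m : τ →₀ ℕ), coeff m (S P) = 2 ^ Finsupp.weight w m * coeff m P := by
    intro m
    clear h
    induction P using MvPolynomial.induction_on' with
    | monomial α c =>
      have : S (monomial α c) = monomial α (2 ^ Finsupp.weight w α * c) := by
        rw [aeval_monomial, monomial_eq (a := _ * c), algebraMap_eq, Finsupp.prod, Finsupp.prod,
          Finsupp.weight_apply, Finsupp.sum, ← Finset.prod_pow_eq_pow_sum]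
        simp only [mul_pow, Finset.prod_mul_distrib, map_mul, map_prod, map_pow, smul_eq_mul,
          pow_mul']
        ring
      rw [this, coeff_monomial, coeff_monomial]
      split_ifs with hα
      · rw [hα]
      · rw [mul_zero]
    | add p q hp hq => rw [map_add, coeff_add, hp, hq, coeff_add, mul_add]
  have hSP : S P = C (2 ^ k) * P := by
    refine MvPolynomial.funext fun x => ?_
    rw [map_mul, eval_C, ← h]
    simp only [S]
    rw [← coe_aeval_eq_eval, ← coe_aeval_eq_eval, RingHom.coe_coe, RingHom.coe_coe,
      ← AlgHom.comp_apply, comp_aeval]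
    congr 2
    funext i
    simp
  intro m hm
  have h1 := hS m
  rw [hSP, coeff_C_mul] at h1
  have h2 : (2 : ℂ) ^ k = 2 ^ Finsupp.weight w m := mul_right_cancel₀ hm h1
  exact (Nat.pow_right_injective le_rfl (by exact_mod_cast h2)).symm

variable {Δ : MvPolynomial (Exps n d) ℂ}

/-- At a nonsingular form some `μ_i` is nonzero. -/
theorem exists_mu_ne_zero (hd : 2 ≤ d) {f : MvPolynomial (Fin n) ℂ} (hf : f.IsHomogeneous d)
    (hs : ¬ IsSingularForm f) : ∃ i : Exps n (n * (d - 2)), mu i f ≠ 0 := by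
  by_contra! hall
  have h1 := omega_toMilnor_eq_sum hd hf hs (isHomogeneous_hessian hf)
  have h2 : omega f (toMilnor f (hessian f)) = 1 := by
    refine omega_eq_of_sub_mem hd hf hs ?_
    rw [C_1, one_mul, sub_self]
    exact Ideal.zero_mem _
  rw [h2] at h1
  simp [hall] at h1

/-- A nonzero `μ_i` is not polynomial, because it is homogeneous of the negative degree `-n`. -/
theorem not_clearsDenominator_zero (hn : 0 < n) (hd : 2 ≤ d)
    (h0 : ∀ f : MvPolynomial (Fin n) ℂ, f.IsHomogeneous d → (evalForm Δ f = 0 ↔ IsSingularForm f))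
    {f : MvPolynomial (Fin n) ℂ} (hf : f.IsHomogeneous d) (hs : ¬ IsSingularForm f)
    {i : Exps n (n * (d - 2))} (hi : mu i f ≠ 0) : ¬ ClearsDenominator Δ (mu i) 0 := by
  rintro ⟨P, hP⟩
  have hP' : ∀ f : MvPolynomial (Fin n) ℂ, f.IsHomogeneous d → ¬ IsSingularForm f →
      evalForm P f = mu i f := by
    intro f hf hs
    rw [hP f hf fun h => hs ((h0 f hf).1 h), pow_zero, one_mul]
  have hmon : (monomial i.1 (1 : ℂ)).IsHomogeneous (n * (d - 2)) := isHomogeneous_monomial _ i.2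
  let G : MvPolynomial (Fin n) (Polynomial ℂ) := C (Polynomial.X ^ d) * map Polynomial.C f
  have hG : ∀ s, map (Polynomial.evalRingHom s) G = C (s ^ d) * f := by
    intro s
    simp only [G, map_mul, map_C, map_evalRingHom_comp_C]
    simp
  have key : ∀ s : ℂ, s ≠ 0 →
      (s ^ n) ^ 2 * (s ^ (n * (d - 2)) * (evalFamily P G).eval s) = mu i f := by
    intro s hs0
    have hdet : (s • (1 : Matrix (Fin n) (Fin n) ℂ)).det = s ^ n := by
      simp
    have hA : (s • (1 : Matrix (Fin n) (Fin n) ℂ)).det ≠ 0 := by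
      rw [hdet]
      exact pow_ne_zero _ hs0
    have h1 := omega_subst hd hf hs hA hmon
    have hf' := isHomogeneous_subst (s • (1 : Matrix (Fin n) (Fin n) ℂ)) hf
    have hs' : ¬ IsSingularForm (subst (s • (1 : Matrix (Fin n) (Fin n) ℂ)) f) :=
      fun h => hs ((isSingularForm_subst_iff hd hf hA).1 h)
    have h2 := omega_toMilnor_eq_sum hd hf' hs'
      (isHomogeneous_subst (s • (1 : Matrix (Fin n) (Fin n) ℂ)) hmon)
    rw [Finset.sum_eq_single i, subst_smul_one s hmon] at h2
    · rw [subst_smul_one s hmon, h2, hdet, coeff_smul, coeff_monomial, if_pos rfl, smul_eq_mul,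
        mul_one, ← hP' _ hf' hs', subst_smul_one s hf, smul_eq_C_mul, ← hG, ← eval_evalFamily] at h1
      exact h1.symm
    · intro j _ hj
      rw [subst_smul_one s hmon, coeff_smul, coeff_monomial, if_neg, smul_zero, zero_mul]
      exact fun h => hj (Subtype.ext h.symm)
    · simp
  have hpoly : (Polynomial.X ^ n) ^ 2 * (Polynomial.X ^ (n * (d - 2)) * evalFamily P G) =
      Polynomial.C (mu i f) := by
    refine Polynomial.eq_of_infinite_eval_eq _ _
      (Set.Infinite.mono ?_ (Set.finite_singleton (0 : ℂ)).infinite_compl)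
    intro s hs
    have hs : s ≠ 0 := hs
    simpa using key s hs
  have := congrArg (Polynomial.eval 0) hpoly
  simp [hn.ne'] at this
  exact hi this.symm

end Density

/-! ### Contravariants -/

section Contravariant

variable {n d : ℕ}

/-- The polynomial function on forms obtained from a function of `(f, z*)` by fixing `z*`. -/
def fixDual (L : MvPolynomial (Exps n d ⊕ Fin n) ℂ) (w : Fin n → ℂ) : MvPolynomial (Exps n d) ℂ :=
  aeval (Sum.elim X fun j => C (w j)) L

theorem evalForm_fixDual (L : MvPolynomial (Exps n d ⊕ Fin n) ℂ) (w : Fin n → ℂ)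
    (f : MvPolynomial (Fin n) ℂ) : evalForm (fixDual L w) f = evalPair L f w := by
  rw [evalForm, fixDual, evalPair, ← coe_aeval_eq_eval, ← coe_aeval_eq_eval, RingHom.coe_coe,
    RingHom.coe_coe, ← AlgHom.comp_apply, comp_aeval]
  congr 2
  funext i
  rcases i with i | i <;> simp

/-- The contravariant with coefficients `Pᵢ`, that is, the sum of the products of the `Pᵢ` with the
coefficients of `(z₁* z₁ + ⋯ + zₙ* zₙ) ^ N` at `z ^ i`, which are polynomials in `z*`. -/
def contravariantOf {N : ℕ} (P : Exps n N → MvPolynomial (Exps n d) ℂ) :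
    MvPolynomial (Exps n d ⊕ Fin n) ℂ :=
  ∑ i, rename Sum.inl (P i) *
    rename Sum.inr (coeff i.1 (linearPow N (X : Fin n → MvPolynomial (Fin n) ℂ)))

theorem evalPair_contravariantOf {N : ℕ} (P : Exps n N → MvPolynomial (Exps n d) ℂ)
    (f : MvPolynomial (Fin n) ℂ) (w : Fin n → ℂ) :
    evalPair (contravariantOf P) f w = ∑ i, evalForm (P i) f * coeff i.1 (linearPow N w) := by
  rw [evalPair, contravariantOf, map_sum]
  refine Finset.sum_congr rfl fun i _ => ?_
  rw [map_mul, eval_rename, eval_rename, Sum.elim_comp_inl, Sum.elim_comp_inr, ← coeff_map,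
    map_linearPow]
  simp only [eval_X]
  rfl

theorem evalPair_contravariantOf_smul {N : ℕ} (P : Exps n N → MvPolynomial (Exps n d) ℂ)
    (f : MvPolynomial (Fin n) ℂ) (c : ℂ) (w : Fin n → ℂ) :
    evalPair (contravariantOf P) f (c • w) = c ^ N * evalPair (contravariantOf P) f w := by
  rw [evalPair_contravariantOf, evalPair_contravariantOf, Finset.mul_sum]
  refine Finset.sum_congr rfl fun i _ => ?_
  rw [linearPow_smul, coeff_C_mul]
  ring

theorem hasClass_contravariantOf {N : ℕ} (P : Exps n N → MvPolynomial (Exps n d) ℂ) :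
    HasClass (contravariantOf P) N := by
  refine isWeightedHomogeneous_of_eval_two _ fun x => ?_
  have h := evalPair_contravariantOf_smul P (form fun m => x (Sum.inl m)) 2 fun j => x (Sum.inr j)
  rw [evalPair, evalPair, coords_form] at h
  have e1 : (fun i => 2 ^ (Sum.elim (fun _ => 0) (fun _ => 1) : Exps n d ⊕ Fin n → ℕ) i * x i) =
      Sum.elim (fun m => x (Sum.inl m)) ((2 : ℂ) • fun j => x (Sum.inr j)) := by
    funext i
    rcases i with i | i <;> simp
  have e2 : x = Sum.elim (fun m => x (Sum.inl m)) fun j => x (Sum.inr j) := by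
    funext i
    rcases i with i | i <;> simp
  rw [e1, h]
  conv_rhs => rw [e2]

variable {Δ : MvPolynomial (Exps n d) ℂ} {L : MvPolynomial (Exps n d ⊕ Fin n) ℂ} {E : ℕ}

/-- If `Δ(f(A z)) = det(A) ^ E Δ(f)` and `L = Δ Φ` at the nonsingular forms, then `L` has weight
`E - 2`, as `Φ` contributes the factor `det(A) ^ (-2)`. -/
theorem isContravariant_of_eq_mul_associatedForm (hd : 2 ≤ d) (hE : 2 ≤ E)
    (h0 : ∀ f : MvPolynomial (Fin n) ℂ, f.IsHomogeneous d → (evalForm Δ f = 0 ↔ IsSingularForm f))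
    (hne : ∃ f : MvPolynomial (Fin n) ℂ, f.IsHomogeneous d ∧ ¬ IsSingularForm f)
    (hΔ : ∀ f : MvPolynomial (Fin n) ℂ, f.IsHomogeneous d → ∀ A : Matrix (Fin n) (Fin n) ℂ,
      A.det ≠ 0 → evalForm Δ (subst A f) = A.det ^ E * evalForm Δ f)
    (hL : ∀ f : MvPolynomial (Fin n) ℂ, f.IsHomogeneous d → evalForm Δ f ≠ 0 → ∀ w : Fin n → ℂ,
      evalPair L f w = evalForm Δ f * associatedForm d f w) :
    IsContravariant L (E - 2) := by
  intro f hf w g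
  obtain ⟨f₀, hf₀, hs₀⟩ := hne
  have hdet : g.val.det * (g⁻¹).val.det = 1 := by
    rw [← Matrix.det_mul, ← Units.val_mul, mul_inv_cancel, Units.val_one, Matrix.det_one]
  have hA : (g⁻¹).val.det ≠ 0 := right_ne_zero_of_mul (hdet ▸ one_ne_zero)
  rw [actForm_eq_subst, actDual, ← evalForm_fixDual, ← evalForm_fixDual]
  refine evalForm_eq_of_forall_ne_zero (Δ := Δ)
    ⟨f₀, hf₀, fun h => hs₀ ((h0 f₀ hf₀).1 h)⟩ (fun f hf hΔf => ?_) hf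
  have hs : ¬ IsSingularForm f := fun h => hΔf ((h0 f hf).2 h)
  have hΔf' : evalForm Δ (subst (g⁻¹).val f) ≠ 0 := by
    rw [hΔ f hf _ hA]
    exact mul_ne_zero (pow_ne_zero _ hA) hΔf
  rw [evalForm_fixDual, evalForm_fixDual, hL f hf hΔf, hL _ (isHomogeneous_subst _ hf) hΔf',
    hΔ f hf _ hA, associatedForm_subst hd hf hs hA w]
  obtain ⟨k, rfl⟩ : ∃ k, E = k + 2 := ⟨E - 2, by omega⟩
  rw [Nat.add_sub_cancel, pow_add]
  have h1 : g.val.det ^ k * (g⁻¹).val.det ^ k = 1 := by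
    rw [← mul_pow, hdet, one_pow]
  linear_combination (-(evalForm Δ f * ((g⁻¹).val.det ^ 2 *
    associatedForm d (subst (g⁻¹).val f) (Matrix.vecMul w (g⁻¹).val)))) * h1

/-- The degree of a contravariant follows from its weight and class, applied to scalar matrices. -/
theorem hasDegree_of_isContravariant {k N K : ℕ} (hd : 0 < d) (hkN : n * k = N + d * K)
    (hL : IsContravariant L k)
    (hN : ∀ (f : MvPolynomial (Fin n) ℂ) (c : ℂ) (w : Fin n → ℂ),
      evalPair L f (c • w) = c ^ N * evalPair L f w) : HasDegree L K := by
  obtain ⟨s, hs⟩ := IsAlgClosed.exists_pow_nat_eq (2 : ℂ) hd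
  have hs0 : s ≠ 0 := by
    rintro rfl
    rw [zero_pow hd.ne'] at hs
    exact two_ne_zero hs.symm
  have hdet : (s • (1 : Matrix (Fin n) (Fin n) ℂ)).det = s ^ n := by simp
  let g : GL (Fin n) ℂ := Matrix.GeneralLinearGroup.mkOfDetNeZero
    (s • (1 : Matrix (Fin n) (Fin n) ℂ)) (by rw [hdet]; exact pow_ne_zero _ hs0)
  refine isWeightedHomogeneous_of_eval_two _ fun x => ?_
  have hf := isHomogeneous_form fun m : Exps n d => x (Sum.inl m)
  have h1 := hL _ hf (fun j => x (Sum.inr j)) g⁻¹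
  have h2 : (g⁻¹⁻¹).val = s • (1 : Matrix (Fin n) (Fin n) ℂ) := by
    rw [inv_inv]
    rfl
  have h3 : (g⁻¹).val.det * s ^ n = 1 := by
    rw [← hdet, ← h2, inv_inv, ← Matrix.det_mul, ← Units.val_mul, inv_mul_cancel, Units.val_one,
      Matrix.det_one]
  have h4 : (g⁻¹).val.det ^ k * s ^ (n * k) = 1 := by
    rw [pow_mul, ← mul_pow, h3, one_pow]
  rw [actForm_eq_subst, actDual, h2, subst_smul_one s hf, hs, Matrix.vecMul_smul, Matrix.vecMul_one,
    hN] at h1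
  have h5 : (2 : ℂ) • form (fun m : Exps n d => x (Sum.inl m)) =
      form fun m => 2 * x (Sum.inl m) := by
    simp [form, Finset.smul_sum, smul_monomial]
  rw [h5, evalPair, evalPair, coords_form, coords_form] at h1
  have e1 : (fun i => 2 ^ (Sum.elim (fun _ => 1) (fun _ => 0) : Exps n d ⊕ Fin n → ℕ) i * x i) =
      Sum.elim (fun m => 2 * x (Sum.inl m)) fun j => x (Sum.inr j) := by
    funext i
    rcases i with i | i <;> simp
  have e2 : Sum.elim (fun m => x (Sum.inl m)) (fun j => x (Sum.inr j)) = x := by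
    funext i
    rcases i with i | i <;> simp
  rw [e2] at h1
  rw [e1]
  generalize eval (Sum.elim (fun m => 2 * x (Sum.inl m)) fun j => x (Sum.inr j)) L = a at *
  generalize eval x L = b at *
  rw [hkN, pow_add, pow_mul, hs] at h4
  refine mul_left_cancel₀ (pow_ne_zero N hs0) ?_
  rw [h1]
  linear_combination (-(s ^ N * a)) * h4

end Contravariant

end

end AssocForm

open AssocForm

theorem proposition4p1 (n d : ℕ) (hn : n = 2 ∨ n = 3) (hd : 3 ≤ d) :
    (∃ Δ : MvPolynomial (AssocForm.Exps n d) ℂ, AssocForm.IsDiscriminant n d Δ) ∧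
    ∀ Δ : MvPolynomial (AssocForm.Exps n d) ℂ, AssocForm.IsDiscriminant n d Δ →
      (∃ p : AssocForm.Exps n (n * (d - 2)) → ℕ,
        (∀ i, IsLeast {q : ℕ | AssocForm.ClearsDenominator Δ (AssocForm.mu i) q} (p i)) ∧
        IsGreatest (Set.range p) 1) ∧
      ∃ L : MvPolynomial (AssocForm.Exps n d ⊕ Fin n) ℂ,
        (∀ f : MvPolynomial (Fin n) ℂ, f.IsHomogeneous d → AssocForm.evalForm Δ f ≠ 0 →
          ∀ w : Fin n → ℂ,
            AssocForm.evalPair L f w =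
              AssocForm.evalForm Δ f * AssocForm.associatedForm d f w) ∧
        AssocForm.IsContravariant L (d * (d - 1) ^ (n - 1) - 2) ∧
        AssocForm.HasDegree L (n * (d - 1) ^ (n - 1) - n) ∧
        AssocForm.HasClass L (n * (d - 2)) := by
  have hn0 : 0 < n := by omega
  have hd2 : 2 ≤ d := by omega
  let e : Exps n ((n - 1) * (d - 2)) ≃ SylvesterCols n d :=
    Fintype.equivOfCardEq (card_sylvesterCols hn hd).symm
  have hD : IsDiscriminant n d (discDet e) := isDiscriminant_discDet hn hd e
  refine ⟨⟨discDet e, hD⟩, fun Δ hΔ => ?_⟩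
  obtain ⟨c, -, hc⟩ := hD.exists_eq_C_mul hΔ
  have hc' : ∀ f, evalForm Δ f = c * evalForm (discDet e) f := by
    intro f
    rw [hc, evalForm, map_mul, MvPolynomial.eval_C]
    rfl
  have hP : ∀ i : Exps n (n * (d - 2)), ∃ P : MvPolynomial (Exps n d) ℂ,
      ∀ f : MvPolynomial (Fin n) ℂ, f.IsHomogeneous d → ¬ IsSingularForm f →
        evalForm P f = evalForm Δ f * mu i f := by
    intro i
    obtain ⟨P, hP⟩ := exists_evalForm_eq_discDet_mul_mu e hn0 hd2 i
    refine ⟨MvPolynomial.C c * P, fun f hf hs => ?_⟩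
    rw [hc', mul_assoc, ← hP f hf hs, evalForm, map_mul, MvPolynomial.eval_C]
    rfl
  choose P hP using hP
  obtain ⟨f₀, hf₀, hs₀⟩ := exists_not_isSingularForm hn hd
  refine ⟨?_, contravariantOf P, ?_⟩
  · classical
    have hone : ∀ i : Exps n (n * (d - 2)), ClearsDenominator Δ (mu i) 1 := fun i =>
      ⟨P i, fun f hf hΔf => by
        rw [pow_one, hP i f hf fun h => hΔf ((hΔ.2 f hf).2 h)]⟩
    refine ⟨fun i => Nat.find ⟨1, hone i⟩, fun i => ⟨Nat.find_spec ⟨1, hone i⟩, fun q hq =>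
      Nat.find_min' ⟨1, hone i⟩ hq⟩, ?_, ?_⟩
    · obtain ⟨i, hi⟩ := exists_mu_ne_zero hd2 hf₀ hs₀
      refine ⟨i, le_antisymm (Nat.find_min' _ (hone i)) ?_⟩
      rw [Nat.one_le_iff_ne_zero]
      intro h
      have h1 := Nat.find_spec ⟨1, hone i⟩
      rw [show Nat.find ⟨1, hone i⟩ = 0 from h] at h1
      exact not_clearsDenominator_zero hn0 hd2 hΔ.2 hf₀ hs₀ hi h1
    · rintro _ ⟨i, rfl⟩
      exact Nat.find_min' _ (hone i)
  · have hL : ∀ f : MvPolynomial (Fin n) ℂ, f.IsHomogeneous d → evalForm Δ f ≠ 0 →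
        ∀ w : Fin n → ℂ,
          evalPair (contravariantOf P) f w = evalForm Δ f * associatedForm d f w := by
      intro f hf hΔf w
      have hs : ¬ IsSingularForm f := fun h => hΔf ((hΔ.2 f hf).2 h)
      rw [associatedForm_eq_omega, omega_toMilnor_eq_sum hd2 hf hs (isHomogeneous_linearPow _ _),
        evalPair_contravariantOf, Finset.mul_sum]
      refine Finset.sum_congr rfl fun i _ => ?_
      rw [hP i f hf hs]
      ring
    have hM : 1 ≤ (d - 1) ^ (n - 1) := Nat.one_le_pow _ _ (by omega)
    have hE : 2 ≤ d * (d - 1) ^ (n - 1) := hd2.trans (Nat.le_mul_of_pos_right d hM)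
    have hcon : IsContravariant (contravariantOf P) (d * (d - 1) ^ (n - 1) - 2) := by
      refine isContravariant_of_eq_mul_associatedForm hd2 hE hΔ.2 ⟨f₀, hf₀, hs₀⟩ ?_ hL
      intro f hf A hA
      rw [hc', hc', evalForm_discDet_subst hn hd e hf hA]
      ring
    refine ⟨hL, hcon, ?_, hasClass_contravariantOf P⟩
    refine hasDegree_of_isContravariant (N := n * (d - 2)) (by omega) ?_ hcon
      fun f c w => evalPair_contravariantOf_smul P f c w
    generalize (d - 1) ^ (n - 1) = M at hM hE
    obtain ⟨M, rfl⟩ : ∃ k, M = k + 1 := ⟨M - 1, by omega⟩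
    obtain ⟨d, rfl⟩ : ∃ k, d = k + 2 := ⟨d - 2, by omega⟩
    have e1 : (d + 2) * (M + 1) - 2 = d * (M + 1) + 2 * M := by
      rw [Nat.sub_eq_iff_eq_add hE]
      ring
    have e2 : n * (M + 1) - n = n * M := by
      rw [mul_add, mul_one, Nat.add_sub_cancel]
    rw [e1, e2, Nat.add_sub_cancel]
    ring
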